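/- Let $\Omega=\mathbb T^d=\mathbb R^d/\mathbb Z^d$ with Lebesgue measure, $(u,v)=\int_\Omega u\cdot v\,dx$, and let $A:B$ be the Frobenius product of matrices. Let $F:\mathbb R^n\to\mathbb R^{N\times N}_s$ be a $C^2$ map into the symmetric matrices, and let $L$ be the constant-coefficient differential operator $$L(\Xi)_i=\sum_{j=0}^{\nu}\sum_{l,m=1}^N\sum_{|\alpha|=j}b_{ilm\alpha}\,\partial_\alpha\Xi_{lm},\qquad i=1,\dots,n,$$ acting on symmetric matrix fields, with formal adjoint $L^*$ (with values in symmetric matrix fields). Put $$K(v)=\tfrac12\operatorname{tr}(F(v)-F(0)),\qquad v^{\#}=\nabla K(v).$$ A Young function is an even convex $\Phi:\mathbb R\to[0,\infty)$ vanishing only at $0$ with $\Phi(s)/s\to0$ as $s\to0$ and $\Phi(s)/s\to\infty$ as $s\to+\infty$; an $N$-function is an even convex $A:\mathbb R^n\to[0,\infty)$ with $\Phi_-(|y|)\le A(y)\le\Phi_+(|y|)$ for two Young functions $\Phi_\pm$; it satisfies the $\Delta_2$-condition if $A(2y)\le C(A(y)+1)$ for all $y$, with some constant $C$. $L_A(Q;\mathbb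 R^n)$ is the set of measurable $f:Q\to\mathbb R^n$ with $\int_QA(f)<\infty$, with the Luxemburg norm $\|f\|=\inf\{\lambda>0:\int_QA(f/\lambda)\le1\}$. $A^*$ is the Legendre transform of $A$. Assume: 1. $K$ is strictly convex and is an $N$-function, and both $K$ and $K^*$ satisfy the $\Delta_2$-condition. 2. Let $\Lambda$ be the smallest linear space of symmetric matrices that contains $I$ and all values $L^*(u)(x)$, $u\in C^\infty(\Omega;\mathbb R^n)$, $x\in\Omega$, and let $\pi_\Lambda$ be the Frobenius-orthogonal projection onto $\Lambda$. For every nonnegative-definite $P\in\Lambda$ the function $v\mapsto F(v):P$ is convex and nonnegative, and $|\pi_\Lambda\partial_lF(v)|\le C(|\nabla K(v)|+1)$ for all $v$ and $l$, with some constant $C$. 3. (Formal conservativity) $(F(v),L^*(v^{\#}))=0$ for every $v:\Omega\to\mathbb R^n$ such that $v^{\#}$ is smooth. Let $T>0$, $v_0\in L_K(\Omega;\mathbb R^n)$, let $\kappa$ be a positive measurable function bounded away from $0$ and $\infty$ on $[0,T]$, and $\mathcal K(t)=\int_t^T\kappa(s)\,ds$. A weak solution of $\partial_tv=L(F(v))$,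 $v(0)=v_0$, is a $v\in L_K((0,T)\times\Omega;\mathbb R^n)$ with $$\int_0^T[(v-v_0,E)+(F(v),B)]\,dt=0$$ for all $(E,B)\in L_{K^*}((0,T)\times\Omega;\mathbb R^n)\times L^\infty((0,T)\times\Omega;\mathbb R^{N\times N}_s)$ such that $\int_0^T[(B,\partial_t\Psi)+(E,L\Psi)]\,dt=0$ for all smooth $\Psi:[0,T]\times\Omega\to\mathbb R^{N\times N}_s$ with $\Psi(0)=0$. A strong solution is a weak solution $v$ with $\partial_t(\mathcal K v^{\#})\in L_{K^*}((0,T)\times\Omega;\mathbb R^n)$ and $\mathcal K L^*(v^{\#})\in L^\infty((0,T)\times\Omega;\mathbb R^{N\times N}_s)$ (derivatives in the sense of distributions) such that $$\partial_t(v^{\#})_l+L^*(v^{\#}):\partial_lF(v)=0,\quad l=1,\dots,n,\qquad v^{\#}(0,\cdot)=v_0^{\#}$$ a.e. in $(0,T)\times\Omega$ and a.e. in $\Omega$, respectively. Here $v^{\#}(0,\cdot)$ is the value at $t=0$ of the version of $v$ with $v^{\#}\in C([0,T);L_{K^*}(\Omega;\mathbb R^n))$. Then, for every strong solution $v$, such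 a time-continuous version exists, and for it the total entropy $$K(t)=\int_\Omega K(v(t,x))\,dx$$ is finite for every $t\in[0,T)$, is a continuous function of $t\in[0,T)$, and is conserved: $K(t)=K(0)=\int_\Omega K(v_0)\,dx$ for all $t\in[0,T)$. -/

import Mathlib

open MeasureTheory Set Filter Topology
open scoped ContDiff ENNReal

noncomputable section

namespace EntropyCons

/-! ### The periodic box and smooth functions -/

/-- The phase space `ℝⁿ` with its Euclidean structure. -/
abbrev Vec (n : ℕ) := EuclideanSpace ℝ (Fin n)

/-- `N × N` real matrices. -/
abbrev Mat (N : ℕ) := Matrix (Fin N) (Fin N) ℝ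

/-- The periodic box `𝕋^d = ℝ^d / ℤ^d`, with Lebesgue measure `volume`. -/
abbrev Box (d : ℕ) := UnitAddTorus (Fin d)

/-- The quotient map `ℝ^d → 𝕋^d`. -/
def toBox {d : ℕ} (y : Fin d → ℝ) : Box d := fun i => (y i : UnitAddCircle)

/-- Smooth functions on the periodic box: the periodic lift is `C^∞`. -/
def SmoothBox {d : ℕ} {E : Type*} [NormedAddCommGroup E] [NormedSpace ℝ E]
    (f : Box d → E) : Prop :=
  ContDiff ℝ ∞ (fun y : Fin d → ℝ => f (toBox y))

/-- Smooth functions of time and space: the lift, periodic in space, is `C^∞`. -/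
def SmoothTimeBox {d : ℕ} {E : Type*} [NormedAddCommGroup E] [NormedSpace ℝ E]
    (f : ℝ × Box d → E) : Prop :=
  ContDiff ℝ ∞ (fun p : ℝ × (Fin d → ℝ) => f (p.1, toBox p.2))

/-- The space-time cylinder `(0,T) × Ω`. -/
def cylinder (d : ℕ) (T : ℝ) : Set (ℝ × Box d) := Ioo 0 T ×ˢ univ

/-- Lebesgue measure on `(0,T) × Ω`. -/
def cylMeasure (d : ℕ) (T : ℝ) : Measure (ℝ × Box d) := volume.restrict (cylinder d T)

/-- The partial derivative `∂_i` of a scalar function on the box. -/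
def partialD {d : ℕ} (i : Fin d) (f : Box d → ℝ) (x : Box d) : ℝ :=
  deriv (fun s : ℝ => f (x + Pi.single i (s : UnitAddCircle))) 0

/-- The iterated partial derivative `∂_α` for a multiindex `α`. -/
def multiD {d : ℕ} (α : Fin d → ℕ) (f : Box d → ℝ) : Box d → ℝ :=
  (List.finRange d).foldr (fun i g => (partialD i)^[α i] g) f

/-- The time derivative of a vector function of `(t, x)`. -/
def timeD {d n : ℕ} (a : ℝ × Box d → Vec n) (p : ℝ × Box d) : Vec n :=
  deriv (fun s : ℝ => a (s, p.2)) p.1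

/-- The entrywise time derivative of a matrix function of `(t, x)`. -/
def timeDMat {d N : ℕ} (Ψ : ℝ × Box d → Mat N) (p : ℝ × Box d) : Mat N :=
  Matrix.of fun i j => deriv (fun s : ℝ => Ψ (s, p.2) i j) p.1

/-! ### Matrices -/

/-- The Frobenius product `A : B`. -/
def frob {N : ℕ} (A B : Mat N) : ℝ := ∑ i, ∑ j, A i j * B i j

/-- The identification of `N × N` matrices with the Euclidean space `ℝ^{N × N}`; it carries the
Frobenius product to the Euclidean inner product. -/
def frobVec (N : ℕ) : Mat N →ₗ[ℝ] EuclideanSpace ℝ (Fin N × Fin N) where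
  toFun A := WithLp.toLp 2 fun p => A p.1 p.2
  map_add' _ _ := rfl
  map_smul' _ _ := rfl

theorem inner_frobVec {N : ℕ} (A B : Mat N) :
    inner ℝ (frobVec N A) (frobVec N B) = frob A B := by
  have h : ∀ (C : Mat N) p, (frobVec N C) p = C p.1 p.2 := fun _ _ => rfl
  simp [frob, PiLp.inner_apply, Fintype.sum_prod_type, mul_comm, h]

/-! ### The constant coefficient operator `L` and its adjoint -/

/-- The coefficients `b_{ilmα}` of the operator. -/
abbrev Coeff (d n N : ℕ) := Fin n → Fin N → Fin N → (Fin d → ℕ) → ℝ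

/-- `L(Ξ)_i = ∑_{j ≤ ν} ∑_{l,m} ∑_{|α| = j} b_{ilmα} ∂_α Ξ_{lm}`. -/
def opL {d n N : ℕ} (ν : ℕ) (b : Coeff d n N) (Ξ : Box d → Mat N) (x : Box d) : Vec n :=
  WithLp.toLp 2 fun i => ∑ j ∈ Finset.range (ν + 1), ∑ l, ∑ m,
    ∑ α ∈ Finset.piAntidiag (Finset.univ : Finset (Fin d)) j,
      b i l m α * multiD α (fun y => Ξ y l m) x

/-- The formal adjoint `L^*` of `L`, where `L` acts on symmetric matrix fields; its values are
symmetric matrices, `(L^* a)_{lm} = ∑_{j ≤ ν} ∑_i ∑_{|α| = j} (-1)^j (b_{ilmα}+b_{imlα})/2 ∂_α a_i`,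
so that `∫ Ξ : L^* a = ∫ L Ξ · a` for smooth symmetric `Ξ`. -/
def opLstar {d n N : ℕ} (ν : ℕ) (b : Coeff d n N) (a : Box d → Vec n) (x : Box d) : Mat N :=
  Matrix.of fun l m => ∑ j ∈ Finset.range (ν + 1), ∑ i,
    ∑ α ∈ Finset.piAntidiag (Finset.univ : Finset (Fin d)) j,
      (-1) ^ j * ((b i l m α + b i m l α) / 2) * multiD α (fun y => a y i) x

/-- The smallest linear space of matrices that contains `I` and all values `L^*(u)(x)`,
`u` smooth. -/
def Lam {d n N : ℕ} (ν : ℕ) (b : Coeff d n N) : Submodule ℝ (Mat N) :=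
  Submodule.span ℝ ({1} ∪ {P | ∃ u : Box d → Vec n, SmoothBox u ∧ ∃ x, P = opLstar ν b u x})

/-- The Frobenius norm `|π_Λ A|` of the Frobenius-orthogonal projection of `A` onto `Λ`. -/
def projNorm {N : ℕ} (Λ : Submodule ℝ (Mat N)) (A : Mat N) : ℝ :=
  ‖(Λ.map (frobVec N)).starProjection (frobVec N A)‖

/-! ### `N`-functions and anisotropic Orlicz spaces -/

/-- Young functions. -/
structure IsYoung (Φ : ℝ → ℝ) : Prop where
  convex : ConvexOn ℝ univ Φ
  nonneg : ∀ s, 0 ≤ Φ s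
  even : ∀ s, Φ (-s) = Φ s
  zero_iff : ∀ s, Φ s = 0 ↔ s = 0
  lim_zero : Tendsto (fun s => Φ s / s) (𝓝[≠] 0) (𝓝 0)
  lim_top : Tendsto (fun s => Φ s / s) atTop atTop

/-- (Anisotropic) `N`-functions. -/
structure IsNFunction {n : ℕ} (A : Vec n → ℝ) : Prop where
  convex : ConvexOn ℝ univ A
  nonneg : ∀ y, 0 ≤ A y
  even : ∀ y, A (-y) = A y
  bounds : ∃ Φ₁ Φ₂ : ℝ → ℝ, IsYoung Φ₁ ∧ IsYoung Φ₂ ∧ ∀ y, Φ₁ ‖y‖ ≤ A y ∧ A y ≤ Φ₂ ‖y‖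

/-- The `Δ₂`-condition. -/
def DeltaTwo {n : ℕ} (A : Vec n → ℝ) : Prop :=
  ∃ C : ℝ, ∀ y, A ((2 : ℝ) • y) ≤ C * (A y + 1)

/-- The Legendre transform `A^*`. -/
def legendre {n : ℕ} (A : Vec n → ℝ) (y : Vec n) : ℝ := ⨆ z, (inner ℝ y z - A z)

/-- The anisotropic Orlicz class `L_A(Q; ℝⁿ)`: measurable functions with finite modular. -/
def MemOrlicz {Q : Type*} [MeasurableSpace Q] {n : ℕ} (A : Vec n → ℝ) (μ : Measure Q)
    (f : Q → Vec n) : Prop :=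
  AEStronglyMeasurable f μ ∧ Integrable (fun q => A (f q)) μ

/-- The Luxemburg norm. -/
def luxemburg {Q : Type*} [MeasurableSpace Q] {n : ℕ} (A : Vec n → ℝ) (μ : Measure Q)
    (f : Q → Vec n) : ℝ :=
  sInf {r : ℝ | 0 < r ∧ Integrable (fun q => A (r⁻¹ • f q)) μ ∧ ∫ q, A (r⁻¹ • f q) ∂μ ≤ 1}

/-! ### The entropy and the structural conditions on the flux `F` -/

/-- The entropy function `K(v) = ½ tr (F(v) - F(0))`. -/
def entropy {n N : ℕ} (F : Vec n → Mat N) (v : Vec n) : ℝ := (1 / 2) * (F v - F 0).trace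

/-- The sharp vector `v^# = ∇K(v)`. -/
def sharp {n N : ℕ} (F : Vec n → Mat N) (v : Vec n) : Vec n := gradient (entropy F) v

/-- The partial derivative `∂_l F(v)`. -/
def partialF {n N : ℕ} (F : Vec n → Mat N) (l : Fin n) (v : Vec n) : Mat N :=
  Matrix.of fun i j => fderiv ℝ (fun u => F u i j) v (EuclideanSpace.single l 1)

/-- The entropy is strictly convex, is an `N`-function, and satisfies the `Δ₂`-condition together
with its Legendre transform. -/
structure EntropyAssumption {n N : ℕ} (F : Vec n → Mat N) : Prop where
  strictConvex : StrictConvexOn ℝ univ (entropy F)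
  nFunction : IsNFunction (entropy F)
  deltaTwo : DeltaTwo (entropy F)
  deltaTwo_legendre : DeltaTwo (legendre (entropy F))

/-- `Λ`-convexity: `F : P` is convex for every nonnegative-definite `P ∈ Λ`. -/
def LambdaConvex {n N : ℕ} (Λ : Submodule ℝ (Mat N)) (F : Vec n → Mat N) : Prop :=
  ∀ P ∈ Λ, P.PosSemidef → ConvexOn ℝ univ (fun v => frob (F v) P)

/-- `F ≥ 0` in the `Λ`-order, and `|π_Λ ∂_l F(v)| ≲ |∇K(v)| + 1`. -/
structure LambdaOrderAssumption {n N : ℕ} (Λ : Submodule ℝ (Mat N)) (F : Vec n → Mat N) :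
    Prop where
  nonneg : ∀ v, ∀ P ∈ Λ, P.PosSemidef → 0 ≤ frob (F v) P
  growth : ∃ C : ℝ, ∀ l v, projNorm Λ (partialF F l v) ≤ C * (‖sharp F v‖ + 1)

/-- The formal conservativity condition: `(F(v), L^*(v^#)) = 0` whenever `v^#` is smooth. -/
def FormallyConservative {d n N : ℕ} (ν : ℕ) (b : Coeff d n N) (F : Vec n → Mat N) : Prop :=
  ∀ v : Box d → Vec n, SmoothBox (fun x => sharp F (v x)) →
    ∫ x, frob (F (v x)) (opLstar ν b (fun y => sharp F (v y)) x) = 0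

/-! ### Weak solutions -/

/-- Essentially bounded measurable fields of symmetric matrices on `(0,T) × Ω`. -/
def MemLinftySym {d N : ℕ} (T : ℝ) (B : ℝ × Box d → Mat N) : Prop :=
  (∀ i j, MemLp (fun p => B p i j) ∞ (cylMeasure d T)) ∧ ∀ p, (B p).IsSymm

/-- The weak form of `∂_t B = L^* E`, `B(T) = 0`:
`∫_0^T [(B, ∂_t Ψ) + (E, L Ψ)] dt = 0` for all smooth symmetric matrix fields `Ψ` on
`[0,T] × Ω` (restrictions of smooth fields on `ℝ × Ω`) with `Ψ(0) = 0`. -/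
def Constraint {d n N : ℕ} (ν : ℕ) (b : Coeff d n N) (T : ℝ)
    (E : ℝ × Box d → Vec n) (B : ℝ × Box d → Mat N) : Prop :=
  ∀ Ψ : ℝ × Box d → Mat N, (∀ i j, SmoothTimeBox (fun p => Ψ p i j)) →
    (∀ p, (Ψ p).IsSymm) → (∀ x, Ψ (0, x) = 0) →
    ∫ p, (frob (B p) (timeDMat Ψ p) + inner ℝ (E p) (opL ν b (fun y => Ψ (p.1, y)) p.2))
      ∂(cylMeasure d T) = 0

/-- Weak solutions of `∂_t v = L(F(v))`, `v(0) = v₀`. -/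
structure IsWeakSolution {d n N : ℕ} (ν : ℕ) (b : Coeff d n N) (F : Vec n → Mat N) (T : ℝ)
    (v₀ : Box d → Vec n) (v : ℝ × Box d → Vec n) : Prop where
  mem : MemOrlicz (entropy F) (cylMeasure d T) v
  weak : ∀ (E : ℝ × Box d → Vec n) (B : ℝ × Box d → Mat N),
    MemOrlicz (legendre (entropy F)) (cylMeasure d T) E → MemLinftySym T B →
    Constraint ν b T E B →
    ∫ p, (inner ℝ (v p - v₀ p.2) (E p) + frob (F (v p)) (B p)) ∂(cylMeasure d T) = 0

/-! ### Strong solutions -/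

/-- `∂_t f = g` in the sense of distributions on `(0,T) × Ω`, for locally integrable `f`, `g`. -/
def HasWeakTimeDeriv {d n : ℕ} (T : ℝ) (f g : ℝ × Box d → Vec n) : Prop :=
  LocallyIntegrableOn f (cylinder d T) ∧ LocallyIntegrableOn g (cylinder d T) ∧
  ∀ φ : ℝ × Box d → Vec n, SmoothTimeBox φ → HasCompactSupport φ → tsupport φ ⊆ cylinder d T →
    ∫ p, inner ℝ (f p) (timeD φ p) ∂(cylMeasure d T) =
      - ∫ p, inner ℝ (g p) (φ p) ∂(cylMeasure d T)

/-- `L^* f = G` in the sense of distributions on `(0,T) × Ω`, for locally integrable `f` and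
a locally integrable field `G` of symmetric matrices. -/
def HasWeakLstar {d n N : ℕ} (ν : ℕ) (b : Coeff d n N) (T : ℝ)
    (f : ℝ × Box d → Vec n) (G : ℝ × Box d → Mat N) : Prop :=
  LocallyIntegrableOn f (cylinder d T) ∧
  (∀ i j, LocallyIntegrableOn (fun p => G p i j) (cylinder d T)) ∧ (∀ p, (G p).IsSymm) ∧
  ∀ Ψ : ℝ × Box d → Mat N, (∀ i j, SmoothTimeBox (fun p => Ψ p i j)) → (∀ p, (Ψ p).IsSymm) →
    HasCompactSupport Ψ → tsupport Ψ ⊆ cylinder d T →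
    ∫ p, frob (G p) (Ψ p) ∂(cylMeasure d T) =
      ∫ p, inner ℝ (f p) (opL ν b (fun y => Ψ (p.1, y)) p.2) ∂(cylMeasure d T)

/-- A weight: a positive scalar function bounded away from `0` and `∞` on `[0,T]`. -/
def IsWeight (T : ℝ) (κ : ℝ → ℝ) : Prop :=
  AEMeasurable κ (volume.restrict (Icc 0 T)) ∧
    ∃ c C : ℝ, 0 < c ∧ ∀ t ∈ Icc 0 T, c ≤ κ t ∧ κ t ≤ C

/-- The integrated weight `∫_t^T κ(s) ds`. -/
def cumWeight (T : ℝ) (κ : ℝ → ℝ) (t : ℝ) : ℝ := ∫ s in t..T, κ s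

/-- `w` is a version of `v` that is defined for every `t ∈ [0,T)` and for which
`w^# ∈ C([0,T); L_{K^*}(Ω; ℝⁿ))`.  Any two such versions agree, for every `t ∈ [0,T)`,
almost everywhere in `Ω`. -/
structure IsContinuousVersion {d n N : ℕ} (F : Vec n → Mat N) (T : ℝ)
    (v w : ℝ × Box d → Vec n) : Prop where
  ae_eq : w =ᵐ[cylMeasure d T] v
  mem : ∀ t ∈ Ico 0 T,
    MemOrlicz (legendre (entropy F)) volume (fun x : Box d => sharp F (w (t, x)))
  continuous : ∀ t ∈ Ico 0 T,
    Tendsto (fun s => luxemburg (legendre (entropy F)) volume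
      (fun x : Box d => sharp F (w (s, x)) - sharp F (w (t, x)))) (𝓝[Ico 0 T] t) (𝓝 0)

/-- Strong solutions of `∂_t v = L(F(v))`, `v(0) = v₀`, with the weight `κ` and its
integral `𝒦(t) = ∫_t^T κ`: weak solutions with `∂_t (𝒦 v^#) ∈ L_{K^*}`, `𝒦 L^*(v^#) ∈ L^∞` and
`∂_t (v^#)_l + L^*(v^#) : ∂_l F(v) = 0` a.e., `v^#(0) = v₀^#` a.e.  The value of `v^#` at the time
`0` is that of the time-continuous version; it is not part of the definition that a
time-continuous version exists. -/
structure IsStrongSolution {d n N : ℕ} (ν : ℕ) (b : Coeff d n N) (F : Vec n → Mat N) (T : ℝ)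
    (κ : ℝ → ℝ) (v₀ : Box d → Vec n) (v : ℝ × Box d → Vec n) : Prop where
  weakSolution : IsWeakSolution ν b F T v₀ v
  regular_time : ∃ g : ℝ × Box d → Vec n,
    HasWeakTimeDeriv T (fun p => cumWeight T κ p.1 • sharp F (v p)) g ∧
    MemOrlicz (legendre (entropy F)) (cylMeasure d T) g
  equation : ∃ (h : ℝ × Box d → Vec n) (G : ℝ × Box d → Mat N),
    HasWeakTimeDeriv T (fun p => sharp F (v p)) h ∧
    HasWeakLstar ν b T (fun p => sharp F (v p)) G ∧
    MemLinftySym T (fun p => cumWeight T κ p.1 • G p) ∧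
    ∀ᵐ p ∂(cylMeasure d T), ∀ l, h p l + frob (G p) (partialF F l (v p)) = 0
  initial : ∀ w, IsContinuousVersion F T v w →
    (fun x => sharp F (w (0, x))) =ᵐ[volume] fun x => sharp F (v₀ x)

/-- The total entropy `K(t) = ∫_Ω K(v(t,x)) dx`. -/
def totalEntropy {d n N : ℕ} (F : Vec n → Mat N) (v : ℝ × Box d → Vec n) (t : ℝ) : ℝ :=
  ∫ x, entropy F (v (t, x))

end EntropyCons

end

noncomputable section

namespace EntropyCons

/-! ### Legendre duality for smooth strictly convex `N`-functions -/

/-! Write `z = v^#`, and let `S = (∇K)⁻¹ = ∇K^*`, so that `v = S(z)`. For a smooth `θ` with compact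
support in `(0,T)`, test the weak equation with `E = ∂_t(θ z)` and `B = θ L^*(z)`. The pair is
admissible because `∂_t` and `L^*` commute (`constraint_testField`). The term with `v₀` is the time
integral of an exact derivative with compact support and vanishes. The flux term `θ (F(v), L^*(z))`
vanishes by conservativity. Young's equality `v·z = K(v) + K^*(z)` and the chain rule `v·∂_t z = ∂_t
K^*(z)` give `v·∂_t(θ z) = θ' K(v) + ∂_t(θ K^*(z))`, so what remains is `∫ θ'(t) ∫_Ω K(v) dx dt = 0`
(`DualPair.integral_inner_testField`). By du Bois-Reymond the total entropy is a.e. constant in time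
(`IsStrongSolution.exists_ae_totalEntropy_eq`).

Three points turn this calculation into a proof.

Time regularity: `𝒦 z` has a weak derivative `g` in `L_{K^*}`, so `z = 𝒦⁻¹ (u + ∫₀ᵗ g)` a.e.
(`DualPair.exists_eq_pathField`). For a.e. `x` this is a locally absolutely continuous path on
`[0,T)`, which justifies the chain rule. By Jensen's inequality it is also continuous into `L_{K^*}`
(`DualPair.tendsto_luxemburg_pathField`), which provides the time-continuous version.

Conservativity for irregular fields: at almost every time, `z` is only an Orlicz function with
bounded weak `L^*(z) = G`. Convolution with nonnegative trigonometric kernels makes it smooth and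
commutes with `L^*`, as seen on Fourier coefficients. For bounded `P ∈ Λ`, nonnegativity of `F` in
the `Λ`-order gives `|F(v) : P| ≤ C (K(v) + 1)`, and Jensen's inequality controls `K^*` of the
mollified fields, so the identity for smooth fields passes to the limit
(`TrigWeakLstar.mem_and_integral_frob_eq_zero`).

Passage from almost every to every time: the `Δ₂`-condition gives `K(S(y)) ≤ C (K^*(y) + 1)`, hence
the total entropy of a continuous version is continuous in time
(`IsContinuousVersion.continuousOn_totalEntropy`) and its a.e. constant value is attained
everywhere. At time `0` the initial condition and the injectivity of `∇K` identify that value. -/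

/-- The relations between a smooth strictly convex `N`-function `A`, its Legendre transform `B`,
the gradient `σ` of `A` and the inverse `S` of `σ`, under the `Δ₂`-condition. -/
structure DualPair {n : ℕ} (A B : Vec n → ℝ) (σ S : Vec n → Vec n) : Prop where
  right_inv : ∀ y, σ (S y) = y
  left_inv : ∀ v, S (σ v) = v
  cont_grad : Continuous σ
  cont_inv : Continuous S
  cont : Continuous A
  cont_dual : Continuous B
  nonneg : ∀ v, 0 ≤ A v
  even : ∀ v, A (-v) = A v
  dual_nonneg : ∀ y, 0 ≤ B y
  dual_zero : B 0 = 0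
  dual_even : ∀ y, B (-y) = B y
  dual_convex : ConvexOn ℝ univ B
  young : ∀ v y, inner ℝ v y ≤ A v + B y
  young_eq : ∀ y, inner ℝ (S y) y = A (S y) + B y
  hasGradientAt : ∀ y, HasGradientAt B (S y) y
  dual_double : ∃ C, 0 ≤ C ∧ ∀ y, B ((2 : ℝ) • y) ≤ C * (B y + 1)
  inv_bound : ∃ C, 0 ≤ C ∧ ∀ y, A (S y) ≤ C * (B y + 1)
  grad_bound : ∃ C, 0 ≤ C ∧ ∀ v, B (σ v) ≤ C * (A v + 1)
  dual_norm_le : ∃ C, 0 ≤ C ∧ ∀ y, ‖y‖ ≤ B y + C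

/-- Restricted to the line through `v` and `u`, the function is convex in one variable, and its
derivative at `0` is at most the slope over `[0,1]`. -/
theorem _root_.ConvexOn.add_inner_gradient_le {E : Type*} [NormedAddCommGroup E]
    [InnerProductSpace ℝ E] [CompleteSpace E] {A : E → ℝ} (hA : ConvexOn ℝ univ A) {p v : E}
    (h : HasGradientAt A p v) (u : E) : A v + inner ℝ p (u - v) ≤ A u := by
  have hg : ConvexOn ℝ univ (fun t : ℝ => A (AffineMap.lineMap v u t)) := by
    have := hA.comp_affineMap (AffineMap.lineMap (k := ℝ) v u)
    rwa [preimage_univ] at this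
  have hd : HasDerivAt (fun t : ℝ => A (AffineMap.lineMap v u t)) (inner ℝ p (u - v)) 0 := by
    have h1 : HasFDerivAt A (InnerProductSpace.toDual ℝ E p) (AffineMap.lineMap v u (0 : ℝ)) := by
      simpa using h.hasFDerivAt
    have h2 : HasDerivAt (AffineMap.lineMap v u : ℝ → E) (u - v) 0 := AffineMap.hasDerivAt_lineMap
    have := h1.comp_hasDerivAt (0 : ℝ) h2
    rwa [InnerProductSpace.toDual_apply_apply] at this
  have := hg.le_slope_of_hasDerivAt (mem_univ 0) (mem_univ 1) one_pos hd
  simp [slope] at this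
  linarith

theorem IsYoung.exists_linear_le {Φ : ℝ → ℝ} (h : IsYoung Φ) (R : ℝ) :
    ∃ C, 0 ≤ C ∧ ∀ s, 0 ≤ s → R * s ≤ Φ s + C := by
  obtain ⟨s₀, hs₀⟩ := (h.lim_top.eventually_ge_atTop R).exists_forall_of_atTop
  -- Beyond `|s₀| + 1` superlinear growth suffices, and the added `1` keeps `s` positive for the
  -- division; below it the constant alone dominates `R s`.
  refine ⟨|R| * (|s₀| + 1), by positivity, fun s hs => ?_⟩
  by_cases hcase : |s₀| + 1 ≤ s
  · have h0 : s₀ ≤ s := by linarith [le_abs_self s₀]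
    have hpos : 0 < s := by linarith [abs_nonneg s₀]
    have := hs₀ s h0
    rw [le_div_iff₀ hpos] at this
    have : 0 ≤ |R| * (|s₀| + 1) := by positivity
    linarith
  · push Not at hcase
    have h1 : R * s ≤ |R| * s := mul_le_mul_of_nonneg_right (le_abs_self R) hs
    have h2 : |R| * s ≤ |R| * (|s₀| + 1) := mul_le_mul_of_nonneg_left hcase.le (abs_nonneg R)
    linarith [h.nonneg s]

/-! ### Young's inequality, and the inverse gradient as the gradient of the Legendre transform -/

section Duality

variable {n : ℕ} {A : Vec n → ℝ}

theorem IsNFunction.exists_linear_le (hN : IsNFunction A) (R : ℝ) :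
    ∃ C, 0 ≤ C ∧ ∀ v, R * ‖v‖ ≤ A v + C := by
  obtain ⟨Φ₁, Φ₂, h1, -, hb⟩ := hN.bounds
  obtain ⟨C, hC, h⟩ := h1.exists_linear_le R
  exact ⟨C, hC, fun v => (h _ (norm_nonneg v)).trans (by linarith [(hb v).1])⟩

theorem IsNFunction.map_zero (hN : IsNFunction A) : A 0 = 0 := by
  obtain ⟨Φ₁, Φ₂, -, h2, hb⟩ := hN.bounds
  refine le_antisymm ?_ (hN.nonneg 0)
  simpa [(h2.zero_iff 0).2 rfl] using (hb 0).2

/-- `legendre` is a real supremum, which has a default value on unbounded sets. Superlinear growth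
of `A` excludes that case, so Young's inequality may be read off from it. -/
theorem IsNFunction.bddAbove_legendre (hN : IsNFunction A) (y : Vec n) :
    BddAbove (range fun z => inner ℝ y z - A z) := by
  obtain ⟨C, -, h⟩ := hN.exists_linear_le ‖y‖
  refine ⟨C, ?_⟩
  rintro _ ⟨z, rfl⟩
  have := real_inner_le_norm y z
  simp only
  linarith [h z]

theorem IsNFunction.young (hN : IsNFunction A) (v y : Vec n) :
    inner ℝ v y ≤ A v + legendre A y := by
  have := le_ciSup (hN.bddAbove_legendre y) v
  simp only [legendre] at *
  rw [real_inner_comm] at this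
  linarith

theorem legendre_le {y : Vec n} {M : ℝ} (h : ∀ z, inner ℝ y z - A z ≤ M) : legendre A y ≤ M :=
  ciSup_le h

/-- The tangent inequality at `v` says that `z ↦ ⟨p, z⟩ - A z` attains its supremum at `v`; this is
the equality case of Young's inequality. -/
theorem IsNFunction.legendre_gradient (hN : IsNFunction A) {p v : Vec n}
    (h : HasGradientAt A p v) : inner ℝ v p = A v + legendre A p := by
  refine le_antisymm (hN.young v p) ?_
  have : legendre A p ≤ inner ℝ v p - A v := legendre_le fun z => by
    have := hN.convex.add_inner_gradient_le h z
    rw [inner_sub_right, real_inner_comm v p] at this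
    linarith
  linarith

theorem IsNFunction.legendre_nonneg (hN : IsNFunction A) (y : Vec n) : 0 ≤ legendre A y := by
  have := hN.young 0 y
  rw [hN.map_zero] at this
  simpa using this

theorem IsNFunction.legendre_zero (hN : IsNFunction A) : legendre A 0 = 0 :=
  le_antisymm (legendre_le fun z => by simpa using hN.nonneg z) (hN.legendre_nonneg 0)

theorem IsNFunction.legendre_even (hN : IsNFunction A) (y : Vec n) :
    legendre A (-y) = legendre A y := by
  have key : ∀ y, legendre A (-y) ≤ legendre A y := fun y => legendre_le fun z => by
    have := hN.young (-z) y
    rw [hN.even, inner_neg_left, real_inner_comm] at this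
    rw [inner_neg_left]
    linarith
  exact le_antisymm (key y) (by simpa using key (-y))

theorem IsNFunction.convexOn_legendre (hN : IsNFunction A) : ConvexOn ℝ univ (legendre A) := by
  refine ⟨convex_univ, fun x _ y _ a b ha hb hab => legendre_le fun z => ?_⟩
  have h1 := mul_le_mul_of_nonneg_left (hN.young z x) ha
  have h2 := mul_le_mul_of_nonneg_left (hN.young z y) hb
  rw [inner_add_left, real_inner_smul_left, real_inner_smul_left, smul_eq_mul, smul_eq_mul,
    real_inner_comm z x, real_inner_comm z y]
  have h3 : A z = a * A z + b * A z := by rw [← add_mul, hab, one_mul]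
  linarith

/-- Young's inequality tested with the unit vector `y / ‖y‖`, on which `A` is bounded by
compactness. With `0⁻¹ = 0` the argument also covers `y = 0`. -/
theorem IsNFunction.exists_linear_le_legendre (hN : IsNFunction A) (hc : Continuous A) :
    ∃ C, 0 ≤ C ∧ ∀ y, ‖y‖ ≤ legendre A y + C := by
  obtain ⟨M, hM⟩ := (isCompact_closedBall (0 : Vec n) 1).exists_bound_of_continuousOn
    hc.continuousOn
  refine ⟨|M|, abs_nonneg M, fun y => ?_⟩
  have hu : ‖(‖y‖⁻¹ • y)‖ ≤ 1 := by
    rw [norm_smul, norm_inv, norm_norm]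
    exact inv_mul_le_one
  have h1 := hN.young (‖y‖⁻¹ • y) y
  have h2 := hM (‖y‖⁻¹ • y) (by simpa using hu)
  rw [real_inner_smul_left, real_inner_self_eq_norm_sq] at h1
  have h3 : ‖y‖⁻¹ * ‖y‖ ^ 2 = ‖y‖ := by
    rcases eq_or_ne ‖y‖ 0 with h | h
    · simp [h]
    · field_simp
  rw [h3] at h1
  rw [Real.norm_eq_abs] at h2
  linarith [le_abs_self (A (‖y‖⁻¹ • y)), le_abs_self M]

/-- If the gradients at `u` and `v` agree, the tangent inequalities force `A` at the midpoint to be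
at least the mean of the end values, against strict convexity. -/
theorem injective_gradient (hs : StrictConvexOn ℝ univ A) {σ : Vec n → Vec n}
    (hσ : ∀ v, HasGradientAt A (σ v) v) : Function.Injective σ := by
  intro u v huv
  by_contra hne
  have h1 := hs.convexOn.add_inner_gradient_le (hσ u) v
  have h2 := hs.convexOn.add_inner_gradient_le (hσ v) u
  have h3 := hs.convexOn.add_inner_gradient_le (hσ v) ((1 / 2 : ℝ) • u + (1 / 2 : ℝ) • v)
  have h4 : A ((1 / 2 : ℝ) • u + (1 / 2 : ℝ) • v) < (1 / 2 : ℝ) • A u + (1 / 2 : ℝ) • A v :=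
    hs.2 (mem_univ u) (mem_univ v) hne (by norm_num) (by norm_num) (by norm_num)
  have e : (1 / 2 : ℝ) • u + (1 / 2 : ℝ) • v - v = (1 / 2 : ℝ) • (u - v) := by
    module
  rw [e, real_inner_smul_right] at h3
  rw [huv, ← neg_sub u v, inner_neg_right] at h1
  simp only [smul_eq_mul] at h4
  linarith

/-- `A - ⟨y, ·⟩` is coercive, and at a minimiser the gradient of `A` equals `y`. -/
theorem IsNFunction.surjective_gradient (hN : IsNFunction A) {σ : Vec n → Vec n}
    (hσ : ∀ v, HasGradientAt A (σ v) v) : Function.Surjective σ := by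
  intro y
  have hc : Continuous A := continuous_iff_continuousAt.2 fun v => (hσ v).continuousAt
  obtain ⟨C, -, h⟩ := hN.exists_linear_le (‖y‖ + 1)
  have hlim : Tendsto (fun v => A v - inner ℝ y v) (cocompact (Vec n)) atTop := by
    refine tendsto_atTop_mono (f := fun v : Vec n => ‖v‖ - C) (fun v => ?_) ?_
    · have := real_inner_le_norm y v
      linarith [h v]
    · exact tendsto_atTop_add_const_right _ _ (tendsto_norm_cocompact_atTop (E := Vec n))
  obtain ⟨v, hv⟩ := Continuous.exists_forall_le (f := fun v => A v - inner ℝ y v)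
    (hc.sub (continuous_const.inner continuous_id)) hlim
  refine ⟨v, ?_⟩
  have hmin : IsLocalMin (fun v => A v - inner ℝ y v) v := Eventually.of_forall hv
  have hd : HasFDerivAt (fun v => A v - inner ℝ y v)
      (InnerProductSpace.toDual ℝ (Vec n) (σ v) - InnerProductSpace.toDual ℝ (Vec n) y) v :=
    (hσ v).hasFDerivAt.sub (InnerProductSpace.toDual ℝ (Vec n) y).hasFDerivAt
  have h0 := hmin.hasFDerivAt_eq_zero hd
  exact (InnerProductSpace.toDual ℝ (Vec n)).injective (sub_eq_zero.1 h0)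

/-- From `⟨σ v, v⟩ ≥ A v ≥ (R + 1)‖v‖ - C` the gradient is large where `v` is large. Hence `σ` is
proper and therefore closed, and the bijection `σ` is a homeomorphism. -/
theorem IsNFunction.isClosedMap_gradient (hN : IsNFunction A) {σ : Vec n → Vec n}
    (hσ : ∀ v, HasGradientAt A (σ v) v) (hcont : Continuous σ) : IsClosedMap σ := by
  have : Tendsto σ (Bornology.cobounded _) (Bornology.cobounded _) := by
    rw [← tendsto_norm_atTop_iff_cobounded, tendsto_atTop]
    intro R
    obtain ⟨C, -, h⟩ := hN.exists_linear_le (R + 1)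
    filter_upwards [(tendsto_norm_cobounded_atTop (E := Vec n)).eventually_gt_atTop C] with v hv
    have h1 := hN.convex.add_inner_gradient_le (hσ v) 0
    rw [hN.map_zero, zero_sub, inner_neg_right] at h1
    have h2 := real_inner_le_norm (σ v) v
    by_contra hlt
    push Not at hlt
    have h3 : ‖σ v‖ * ‖v‖ ≤ R * ‖v‖ := mul_le_mul_of_nonneg_right hlt.le (norm_nonneg v)
    linarith [h v]
  rw [Metric.cobounded_eq_cocompact] at this
  exact (isProperMap_iff_tendsto_cocompact.2 ⟨hcont, this⟩).isClosedMap

/-- The subgradient inequalities at `y` and at `z` squeeze `B z - B y - ⟨S y, z - y⟩` between `0`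
and `⟨S z - S y, z - y⟩`, which is `o(‖z - y‖)` by continuity of `S`. -/
theorem hasGradientAt_of_subgradient {B : Vec n → ℝ} {S : Vec n → Vec n} (hS : Continuous S)
    (hsub : ∀ y z, B y + inner ℝ (S y) (z - y) ≤ B z) (y : Vec n) : HasGradientAt B (S y) y := by
  rw [hasGradientAt_iff_isLittleO, Asymptotics.isLittleO_iff]
  intro c hc
  have hev : ∀ᶠ z in 𝓝 y, ‖S z - S y‖ < c := by
    have := (Metric.tendsto_nhds.1 hS.continuousAt c hc : ∀ᶠ z in 𝓝 y, dist (S z) (S y) < c)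
    simpa [dist_eq_norm] using this
  filter_upwards [hev] with z hz
  have h1 := hsub y z
  have h2 := hsub z y
  have h3 := real_inner_le_norm (S z - S y) (z - y)
  rw [inner_sub_left] at h3
  rw [← neg_sub z y, inner_neg_right] at h2
  have h4 : ‖S z - S y‖ * ‖z - y‖ ≤ c * ‖z - y‖ := mul_le_mul_of_nonneg_right hz.le (norm_nonneg _)
  rw [Real.norm_eq_abs, abs_le]
  constructor <;> linarith

theorem DeltaTwo.exists_nonneg (h : DeltaTwo A) (h0 : ∀ v, 0 ≤ A v) :
    ∃ C, 0 ≤ C ∧ ∀ y, A ((2 : ℝ) • y) ≤ C * (A y + 1) := by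
  obtain ⟨C, hC⟩ := h
  exact ⟨|C|, abs_nonneg C, fun y => (hC y).trans
    (mul_le_mul_of_nonneg_right (le_abs_self C) (by linarith [h0 y]))⟩

theorem exists_dualPair (hN : IsNFunction A) (hs : StrictConvexOn ℝ univ A)
    (hA : ContDiff ℝ 1 A) (h2 : DeltaTwo A) (h2' : DeltaTwo (legendre A)) :
    ∃ S, DualPair A (legendre A) (gradient A) S := by
  have hσ : ∀ v, HasGradientAt A (gradient A v) v := fun v =>
    (hA.differentiable one_ne_zero v).hasGradientAt
  have hcσ : Continuous (gradient A) :=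
    (InnerProductSpace.toDual ℝ (Vec n)).symm.continuous.comp (hA.continuous_fderiv one_ne_zero)
  let e := Equiv.ofBijective _ ⟨injective_gradient hs hσ, hN.surjective_gradient hσ⟩
  let e' := e.toHomeomorphOfContinuousClosed hcσ (hN.isClosedMap_gradient hσ hcσ)
  have hr : ∀ y, gradient A (e'.symm y) = y := fun y => e'.apply_symm_apply y
  have hl : ∀ v, e'.symm (gradient A v) = v := fun v => e'.symm_apply_apply v
  have heq : ∀ y, inner ℝ (e'.symm y) y = A (e'.symm y) + legendre A y := fun y => by
    have := hN.legendre_gradient (hσ (e'.symm y))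
    rwa [hr] at this
  have hgrad : ∀ y, HasGradientAt (legendre A) (e'.symm y) y := by
    refine hasGradientAt_of_subgradient e'.symm.continuous fun y z => ?_
    rw [inner_sub_right]
    linarith [hN.young (e'.symm y) z, heq y]
  have hcB : Continuous (legendre A) :=
    continuous_iff_continuousAt.2 fun v => (hgrad v).continuousAt
  obtain ⟨C, hC, hCd⟩ := h2.exists_nonneg hN.nonneg
  obtain ⟨C', hC', hCd'⟩ := h2'.exists_nonneg hN.legendre_nonneg
  refine ⟨e'.symm, hr, hl, hcσ, e'.symm.continuous, hA.continuous, hcB, hN.nonneg, hN.even,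
    hN.legendre_nonneg, hN.legendre_zero, hN.legendre_even, hN.convexOn_legendre, hN.young, heq,
    hgrad, ⟨C', hC', hCd'⟩, ⟨C', hC', fun y => ?_⟩, ⟨C, hC, fun v => ?_⟩,
    hN.exists_linear_le_legendre hA.continuous⟩
  -- Young's inequality for the pair `S y`, `2y`, minus twice the equality for `S y`, `y`, leaves
  -- `A(S y) ≤ B(2y) - 2 B(y)`; the `Δ₂`-condition for `B` bounds the right side. The other bound is
  -- the mirror image with `2v` and the `Δ₂`-condition for `A`.
  · have := hN.young (e'.symm y) ((2 : ℝ) • y)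
    rw [inner_smul_right] at this
    linarith [heq y, hCd' y, hN.legendre_nonneg y]
  · have h1 := hN.young ((2 : ℝ) • v) (gradient A v)
    have h3 := hN.legendre_gradient (hσ v)
    rw [real_inner_smul_left] at h1
    linarith [hCd v, hN.nonneg v]

end Duality

end EntropyCons

namespace EntropyCons

/-! ### Anisotropic Orlicz classes under the `Δ₂`-condition -/

/-- The cost of truncating at level `a` a number bounded by `b`. With `a` the limit dominating
function and `b` the `k`-th one, this cost tends to zero in `L¹`. -/
theorem abs_sub_clamp_le {x a b : ℝ} (ha : 0 ≤ a) (h : |x| ≤ b) :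
    |x - max (-a) (min x a)| ≤ |b - a| := by
  rcases abs_le.1 h with ⟨h1, h2⟩
  rcases le_total x a with hx | hx
  · rw [min_eq_left hx]
    rcases le_total (-a) x with hy | hy
    · rw [max_eq_right hy, sub_self, abs_zero]
      exact abs_nonneg _
    · rw [max_eq_left hy, abs_of_nonpos (by linarith)]
      exact le_trans (by linarith) (le_abs_self _)
  · rw [min_eq_right hx, max_eq_right (by linarith), abs_of_nonneg (by linarith)]
    exact le_trans (by linarith) (le_abs_self _)

/-- Dominated convergence with dominating functions that converge in `L¹`. -/
theorem tendsto_integral_of_dominated_of_tendsto {α : Type*} [MeasurableSpace α] {μ : Measure α}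
    {F G : ℕ → α → ℝ} {f g : α → ℝ} (hF : ∀ k, AEStronglyMeasurable (F k) μ)
    (hG : ∀ k, Integrable (G k) μ) (hg : Integrable g μ)
    (hFG : ∀ k, ∀ᵐ x ∂μ, |F k x| ≤ G k x) (hfg : ∀ᵐ x ∂μ, |f x| ≤ g x)
    (hlim : ∀ᵐ x ∂μ, Tendsto (fun k => F k x) atTop (𝓝 (f x)))
    (hGg : Tendsto (fun k => ∫ x, |G k x - g x| ∂μ) atTop (𝓝 0)) :
    Tendsto (fun k => ∫ x, F k x ∂μ) atTop (𝓝 (∫ x, f x ∂μ)) := by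
  -- `F k` truncated to `[-g, g]` converges under ordinary dominated convergence, and the truncation
  -- error is at most `|G k - g|`.
  have hm : ∀ k, AEStronglyMeasurable (fun x => max (-g x) (min (F k x) (g x))) μ := fun k =>
    hg.aestronglyMeasurable.neg.sup ((hF k).inf hg.aestronglyMeasurable)
  have hb : ∀ k, ∀ᵐ x ∂μ, ‖max (-g x) (min (F k x) (g x))‖ ≤ g x := fun k => by
    filter_upwards [hfg] with x hx
    have h0 : 0 ≤ g x := (abs_nonneg _).trans hx
    rw [Real.norm_eq_abs, abs_le]
    exact ⟨le_max_left _ _, max_le (by linarith) (min_le_right _ _)⟩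
  have h1 : Tendsto (fun k => ∫ x, max (-g x) (min (F k x) (g x)) ∂μ) atTop
      (𝓝 (∫ x, f x ∂μ)) := by
    refine tendsto_integral_of_dominated_convergence g hm hg hb ?_
    filter_upwards [hlim, hfg] with x hx hxg
    have e : max (-g x) (min (f x) (g x)) = f x := by
      rw [min_eq_left ((le_abs_self _).trans hxg), max_eq_right (abs_le.1 hxg).1]
    have : Tendsto (fun k => max (-g x) (min (F k x) (g x))) atTop
        (𝓝 (max (-g x) (min (f x) (g x)))) :=
      tendsto_const_nhds.max (hx.min tendsto_const_nhds)
    rwa [e] at this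
  have hFi : ∀ k, Integrable (F k) μ := fun k => (hG k).mono' (hF k) (hFG k)
  have hci : ∀ k, Integrable (fun x => max (-g x) (min (F k x) (g x))) μ := fun k =>
    hg.mono' (hm k) (hb k)
  have h2 : Tendsto (fun k => (∫ x, F k x ∂μ) - ∫ x, max (-g x) (min (F k x) (g x)) ∂μ) atTop
      (𝓝 0) := by
    refine squeeze_zero_norm (fun k => ?_) hGg
    rw [← integral_sub (hFi k) (hci k)]
    refine (norm_integral_le_integral_norm _).trans ?_
    refine integral_mono_ae ((hFi k).sub (hci k)).norm ((hG k).sub hg).abs ?_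
    filter_upwards [hFG k, hfg] with x hx hxg
    exact abs_sub_clamp_le ((abs_nonneg _).trans hxg) hx
  simpa using h2.add h1

/-- A sequence that converges to zero in `L¹` has an almost everywhere convergent subsequence. -/
theorem exists_subseq_tendsto_ae_of_tendsto_integral_norm {α E : Type*} [MeasurableSpace α]
    [NormedAddCommGroup E] {μ : Measure α} {f : ℕ → α → E} {g : α → E}
    (hf : ∀ k, Integrable (f k) μ) (hg : Integrable g μ)
    (h : Tendsto (fun k => ∫ x, ‖f k x - g x‖ ∂μ) atTop (𝓝 0)) :
    ∃ ns : ℕ → ℕ, StrictMono ns ∧ ∀ᵐ x ∂μ, Tendsto (fun k => f (ns k) x) atTop (𝓝 (g x)) := by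
  have h1 : Tendsto (fun k => eLpNorm (f k - g) 1 μ) atTop (𝓝 0) := by
    have e : ∀ k, eLpNorm (f k - g) 1 μ = ENNReal.ofReal (∫ x, ‖f k x - g x‖ ∂μ) := fun k => by
      rw [eLpNorm_one_eq_lintegral_enorm]
      exact (ofReal_integral_norm_eq_lintegral_enorm ((hf k).sub hg)).symm
    simp_rw [e]
    simpa using ENNReal.tendsto_ofReal h
  exact (tendstoInMeasure_of_tendsto_eLpNorm one_ne_zero
    (fun k => (hf k).aestronglyMeasurable) hg.aestronglyMeasurable h1).exists_seq_tendsto_ae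

/-! ### Modular and Luxemburg norm under the `Δ₂`-condition -/

namespace DualPair

variable {n : ℕ} {A B : Vec n → ℝ} {σ S : Vec n → Vec n}

/-- Convexity between `y` and `0`, where `B` vanishes, gives linear decay under scaling; evenness
handles negative factors. -/
theorem dual_smul_le (hD : DualPair A B σ S) {r : ℝ} (hr : |r| ≤ 1) (y : Vec n) :
    B (r • y) ≤ |r| * B y := by
  have key : ∀ t, 0 ≤ t → t ≤ 1 → B (t • y) ≤ t * B y := fun t h0 h1 => by
    have := hD.dual_convex.2 (mem_univ y) (mem_univ 0) h0 (sub_nonneg.2 h1) (by ring)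
    simpa [hD.dual_zero] using this
  rcases le_total 0 r with h | h
  · rw [abs_of_nonneg h] at *
    exact key r h hr
  · rw [abs_of_nonpos h] at *
    have := key (-r) (by linarith) hr
    rwa [neg_smul, hD.dual_even] at this

theorem dual_smul_le_self (hD : DualPair A B σ S) {r : ℝ} (hr : |r| ≤ 1) (y : Vec n) :
    B (r • y) ≤ B y :=
  (hD.dual_smul_le hr y).trans (mul_le_of_le_one_left (hD.dual_nonneg y) hr)

/-- Iterate the doubling condition until `2 ^ k` exceeds `M`, then scale down by convexity. -/
theorem exists_dual_smul_le (hD : DualPair A B σ S) (M : ℝ) :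
    ∃ C, 0 ≤ C ∧ ∀ r, |r| ≤ M → ∀ y, B (r • y) ≤ C * (B y + 1) := by
  obtain ⟨C, hC, h2⟩ := hD.dual_double
  have key : ∀ k : ℕ, ∃ D, 0 ≤ D ∧ ∀ y, B ((2 : ℝ) ^ k • y) ≤ D * (B y + 1) := by
    intro k
    induction k with
    | zero => exact ⟨1, zero_le_one, fun y => by simp⟩
    | succ k ih =>
      obtain ⟨D, hDn, hk⟩ := ih
      refine ⟨C * (D + 1), by positivity, fun y => ?_⟩
      have h3 := h2 ((2 : ℝ) ^ k • y)
      rw [smul_smul, ← pow_succ'] at h3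
      refine h3.trans ?_
      rw [mul_assoc]
      refine mul_le_mul_of_nonneg_left ?_ hC
      have := hk y
      have := hD.dual_nonneg y
      linarith
  obtain ⟨k, hk⟩ := pow_unbounded_of_one_lt M (one_lt_two (α := ℝ))
  obtain ⟨D, hDn, hk'⟩ := key k
  refine ⟨D, hDn, fun r hr y => ?_⟩
  have hpos : (0 : ℝ) < 2 ^ k := by positivity
  have e : r • y = (r / 2 ^ k) • ((2 : ℝ) ^ k • y) := by
    rw [smul_smul, div_mul_cancel₀ _ hpos.ne']
  rw [e]
  refine (hD.dual_smul_le_self ?_ _).trans (hk' y)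
  rw [abs_div, abs_of_pos hpos, div_le_one hpos]
  exact hr.trans hk.le

/-- `x + y` is the midpoint of `2x` and `2y`. This replaces the triangle inequality in modular
estimates. -/
theorem dual_add_le (hD : DualPair A B σ S) (x y : Vec n) :
    B (x + y) ≤ (1 / 2) * B ((2 : ℝ) • x) + (1 / 2) * B ((2 : ℝ) • y) := by
  have h : (0 : ℝ) ≤ 1 / 2 := by norm_num
  have := hD.dual_convex.2 (mem_univ ((2 : ℝ) • x)) (mem_univ ((2 : ℝ) • y)) h h (by norm_num)
  simpa [smul_smul] using this

variable {Q : Type*} [MeasurableSpace Q] {μ : Measure Q}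

theorem memOrlicz_of_le (hD : DualPair A B σ S) {f : Q → Vec n} {g : Q → ℝ}
    (hf : AEStronglyMeasurable f μ) (hg : Integrable g μ) (h : ∀ᵐ q ∂μ, B (f q) ≤ g q) :
    MemOrlicz B μ f := by
  refine ⟨hf, hg.mono' (hD.cont_dual.comp_aestronglyMeasurable hf) ?_⟩
  filter_upwards [h] with q hq
  rwa [Real.norm_of_nonneg (hD.dual_nonneg _)]

theorem memOrlicz_smul [IsFiniteMeasure μ] (hD : DualPair A B σ S) {f : Q → Vec n} {r : Q → ℝ}
    {M : ℝ} (hr : AEStronglyMeasurable r μ) (hM : ∀ᵐ q ∂μ, |r q| ≤ M) (hf : MemOrlicz B μ f) :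
    MemOrlicz B μ (fun q => r q • f q) := by
  obtain ⟨C, -, h⟩ := hD.exists_dual_smul_le M
  refine hD.memOrlicz_of_le (hr.smul hf.1) ((hf.2.add (integrable_const 1)).const_mul C) ?_
  filter_upwards [hM] with q hq
  exact h _ hq _

theorem memOrlicz_const_smul [IsFiniteMeasure μ] (hD : DualPair A B σ S) {f : Q → Vec n} (r : ℝ)
    (hf : MemOrlicz B μ f) : MemOrlicz B μ (fun q => r • f q) :=
  hD.memOrlicz_smul aestronglyMeasurable_const (ae_of_all _ fun _ => le_refl |r|) hf

theorem memOrlicz_add [IsFiniteMeasure μ] (hD : DualPair A B σ S) {f g : Q → Vec n}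
    (hf : MemOrlicz B μ f) (hg : MemOrlicz B μ g) : MemOrlicz B μ (fun q => f q + g q) :=
  hD.memOrlicz_of_le (hf.1.add hg.1)
    (((hD.memOrlicz_const_smul 2 hf).2.const_mul (1 / 2)).add
      ((hD.memOrlicz_const_smul 2 hg).2.const_mul (1 / 2)))
    (ae_of_all _ fun _ => hD.dual_add_le _ _)

theorem memOrlicz_sub [IsFiniteMeasure μ] (hD : DualPair A B σ S) {f g : Q → Vec n}
    (hf : MemOrlicz B μ f) (hg : MemOrlicz B μ g) : MemOrlicz B μ (fun q => f q - g q) := by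
  have := hD.memOrlicz_add hf (hD.memOrlicz_const_smul (-1) hg)
  simpa [sub_eq_add_neg] using this

theorem integrable_of_memOrlicz [IsFiniteMeasure μ] (hD : DualPair A B σ S) {f : Q → Vec n}
    (hf : MemOrlicz B μ f) : Integrable f μ := by
  obtain ⟨C, -, h⟩ := hD.dual_norm_le
  exact (hf.2.add (integrable_const C)).mono' hf.1 (ae_of_all _ fun _ => h _)

theorem memOrlicz_grad [IsFiniteMeasure μ] (hD : DualPair A B σ S) {v : Q → Vec n}
    (hv : MemOrlicz A μ v) : MemOrlicz B μ (fun q => σ (v q)) := by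
  obtain ⟨C, -, h⟩ := hD.grad_bound
  exact hD.memOrlicz_of_le (hD.cont_grad.comp_aestronglyMeasurable hv.1)
    ((hv.2.add (integrable_const 1)).const_mul C) (ae_of_all _ fun _ => h _)

theorem integrable_comp_inv [IsFiniteMeasure μ] (hD : DualPair A B σ S) {z : Q → Vec n}
    (hz : MemOrlicz B μ z) : Integrable (fun q => A (S (z q))) μ := by
  obtain ⟨C, -, h⟩ := hD.inv_bound
  refine ((hz.2.add (integrable_const 1)).const_mul C).mono'
    ((hD.cont.comp hD.cont_inv).comp_aestronglyMeasurable hz.1) (ae_of_all _ fun q => ?_)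
  rw [Real.norm_of_nonneg (hD.nonneg _)]
  exact h _

/-- Young's inequality for `v` and for `-v`, together with evenness of `A`, bounds the product on
both sides by `A(v) + B(E)`. -/
theorem integrable_inner (hD : DualPair A B σ S) {v E : Q → Vec n} (hv : MemOrlicz A μ v)
    (hE : MemOrlicz B μ E) : Integrable (fun q => (inner ℝ (v q) (E q) : ℝ)) μ := by
  refine (hv.2.add hE.2).mono' (hv.1.inner hE.1) (ae_of_all _ fun q => ?_)
  rw [Real.norm_eq_abs, abs_le]
  have h1 := hD.young (v q) (E q)
  have h2 := hD.young (-v q) (E q)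
  rw [inner_neg_left, hD.even] at h2
  simp only [Pi.add_apply]
  constructor <;> linarith

theorem exists_of_luxemburg_lt [IsFiniteMeasure μ] (hD : DualPair A B σ S) {u : Q → Vec n}
    (hu : MemOrlicz B μ u) {ε : ℝ} (h : luxemburg B μ u < ε) :
    ∃ r, 0 < r ∧ r < ε ∧ ∫ q, B (r⁻¹ • u q) ∂μ ≤ 1 := by
  -- The infimum gives information only if the set is nonempty; `1 + ∫ B(u)` belongs to it, because
  -- dividing by a number at least `1` divides the modular at least as much.
  have hne : {r : ℝ | 0 < r ∧ Integrable (fun q => B (r⁻¹ • u q)) μ ∧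
      ∫ q, B (r⁻¹ • u q) ∂μ ≤ 1}.Nonempty := by
    have hI : 0 ≤ ∫ q, B (u q) ∂μ := integral_nonneg fun _ => hD.dual_nonneg _
    have hpos : 0 < 1 + ∫ q, B (u q) ∂μ := by linarith
    have habs : |(1 + ∫ q, B (u q) ∂μ)⁻¹| ≤ 1 := by
      rw [abs_of_pos (inv_pos.2 hpos)]
      exact inv_le_one_of_one_le₀ (by linarith)
    refine ⟨1 + ∫ q, B (u q) ∂μ, hpos, (hD.memOrlicz_const_smul _ hu).2, ?_⟩
    refine (integral_mono (hD.memOrlicz_const_smul _ hu).2 (hu.2.const_mul _)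
      fun q => hD.dual_smul_le habs (u q)).trans ?_
    rw [integral_const_mul, abs_of_pos (inv_pos.2 hpos), inv_mul_le_iff₀ hpos]
    linarith
  obtain ⟨r, ⟨h0, -, h1⟩, hr⟩ := exists_lt_of_csInf_lt hne h
  exact ⟨r, h0, hr, h1⟩

theorem tendsto_modular_of_tendsto_luxemburg [IsFiniteMeasure μ] (hD : DualPair A B σ S)
    {ι : Type*} {l : Filter ι} {u : ι → Q → Vec n} (hu : ∀ᶠ i in l, MemOrlicz B μ (u i))
    (h : Tendsto (fun i => luxemburg B μ (u i)) l (𝓝 0)) (M : ℝ) :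
    Tendsto (fun i => ∫ q, B (M • u i q) ∂μ) l (𝓝 0) := by
  rw [Metric.tendsto_nhds]
  intro ε hε
  have hM : 0 < |M| + 1 := by positivity
  have hδ : 0 < min 1 ε / (|M| + 1) := by positivity
  filter_upwards [hu, h.eventually_lt_const hδ] with i hi hlt
  obtain ⟨r, h0, hr, h1⟩ := hD.exists_of_luxemburg_lt hi hlt
  have hMr : |M * r| < min 1 ε := by
    rw [abs_mul, abs_of_pos h0]
    rw [lt_div_iff₀ hM] at hr
    nlinarith [abs_nonneg M]
  -- `M u = (M r)(r⁻¹ u)` with `|M r| < 1`, so convexity extracts the small factor while the modular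
  -- of `r⁻¹ u` is at most `1`.
  have h2 : ∫ q, B (M • u i q) ∂μ ≤ |M * r| * ∫ q, B (r⁻¹ • u i q) ∂μ := by
    rw [← integral_const_mul]
    refine integral_mono (hD.memOrlicz_const_smul _ hi).2
      ((hD.memOrlicz_const_smul _ hi).2.const_mul _) fun q => ?_
    have := hD.dual_smul_le (hMr.le.trans (min_le_left _ _)) (r⁻¹ • u i q)
    rwa [smul_smul, mul_assoc, mul_inv_cancel₀ h0.ne', mul_one] at this
  have h3 : 0 ≤ ∫ q, B (M • u i q) ∂μ := integral_nonneg fun _ => hD.dual_nonneg _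
  rw [Real.dist_eq, sub_zero, abs_of_nonneg h3]
  calc _ ≤ |M * r| * 1 := h2.trans (mul_le_mul_of_nonneg_left h1 (abs_nonneg _))
    _ < ε := by rw [mul_one]; exact hMr.trans_le (min_le_right _ _)

theorem tendsto_luxemburg_of_tendsto_modular [IsFiniteMeasure μ] (hD : DualPair A B σ S)
    {ι : Type*} {l : Filter ι} {u : ι → Q → Vec n} (hu : ∀ᶠ i in l, MemOrlicz B μ (u i))
    (h : ∀ M : ℝ, 0 < M → Tendsto (fun i => ∫ q, B (M • u i q) ∂μ) l (𝓝 0)) :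
    Tendsto (fun i => luxemburg B μ (u i)) l (𝓝 0) := by
  have h0 : ∀ i, 0 ≤ luxemburg B μ (u i) := fun i => Real.sInf_nonneg fun r hr => hr.1.le
  rw [Metric.tendsto_nhds]
  intro ε hε
  -- A modular below `1` at scale `2/ε` makes `ε/2` an admissible radius.
  filter_upwards [hu, (h (2 / ε) (by positivity)).eventually_lt_const zero_lt_one] with i hi hlt
  rw [Real.dist_eq, sub_zero, abs_of_nonneg (h0 i)]
  refine lt_of_le_of_lt (csInf_le ⟨0, fun r hr => hr.1.le⟩ (a := ε / 2) ⟨by positivity, ?_, ?_⟩)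
    (half_lt_self hε)
  · exact (hD.memOrlicz_const_smul _ hi).2
  · rw [inv_div]
    exact hlt.le

/-- Superposition operators are continuous along modular convergence. -/
theorem tendsto_integral_comp [IsFiniteMeasure μ] (hD : DualPair A B σ S) {f : Vec n → ℝ} {C : ℝ}
    (hf : Continuous f) (hfC : ∀ y, |f y| ≤ C * (B y + 1)) {u : ℕ → Q → Vec n} {z : Q → Vec n}
    (hz : MemOrlicz B μ z) (hu : ∀ k, MemOrlicz B μ (u k))
    (h : ∀ M : ℝ, Tendsto (fun k => ∫ q, B (M • (u k q - z q)) ∂μ) atTop (𝓝 0)) :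
    Tendsto (fun k => ∫ q, f (u k q) ∂μ) atTop (𝓝 (∫ q, f (z q) ∂μ)) := by
  have hC : 0 ≤ C := by
    have := (abs_nonneg _).trans (hfC 0)
    rwa [hD.dual_zero, zero_add, mul_one] at this
  have hd : ∀ k, MemOrlicz B μ (fun q => u k q - z q) := fun k => hD.memOrlicz_sub (hu k) hz
  -- `‖y‖ ≤ B y + D` applied to `M (u k - z)` gives `M ∫‖u k - z‖ < 1 + D m` once the modular is
  -- below `1`; `M` is chosen so that this is less than `M ε`.
  have hL1 : Tendsto (fun k => ∫ q, ‖u k q - z q‖ ∂μ) atTop (𝓝 0) := by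
    obtain ⟨D, hD0, hDle⟩ := hD.dual_norm_le
    rw [Metric.tendsto_nhds]
    intro ε hε
    set m := μ.real univ
    have hm : 0 ≤ m := measureReal_nonneg
    set M := 2 * (D * m + 1) / ε
    have hM : 0 < M := by positivity
    filter_upwards [(h M).eventually_lt_const zero_lt_one] with k hk
    rw [Real.dist_eq, sub_zero, abs_of_nonneg (integral_nonneg fun _ => norm_nonneg _)]
    have h1 : M * ∫ q, ‖u k q - z q‖ ∂μ ≤ (∫ q, B (M • (u k q - z q)) ∂μ) + D * m := by
      rw [← integral_const_mul]
      have e : ∫ q, (B (M • (u k q - z q)) + D) ∂μ = (∫ q, B (M • (u k q - z q)) ∂μ) + D * m := by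
        rw [integral_add (hD.memOrlicz_const_smul _ (hd k)).2 (integrable_const D),
          integral_const, smul_eq_mul, mul_comm D]
      rw [← e]
      refine integral_mono ((hD.integrable_of_memOrlicz (hd k)).norm.const_mul _)
        ((hD.memOrlicz_const_smul _ (hd k)).2.add (integrable_const D)) fun q => ?_
      have := hDle (M • (u k q - z q))
      rwa [norm_smul, Real.norm_of_nonneg hM.le] at this
    have h2 : M * (∫ q, ‖u k q - z q‖ ∂μ) < M * ε := by
      have : M * ε = 2 * (D * m + 1) := div_mul_cancel₀ _ hε.ne'
      have : 0 ≤ D * m := by positivity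
      linarith
    exact lt_of_mul_lt_mul_left h2 hM.le
  -- Every subsequence has a further one converging almost everywhere, and it suffices to treat the
  -- latter.
  refine tendsto_of_subseq_tendsto fun ns hns => ?_
  obtain ⟨ms, hmono, hms⟩ := exists_subseq_tendsto_ae_of_tendsto_integral_norm
    (fun k => hD.integrable_of_memOrlicz (hu (ns k))) (hD.integrable_of_memOrlicz hz)
    (hL1.comp hns)
  have htop : Tendsto (fun k => ns (ms k)) atTop atTop := hns.comp hmono.tendsto_atTop
  refine ⟨ms, ?_⟩
  have hI2 : Integrable (fun q => B ((2 : ℝ) • z q)) μ := (hD.memOrlicz_const_smul _ hz).2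
  have hId : ∀ k, Integrable (fun q => B ((2 : ℝ) • (u k q - z q))) μ := fun k =>
    (hD.memOrlicz_const_smul _ (hd k)).2
  -- Writing `u = z + (u - z)` and using `dual_add_le`, the dominating function is a fixed
  -- integrable one plus a term that vanishes in `L¹` by modular convergence at scale `2`.
  refine tendsto_integral_of_dominated_of_tendsto
    (G := fun k q => C * ((1 / 2) * B ((2 : ℝ) • z q) + 1) +
      C * ((1 / 2) * B ((2 : ℝ) • (u (ns (ms k)) q - z q))))
    (g := fun q => C * ((1 / 2) * B ((2 : ℝ) • z q) + 1))
    (fun k => hf.comp_aestronglyMeasurable (hu _).1) (fun k => ?_) ?_ (fun k => ?_) ?_ ?_ ?_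
  · exact (((hI2.const_mul _).add (integrable_const _)).const_mul C).add
      (((hId _).const_mul _).const_mul _)
  · exact ((hI2.const_mul _).add (integrable_const _)).const_mul C
  · refine ae_of_all _ fun q => (hfC _).trans ?_
    rw [← mul_add]
    refine mul_le_mul_of_nonneg_left ?_ hC
    have := hD.dual_add_le (z q) (u (ns (ms k)) q - z q)
    rw [add_sub_cancel] at this
    linarith
  · refine ae_of_all _ fun q => (hfC _).trans (mul_le_mul_of_nonneg_left ?_ hC)
    have := hD.dual_add_le (z q) 0
    rw [add_zero, smul_zero, hD.dual_zero] at this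
    linarith
  · filter_upwards [hms] with q hq
    exact (hf.tendsto _).comp hq
  · have h2 := ((h 2).comp htop).const_mul (C * (1 / 2))
    rw [mul_zero] at h2
    refine h2.congr fun k => ?_
    simp only [Function.comp]
    rw [← integral_const_mul]
    refine integral_congr_ae (ae_of_all _ fun q => ?_)
    simp only
    have : 0 ≤ B ((2 : ℝ) • (u (ns (ms k)) q - z q)) := hD.dual_nonneg _
    rw [add_sub_cancel_left, abs_of_nonneg (by positivity), mul_assoc]

end DualPair

end EntropyCons

namespace EntropyCons

open UnitAddTorus

/-! ### Real trigonometric polynomials on the box -/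

instance : IsProbabilityMeasure (volume : Measure UnitAddCircle) :=
  ⟨UnitAddCircle.measure_univ⟩

theorem mFourier_add_apply {d : ℕ} (m : Fin d → ℤ) (x y : Box d) :
    mFourier m (x + y) = mFourier m x * mFourier m y := by
  simp [mFourier, ← Finset.prod_mul_distrib, fourier_apply, AddCircle.toCircle_add]

theorem mFourier_neg_apply {d : ℕ} (m : Fin d → ℤ) (x : Box d) :
    mFourier m (-x) = mFourier (-m) x := by
  simp [mFourier, fourier_apply]

theorem mFourier_pi_single {d : ℕ} (m : Fin d → ℤ) (i : Fin d) (s : UnitAddCircle) :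
    mFourier m (Pi.single i s) = fourier (m i) s := by
  simp only [mFourier, ContinuousMap.coe_mk]
  rw [Finset.prod_eq_single i (fun j _ hj => ?_) (by simp), Pi.single_eq_same]
  rw [Pi.single_eq_of_ne hj]
  simp

/-- The real trigonometric polynomial `Re ∑_{m ∈ s} c_m e^{2πi m·x}`. -/
def trigPoly {d : ℕ} (s : Finset (Fin d → ℤ)) (c : (Fin d → ℤ) → ℂ) (x : Box d) : ℝ :=
  ∑ m ∈ s, (c m * mFourier m x).re

/-- The symbol `∏ᵢ (2πi mᵢ)^{αᵢ}` of `∂_α`. -/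
def derivSymbol {d : ℕ} (α : Fin d → ℕ) (m : Fin d → ℤ) : ℂ :=
  ∏ i, (2 * Real.pi * Complex.I * m i) ^ α i

theorem derivSymbol_neg {d : ℕ} (α : Fin d → ℕ) (m : Fin d → ℤ) :
    derivSymbol α (-m) = (-1) ^ (∑ i, α i) * derivSymbol α m := by
  rw [derivSymbol, derivSymbol, ← Finset.prod_pow_eq_pow_sum, ← Finset.prod_mul_distrib]
  refine Finset.prod_congr rfl fun i _ => ?_
  rw [← mul_pow]
  congr 1
  simp

theorem continuous_trigPoly {d : ℕ} (s : Finset (Fin d → ℤ)) (c : (Fin d → ℤ) → ℂ) :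
    Continuous (trigPoly s c) := by
  unfold trigPoly
  fun_prop

theorem smoothBox_trigPoly {d : ℕ} (s : Finset (Fin d → ℤ)) (c : (Fin d → ℤ) → ℂ) :
    SmoothBox (trigPoly s c) := by
  unfold SmoothBox trigPoly
  refine ContDiff.sum fun m _ => ?_
  refine Complex.reCLM.contDiff.comp (contDiff_const.mul ?_)
  simp only [mFourier, ContinuousMap.coe_mk, toBox, fourier_coe_apply]
  refine contDiff_prod fun i _ => ?_
  refine (Complex.contDiff_exp (𝕜 := ℝ)).comp ?_
  refine ContDiff.div_const (contDiff_const.mul ?_) _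
  exact Complex.ofRealCLM.contDiff.comp (contDiff_apply ℝ ℝ i)

theorem partialD_trigPoly {d : ℕ} (s : Finset (Fin d → ℤ)) (c : (Fin d → ℤ) → ℂ) (i : Fin d) :
    partialD i (trigPoly s c) = trigPoly s (fun m => 2 * Real.pi * Complex.I * m i * c m) := by
  funext x
  unfold partialD trigPoly
  refine HasDerivAt.deriv (HasDerivAt.fun_sum fun m _ => ?_)
  have h1 : HasDerivAt (fun t : ℝ => (fourier (m i) (t : AddCircle (1 : ℝ)) : ℂ))
      (2 * Real.pi * Complex.I * m i) 0 := by
    simpa using hasDerivAt_fourier 1 (m i) 0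
  have h2 := (h1.const_mul (c m * mFourier m x))
  have h3 := Complex.reCLM.hasFDerivAt.comp_hasDerivAt (0 : ℝ) h2
  convert! h3 using 1
  · funext t
    simp only [Function.comp, Complex.reCLM_apply]
    rw [mFourier_add_apply, mFourier_pi_single, mul_assoc]
  · rw [Complex.reCLM_apply]
    congr 1
    ring

theorem iterate_partialD_trigPoly {d : ℕ} (s : Finset (Fin d → ℤ)) (c : (Fin d → ℤ) → ℂ)
    (i : Fin d) (k : ℕ) : (partialD i)^[k] (trigPoly s c) =
      trigPoly s (fun m => (2 * Real.pi * Complex.I * m i) ^ k * c m) := by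
  induction k with
  | zero => simp
  | succ k ih =>
    rw [Function.iterate_succ_apply', ih, partialD_trigPoly]
    congr 1
    funext m
    ring

theorem multiD_trigPoly {d : ℕ} (s : Finset (Fin d → ℤ)) (c : (Fin d → ℤ) → ℂ) (α : Fin d → ℕ) :
    multiD α (trigPoly s c) = trigPoly s (fun m => derivSymbol α m * c m) := by
  have key : ∀ l : List (Fin d), l.foldr (fun i g => (partialD i)^[α i] g) (trigPoly s c) =
      trigPoly s (fun m => (l.map fun i => (2 * Real.pi * Complex.I * m i : ℂ) ^ α i).prod * c m) := by
    intro l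
    induction l with
    | nil => simp
    | cons i l ih =>
      rw [List.foldr_cons, ih, iterate_partialD_trigPoly]
      congr 1
      funext m
      rw [List.map_cons, List.prod_cons]
      ring
  rw [multiD, key]
  simp only [derivSymbol, Fin.prod_univ_def]

theorem trigPoly_const_mul {d : ℕ} (s : Finset (Fin d → ℤ)) (c : (Fin d → ℤ) → ℂ) (r : ℝ)
    (x : Box d) : trigPoly s (fun m => r * c m) x = r * trigPoly s c x := by
  simp only [trigPoly, Finset.mul_sum, mul_assoc, Complex.re_ofReal_mul]

/-- The Fourier coefficient of a real function. -/
def fourierCoef {d : ℕ} (f : Box d → ℝ) (m : Fin d → ℤ) : ℂ := ∫ y, (f y : ℂ) * mFourier (-m) y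

theorem integrable_mul_mFourier {d : ℕ} {f : Box d → ℝ} (hf : Integrable f) (m : Fin d → ℤ) :
    Integrable (fun y => (f y : ℂ) * mFourier m y) := by
  refine hf.ofReal.mul_bdd (c := 1) (mFourier m).continuous.aestronglyMeasurable
    (ae_of_all _ fun y => ?_)
  exact ((mFourier m).norm_coe_le_norm y).trans mFourier_norm.le

theorem integral_mul_trigPoly {d : ℕ} {f : Box d → ℝ} (hf : Integrable f)
    (s : Finset (Fin d → ℤ)) (c : (Fin d → ℤ) → ℂ) :
    ∫ y, f y * trigPoly s c y = ∑ m ∈ s, (c m * fourierCoef f (-m)).re := by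
  have e : ∀ y, f y * trigPoly s c y = ∑ m ∈ s, (c m * ((f y : ℂ) * mFourier m y)).re := by
    intro y
    rw [trigPoly, Finset.mul_sum]
    refine Finset.sum_congr rfl fun m _ => ?_
    rw [← Complex.re_ofReal_mul]
    congr 1
    ring
  have hi : ∀ m, Integrable (fun y => c m * ((f y : ℂ) * mFourier m y)) := fun m =>
    (integrable_mul_mFourier hf m).const_mul _
  simp_rw [e]
  have hi' : ∀ m, Integrable (fun y => (c m * ((f y : ℂ) * mFourier m y)).re) := fun m => (hi m).re
  rw [integral_finsetSum _ fun m _ => hi' m]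
  refine Finset.sum_congr rfl fun m _ => ?_
  have := Complex.reCLM.integral_comp_comm (hi m)
  simp only [Complex.reCLM_apply] at this
  rw [this, integral_const_mul, fourierCoef, neg_neg]

end EntropyCons

namespace EntropyCons

open UnitAddTorus

/-! ### A nonnegative trigonometric approximate identity -/

instance (d : ℕ) : Measure.IsNegInvariant (volume : Measure (Box d)) :=
  Measure.IsAddHaarMeasure.isNegInvariant_of_regular volume

/-- The characters span an algebra, so powers of `d + 1 + ∑ cos(2πxᵢ)` are trigonometric polynomials
without any computation of coefficients. -/
theorem exists_trigPoly_pow_eq {d : ℕ} (k : ℕ) : ∃ (s : Finset (Fin d → ℤ)) (c : (Fin d → ℤ) → ℂ),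
    ∀ x : Box d, trigPoly s c x = (d + 1 + ∑ i, (fourier 1 (x i) : ℂ).re) ^ k := by
  let f : C(Box d, ℂ) := (d + 1 : ℂ) • 1 +
    ∑ i : Fin d, (1 / 2 : ℂ) • (mFourier (Pi.single i 1) + mFourier (-Pi.single i 1))
  have hf : f ∈ (mFourierSubalgebra (Fin d)).toSubalgebra := by
    have hm : ∀ m, mFourier m ∈ (mFourierSubalgebra (Fin d)).toSubalgebra := fun m =>
      Algebra.subset_adjoin ⟨m, rfl⟩
    exact add_mem (Subalgebra.smul_mem _ (one_mem _) _) (sum_mem fun i _ =>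
      Subalgebra.smul_mem _ (add_mem (hm _) (hm _)) _)
  have hfx : ∀ x, f x = ((d + 1 + ∑ i, (fourier 1 (x i) : ℂ).re : ℝ) : ℂ) := by
    intro x
    simp only [f, ContinuousMap.add_apply, ContinuousMap.sum_apply, ContinuousMap.smul_apply,
      ContinuousMap.one_apply, smul_eq_mul, mul_one, mFourier_neg, mFourier_single]
    push_cast
    congr 1
    refine Finset.sum_congr rfl fun i _ => ?_
    rw [Complex.add_conj]
    push_cast
    ring
  have hk : f ^ k ∈ Submodule.span ℂ (range (mFourier (d := Fin d))) := by
    rw [← mFourierSubalgebra_coe]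
    exact pow_mem hf k
  obtain ⟨a, ha⟩ := Finsupp.mem_span_range_iff_exists_finsupp.1 hk
  refine ⟨a.support, a, fun x => ?_⟩
  have h1 : (f ^ k) x = ∑ m ∈ a.support, a m * mFourier m x := by
    rw [← ha, Finsupp.sum, ContinuousMap.sum_apply]
    rfl
  rw [ContinuousMap.pow_apply, hfx, ← Complex.ofReal_pow] at h1
  rw [trigPoly, ← Complex.re_sum, ← h1, Complex.ofReal_re]

/-- The base function is at least `1` and has its unique maximum at the origin, so its normalised
powers concentrate there. Nonnegativity is kept for Jensen's inequality, and the trigonometric form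
makes every convolution smooth and explicit. -/
theorem exists_trigPoly_approx_identity (d : ℕ) :
    ∃ (s : ℕ → Finset (Fin d → ℤ)) (c : ℕ → (Fin d → ℤ) → ℂ),
      (∀ k x, 0 ≤ trigPoly (s k) (c k) x) ∧ (∀ k, ∫ x, trigPoly (s k) (c k) x = 1) ∧
      ∀ g : Box d → ℝ, Continuous g →
        Tendsto (fun k => ∫ x, trigPoly (s k) (c k) x * g x) atTop (𝓝 (g 0)) := by
  choose s c hsc using exists_trigPoly_pow_eq (d := d)
  set p : Box d → ℝ := fun x => d + 1 + ∑ i, (fourier 1 (x i) : ℂ).re with hp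
  have hpc : Continuous p := by
    simp only [hp]
    fun_prop
  have hnorm : ∀ y : UnitAddCircle, ‖(fourier 1 y : ℂ)‖ = 1 := fun y => Circle.norm_coe _
  have hge : ∀ y : UnitAddCircle, -1 ≤ (fourier 1 y : ℂ).re := fun y => by
    have := Complex.abs_re_le_norm (fourier 1 y : ℂ)
    rw [hnorm] at this
    exact (abs_le.1 this).1
  have hle : ∀ y : UnitAddCircle, (fourier 1 y : ℂ).re ≤ 1 := fun y => by
    have := Complex.abs_re_le_norm (fourier 1 y : ℂ)
    rw [hnorm] at this
    exact (abs_le.1 this).2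
  have heq : ∀ y : UnitAddCircle, (fourier 1 y : ℂ).re = 1 → y = 0 := fun y hy => by
    have h1 : (fourier 1 y : ℂ) = 1 := by
      have h2 : (fourier 1 y : ℂ).im = 0 := by
        have h3 := Complex.sq_norm (fourier 1 y : ℂ)
        rw [hnorm, Complex.normSq_apply, hy] at h3
        have : (fourier 1 y : ℂ).im * (fourier 1 y : ℂ).im = 0 := by linarith
        exact mul_self_eq_zero.1 this
      exact Complex.ext hy h2
    rw [fourier_one] at h1
    refine AddCircle.injective_toCircle one_ne_zero ?_
    rw [AddCircle.toCircle_zero]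
    exact Subtype.ext h1
  have hp1 : ∀ x, 1 ≤ p x := fun x => by
    have : ∑ _i : Fin d, (-1 : ℝ) ≤ ∑ i, (fourier 1 (x i) : ℂ).re :=
      Finset.sum_le_sum fun i _ => hge _
    simp at this
    simp only [hp]
    simp
    linarith
  have hpmax : ∀ x ∈ (univ : Set (Box d)), x ≠ 0 → p x < p 0 := fun x _ hx => by
    obtain ⟨i, hi⟩ := Function.ne_iff.1 hx
    simp only [hp]
    refine add_lt_add_right (Finset.sum_lt_sum (fun j _ => ?_) ⟨i, Finset.mem_univ i, ?_⟩) _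
    · simpa using hle (x j)
    · have : (fourier 1 (x i) : ℂ).re ≠ 1 := fun h => hi (heq _ h)
      simpa using lt_of_le_of_ne (hle (x i)) this
  have hpos : ∀ k : ℕ, 0 < ∫ x, p x ^ k := fun k => by
    have h1 : ∫ _x : Box d, (1 : ℝ) ≤ ∫ x, p x ^ k :=
      integral_mono (integrable_const _)
        ((hpc.pow k).integrable_of_hasCompactSupport (HasCompactSupport.of_compactSpace _)) fun x => one_le_pow₀ (hp1 x)
    simp at h1
    linarith
  have hT : ∀ k x, trigPoly (s k) (fun m => ((∫ x, p x ^ k)⁻¹ : ℝ) * c k m) x =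
      (∫ x, p x ^ k)⁻¹ * p x ^ k := fun k x => by
    rw [trigPoly_const_mul, hsc]
  refine ⟨s, fun k m => ((∫ x, p x ^ k)⁻¹ : ℝ) * c k m, fun k x => ?_, fun k => ?_, fun g hg => ?_⟩
  · rw [hT]
    have := hp1 x
    have := (hpos k).le
    positivity
  · simp_rw [hT]
    rw [integral_const_mul, inv_mul_cancel₀ (hpos k).ne']
  · simp_rw [hT]
    have := tendsto_setIntegral_pow_smul_of_unique_maximum_of_isCompact_of_continuousOn
      (μ := (volume : Measure (Box d))) isCompact_univ hpc.continuousOn hpmax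
      (fun x _ => zero_le_one.trans (hp1 x)) (zero_lt_one.trans_le (hp1 0))
      (by simp) hg.continuousOn
    simp only [Measure.restrict_univ, smul_eq_mul] at this
    refine this.congr fun k => ?_
    rw [← integral_const_mul]
    simp_rw [mul_assoc]

/-! ### Mollification -/

/-- Translations depend continuously on the shift and preserve the measure, hence they act
continuously on `L¹`. -/
theorem continuous_integral_norm_translate_sub {d : ℕ} {E : Type*} [NormedAddCommGroup E]
    {f : Box d → E} (hf : Integrable f) : Continuous fun y => ∫ x, ‖f (x - y) - f x‖ := by
  let τ : Box d → C(Box d, Box d) := fun y => ⟨fun x => x - y, by fun_prop⟩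
  have hτ : Continuous τ := by
    refine ContinuousMap.continuous_of_continuous_uncurry _ ?_
    simp only [Function.uncurry_def, τ, ContinuousMap.coe_mk]
    fun_prop
  have hm : ∀ y, MeasurePreserving (τ y) volume volume := fun y =>
    measurePreserving_sub_right volume y
  let F : Lp E 1 (volume : Measure (Box d)) := hf.toL1 f
  have h1 : Continuous fun y => ‖Lp.compMeasurePreserving (τ y) (hm y) F - F‖ :=
    ((continuous_const.compMeasurePreservingLp hτ hm ENNReal.one_ne_top).sub
      continuous_const).norm
  convert! h1 using 2 with y
  rw [L1.norm_eq_integral_norm]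
  refine integral_congr_ae ?_
  filter_upwards [Lp.coeFn_sub (Lp.compMeasurePreserving (τ y) (hm y) F) F,
    Lp.coeFn_compMeasurePreserving F (hm y), hf.coeFn_toL1,
    (hm y).quasiMeasurePreserving.ae hf.coeFn_toL1] with x h2 h3 h4 h5
  rw [h2, Pi.sub_apply, h3, Function.comp, h4, h5]
  rfl

/-- The convolution `ρ * f`. -/
def mollify {d : ℕ} {E : Type*} [NormedAddCommGroup E] [NormedSpace ℝ E] (ρ : Box d → ℝ)
    (f : Box d → E) (x : Box d) : E := ∫ y, ρ (x - y) • f y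

section Mollify

variable {d : ℕ} {E : Type*} [NormedAddCommGroup E] [NormedSpace ℝ E] {ρ : Box d → ℝ}
  {f : Box d → E}

theorem mollify_eq (ρ : Box d → ℝ) (f : Box d → E) (x : Box d) :
    mollify ρ f x = ∫ y, ρ y • f (x - y) := by
  rw [mollify, ← integral_sub_left_eq_self (fun y => ρ y • f (x - y)) volume x]
  simp

theorem integrable_kernel_smul (hρ : Continuous ρ) (hf : Integrable f) (x : Box d) :
    Integrable fun y => ρ (x - y) • f y := by
  obtain ⟨C, hC⟩ := (isCompact_univ (X := Box d)).exists_bound_of_continuousOn hρ.continuousOn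
  exact hf.bdd_smul C (by fun_prop : Continuous fun y => ρ (x - y)).aestronglyMeasurable
    (ae_of_all _ fun y => hC _ (mem_univ _))

theorem integral_kernel (hρ : ∫ x, ρ x = 1) (x : Box d) : ∫ y, ρ (x - y) = 1 := by
  rw [integral_sub_left_eq_self ρ volume x, hρ]

theorem integrable_kernel_prod (hρ : Continuous ρ) (hf : Integrable f) :
    Integrable (fun p : Box d × Box d => ρ p.2 • f (p.1 - p.2)) (volume.prod volume) := by
  obtain ⟨C, hC⟩ := (isCompact_univ (X := Box d)).exists_bound_of_continuousOn hρ.continuousOn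
  have h1 : Integrable (fun p : Box d × Box d => f (p.1 - p.2)) (volume.prod volume) := by
    have h2 : Integrable (fun p : Box d × Box d => f p.1) (volume.prod volume) := hf.comp_fst _
    have hmp : MeasurePreserving (fun p : Box d × Box d => (p.1 - p.2, p.2))
        (volume.prod volume) (volume.prod volume) := measurePreserving_sub_prod volume volume
    exact hmp.integrable_comp_of_integrable h2
  exact h1.bdd_smul C (hρ.comp continuous_snd).aestronglyMeasurable
    (ae_of_all _ fun y => hC _ (mem_univ _))

theorem integrable_mollify (hρ : Continuous ρ) (hf : Integrable f) : Integrable (mollify ρ f) := by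
  have := (integrable_kernel_prod hρ hf).integral_prod_left
  refine this.congr (ae_of_all _ fun x => ?_)
  rw [mollify_eq]

/-- Since the kernel has mass one, the error at `x` is the `ρ`-average of `f(x - y) - f(x)`; the
norm goes inside and Fubini exchanges the integrals. -/
theorem integral_norm_mollify_sub_le (hρ : Continuous ρ) (h0 : ∀ x, 0 ≤ ρ x) (h1 : ∫ x, ρ x = 1)
    [CompleteSpace E] (hf : Integrable f) :
    ∫ x, ‖mollify ρ f x - f x‖ ≤ ∫ y, ρ y * ∫ x, ‖f (x - y) - f x‖ := by
  have hρi : Integrable ρ := integrable_of_integral_eq_one h1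
  have hK : Integrable (fun p : Box d × Box d => ρ p.2 • (f (p.1 - p.2) - f p.1))
      (volume.prod volume) := by
    have h2 : Integrable (fun p : Box d × Box d => ρ p.2 • f p.1) (volume.prod volume) := by
      have := hρi.smul_prod hf
      exact this.swap
    simpa only [smul_sub] using! (integrable_kernel_prod hρ hf).sub h2
  have e : ∀ y, ρ y * ∫ x, ‖f (x - y) - f x‖ = ∫ x, ‖ρ y • (f (x - y) - f x)‖ := fun y => by
    rw [← integral_const_mul]
    simp_rw [norm_smul, Real.norm_of_nonneg (h0 y)]
  simp_rw [e]
  rw [integral_integral_swap (f := fun y x => ‖ρ y • (f (x - y) - f x)‖) hK.norm.swap]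
  refine integral_mono_of_nonneg (ae_of_all _ fun _ => norm_nonneg _) hK.norm.integral_prod_left ?_
  filter_upwards [hK.prod_right_ae, (integrable_kernel_prod hρ hf).prod_right_ae] with x hx hx2
  have : mollify ρ f x - f x = ∫ y, ρ y • (f (x - y) - f x) := by
    simp_rw [smul_sub]
    rw [integral_sub hx2 (hρi.smul_const _), integral_smul_const, h1, one_smul, mollify_eq]
  rw [this]
  exact norm_integral_le_integral_norm _

end Mollify

end EntropyCons

namespace EntropyCons

open UnitAddTorus

/-! ### The operators on trigonometric polynomials -/

theorem trigPoly_finsetSum {d : ℕ} {ι : Type*} (t : Finset ι) (s : Finset (Fin d → ℤ))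
    (c : ι → (Fin d → ℤ) → ℂ) (x : Box d) :
    trigPoly s (fun m => ∑ i ∈ t, c i m) x = ∑ i ∈ t, trigPoly s (c i) x := by
  simp only [trigPoly, Finset.sum_mul, Complex.re_sum]
  exact Finset.sum_comm

/-- Convolution multiplies Fourier coefficients. The mollification of a merely integrable function
is therefore a trigonometric polynomial, on which `∂_α` acts through its symbol. -/
theorem mollify_trigPoly {d : ℕ} {f : Box d → ℝ} (hf : Integrable f) (s : Finset (Fin d → ℤ))
    (c : (Fin d → ℤ) → ℂ) (x : Box d) :
    mollify (trigPoly s c) f x = trigPoly s (fun m => c m * fourierCoef f m) x := by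
  have e : ∀ y, trigPoly s c (x - y) • f y =
      ∑ m ∈ s, (c m * mFourier m x * ((f y : ℂ) * mFourier (-m) y)).re := by
    intro y
    rw [trigPoly, smul_eq_mul, Finset.sum_mul]
    refine Finset.sum_congr rfl fun m _ => ?_
    rw [sub_eq_add_neg, mFourier_add_apply, mFourier_neg_apply, mul_comm _ (f y),
      ← Complex.re_ofReal_mul]
    congr 1
    ring
  have hi : ∀ m, Integrable (fun y => c m * mFourier m x * ((f y : ℂ) * mFourier (-m) y)) :=
    fun m => (integrable_mul_mFourier hf (-m)).const_mul _
  have hi' : ∀ m, Integrable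
    (fun y => (c m * mFourier m x * ((f y : ℂ) * mFourier (-m) y)).re) := fun m => (hi m).re
  rw [mollify]
  simp_rw [e]
  rw [integral_finsetSum _ fun m _ => hi' m, trigPoly]
  refine Finset.sum_congr rfl fun m _ => ?_
  have := Complex.reCLM.integral_comp_comm (hi m)
  simp only [Complex.reCLM_apply] at this
  rw [this, integral_const_mul, fourierCoef]
  congr 1
  ring

theorem mollify_apply {d n : ℕ} {ρ : Box d → ℝ} (hρ : Continuous ρ) {z : Box d → Vec n}
    (hz : Integrable z) (x : Box d) (i : Fin n) :
    mollify ρ z x i = mollify ρ (fun y => z y i) x := by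
  have := (EuclideanSpace.proj (𝕜 := ℝ) i).integral_comp_comm (integrable_kernel_smul hρ hz x)
  simpa [mollify] using this.symm

theorem opL_trigPoly_smul {d n N : ℕ} (ν : ℕ) (b : Coeff d n N) (s : Finset (Fin d → ℤ))
    (c : (Fin d → ℤ) → ℂ) (E : Mat N) (x : Box d) (i : Fin n) :
    opL ν b (fun y => trigPoly s c y • E) x i = ∑ j ∈ Finset.range (ν + 1),
      ∑ α ∈ Finset.piAntidiag (Finset.univ : Finset (Fin d)) j,
        (∑ l, ∑ m, b i l m α * E l m) * trigPoly s (fun m => derivSymbol α m * c m) x := by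
  have h : ∀ α l m, multiD α (fun y => (trigPoly s c y • E) l m) x =
      E l m * trigPoly s (fun m => derivSymbol α m * c m) x := by
    intro α l m
    have e : (fun y => (trigPoly s c y • E) l m) = trigPoly s (fun k => (E l m : ℂ) * c k) := by
      funext y
      rw [trigPoly_const_mul, Matrix.smul_apply, smul_eq_mul, mul_comm]
    rw [e, multiD_trigPoly, ← trigPoly_const_mul]
    congr 1
    funext k
    ring
  simp only [opL, h]
  refine Finset.sum_congr rfl fun j _ => ?_
  simp only [Finset.sum_mul, mul_assoc]
  rw [Finset.sum_comm]
  calc _ = ∑ m, ∑ α ∈ Finset.piAntidiag (Finset.univ : Finset (Fin d)) j, ∑ l,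
        b i l m α * (E l m * trigPoly s (fun m => derivSymbol α m * c m) x) :=
        Finset.sum_congr rfl fun m _ => Finset.sum_comm
    _ = _ := by
        rw [Finset.sum_comm]
        exact Finset.sum_congr rfl fun α _ => Finset.sum_comm

/-- The symmetric matrix with entries `1` at `(l, k)` and `(k, l)` (and `2` if `l = k`). -/
def symUnit {N : ℕ} (l k : Fin N) : Mat N := Matrix.single l k 1 + Matrix.single k l 1

theorem isSymm_symUnit {N : ℕ} (l k : Fin N) : (symUnit l k).IsSymm := by
  rw [Matrix.IsSymm, symUnit, Matrix.transpose_add, Matrix.transpose_single,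
    Matrix.transpose_single, add_comm]

theorem sum_mul_symUnit {N : ℕ} (f : Fin N → Fin N → ℝ) (l k : Fin N) :
    ∑ i, ∑ j, f i j * symUnit l k i j = f l k + f k l := by
  simp only [symUnit, Matrix.add_apply, mul_add, Finset.sum_add_distrib]
  congr 1 <;>
  · rw [Finset.sum_eq_single_of_mem _ (Finset.mem_univ _), Finset.sum_eq_single_of_mem _
      (Finset.mem_univ _)]
    · rw [Matrix.single_apply_same, mul_one]
    · intro j _ hj
      rw [Matrix.single_apply_of_ne, mul_zero]
      exact fun h => hj h.2.symm
    · intro i _ hi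
      refine Finset.sum_eq_zero fun j _ => ?_
      rw [Matrix.single_apply_of_ne, mul_zero]
      exact fun h => hi h.1.symm

theorem isSymm_opLstar {d n N : ℕ} (ν : ℕ) (b : Coeff d n N) (a : Box d → Vec n) (x : Box d) :
    (opLstar ν b a x).IsSymm := by
  refine Matrix.IsSymm.ext fun l m => ?_
  simp only [opLstar, Matrix.of_apply, add_comm]

/-- Tests are real, so a complex coefficient is recovered from its real part (`c = 1`) and its
imaginary part (`c = I`). -/
theorem eq_of_re_mul_eq {w w' : ℂ} (h : ∀ c : ℂ, c = 1 ∨ c = Complex.I → (c * w).re = (c * w').re) :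
    w = w' := by
  have h1 := h 1 (Or.inl rfl)
  have h2 := h Complex.I (Or.inr rfl)
  simp at h1 h2
  exact Complex.ext h1 h2

/-- The weak form of `L^* z = G`, tested with trigonometric polynomials. -/
def TrigWeakLstar {d n N : ℕ} (ν : ℕ) (b : Coeff d n N) (z : Box d → Vec n)
    (G : Box d → Mat N) : Prop :=
  ∀ (m : Fin d → ℤ) (c : ℂ), c = 1 ∨ c = Complex.I → ∀ l k : Fin N,
    ∫ y, frob (G y) (trigPoly {m} (fun _ => c) y • symUnit l k) =
      ∫ y, inner ℝ (z y) (opL ν b (fun y' => trigPoly {m} (fun _ => c) y' • symUnit l k) y)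

/-! ### The weak equation `L^* z = G` on Fourier coefficients -/

section Weak

variable {d n N ν : ℕ} {b : Coeff d n N} {z : Box d → Vec n} {G : Box d → Mat N}

theorem integrable_coord {Q : Type*} [MeasurableSpace Q] {μ : Measure Q} {f : Q → Vec n}
    (hf : Integrable f μ) (i : Fin n) : Integrable (fun q => f q i) μ :=
  (EuclideanSpace.proj (𝕜 := ℝ) i).integrable_comp hf

/-- The test with frequency `m` and matrix `symUnit l k` reads off the coefficients at `-m`, and the
symmetry of `G` produces the factor `2`. Passing from `m` to `-m` turns the symbol of `∂_α` into
`(-1)^|α|` times itself, which is the sign in the formal adjoint. -/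
theorem TrigWeakLstar.fourierCoef_eq (h : TrigWeakLstar ν b z G) (hz : Integrable z)
    (hG : ∀ l k, Integrable fun x => G x l k) (hs : ∀ x, (G x).IsSymm) (m : Fin d → ℤ)
    (l k : Fin N) : fourierCoef (fun x => G x l k) m =
      ∑ j ∈ Finset.range (ν + 1), ∑ i, ∑ α ∈ Finset.piAntidiag (Finset.univ : Finset (Fin d)) j,
        (((-1) ^ j * ((b i l k α + b i k l α) / 2) : ℝ) : ℂ) *
          (derivSymbol α m * fourierCoef (fun x => z x i) m) := by
  have key : ∀ m, 2 * fourierCoef (fun x => G x l k) (-m) =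
      ∑ i, ∑ j ∈ Finset.range (ν + 1), ∑ α ∈ Finset.piAntidiag (Finset.univ : Finset (Fin d)) j,
        ((b i l k α + b i k l α : ℝ) : ℂ) *
          (derivSymbol α m * fourierCoef (fun x => z x i) (-m)) := by
    intro m
    refine eq_of_re_mul_eq fun c h1c => ?_
    have hc := h m c h1c l k
    have e1 : ∀ y, frob (G y) (trigPoly {m} (fun _ => c) y • symUnit l k) =
        2 * (G y l k * trigPoly {m} (fun _ => c) y) := by
      intro y
      have := sum_mul_symUnit (fun i j => G y i j * trigPoly {m} (fun _ => c) y) l k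
      simp only [frob, Matrix.smul_apply, smul_eq_mul]
      simp_rw [mul_assoc] at this ⊢
      rw [this, (hs y).apply l k]
      ring
    have e2 : ∀ y, (inner ℝ (z y)
        (opL ν b (fun y' => trigPoly {m} (fun _ => c) y' • symUnit l k) y) : ℝ) =
        ∑ i, ∑ j ∈ Finset.range (ν + 1), ∑ α ∈ Finset.piAntidiag (Finset.univ : Finset (Fin d)) j,
          (b i l k α + b i k l α) *
            (z y i * trigPoly {m} (fun m => derivSymbol α m * c) y) := by
      intro y
      rw [PiLp.inner_apply]
      refine Finset.sum_congr rfl fun i _ => ?_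
      rw [opL_trigPoly_smul]
      simp only [sum_mul_symUnit (fun l m => b i l m _), RCLike.inner_apply, conj_trivial,
        Finset.sum_mul]
      refine Finset.sum_congr rfl fun j _ => Finset.sum_congr rfl fun α _ => ?_
      ring
    have hi : ∀ i α, Integrable (fun y => (b i l k α + b i k l α) *
        (z y i * trigPoly {m} (fun m => derivSymbol α m * c) y)) := by
      intro i α
      obtain ⟨C, hC⟩ := (isCompact_univ (X := Box d)).exists_bound_of_continuousOn
        (continuous_trigPoly {m} (fun m => derivSymbol α m * c)).continuousOn
      exact ((integrable_coord hz i).mul_bdd (continuous_trigPoly _ _).aestronglyMeasurable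
        (ae_of_all _ fun y => hC y (mem_univ _))).const_mul _
    simp_rw [e1, e2] at hc
    rw [integral_const_mul, integral_mul_trigPoly (hG l k), integral_finsetSum _ fun i _ =>
      integrable_finsetSum _ fun j _ => integrable_finsetSum _ fun α _ => hi i α] at hc
    have e3 : ∀ i, ∫ y, ∑ j ∈ Finset.range (ν + 1),
        ∑ α ∈ Finset.piAntidiag (Finset.univ : Finset (Fin d)) j, (b i l k α + b i k l α) *
            (z y i * trigPoly {m} (fun m => derivSymbol α m * c) y) =
        ∑ j ∈ Finset.range (ν + 1), ∑ α ∈ Finset.piAntidiag (Finset.univ : Finset (Fin d)) j,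
          (b i l k α + b i k l α) *
            (derivSymbol α m * c * fourierCoef (fun x => z x i) (-m)).re := by
      intro i
      rw [integral_finsetSum _ fun j _ => integrable_finsetSum _ fun α _ => hi i α]
      refine Finset.sum_congr rfl fun j _ => ?_
      rw [integral_finsetSum _ fun α _ => hi i α]
      refine Finset.sum_congr rfl fun α _ => ?_
      rw [integral_const_mul, integral_mul_trigPoly (integrable_coord hz i), Finset.sum_singleton]
    simp_rw [e3] at hc
    rw [Finset.sum_singleton] at hc
    rw [mul_left_comm, ← Complex.ofReal_ofNat, Complex.re_ofReal_mul, hc]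
    simp only [Finset.mul_sum, Complex.re_sum]
    refine Finset.sum_congr rfl fun i _ => Finset.sum_congr rfl fun j _ =>
      Finset.sum_congr rfl fun α _ => ?_
    rw [← Complex.re_ofReal_mul]
    congr 1
    ring
  have h2 := key (-m)
  rw [neg_neg, Finset.sum_comm] at h2
  have h3 : fourierCoef (fun x => G x l k) m =
      (1 / 2 : ℂ) * (2 * fourierCoef (fun x => G x l k) m) := by ring
  rw [h3, h2]
  simp only [Finset.mul_sum]
  refine Finset.sum_congr rfl fun j _ => Finset.sum_congr rfl fun i _ =>
    Finset.sum_congr rfl fun α hα => ?_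
  rw [derivSymbol_neg, (Finset.mem_piAntidiag.1 hα).1]
  push_cast
  ring

/-- Convolution commutes with constant-coefficient operators, even if `L^* z` exists only weakly:
both sides are trigonometric polynomials with the same coefficients. -/
theorem TrigWeakLstar.opLstar_mollify (h : TrigWeakLstar ν b z G) (hz : Integrable z)
    (hG : ∀ l k, Integrable fun x => G x l k) (hs : ∀ x, (G x).IsSymm)
    (s : Finset (Fin d → ℤ)) (c : (Fin d → ℤ) → ℂ) (x : Box d) (l k : Fin N) :
    opLstar ν b (mollify (trigPoly s c) z) x l k =
      mollify (trigPoly s c) (fun y => G y l k) x := by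
  rw [mollify_trigPoly (hG l k)]
  have e : ∀ i, (fun y => mollify (trigPoly s c) z y i) =
      trigPoly s (fun m => c m * fourierCoef (fun x => z x i) m) := by
    intro i
    funext y
    rw [mollify_apply (continuous_trigPoly s c) hz, mollify_trigPoly (integrable_coord hz i)]
  simp only [opLstar, Matrix.of_apply, e, multiD_trigPoly]
  simp_rw [h.fourierCoef_eq hz hG hs, Finset.mul_sum, trigPoly_finsetSum]
  refine Finset.sum_congr rfl fun j _ => Finset.sum_congr rfl fun i _ =>
    Finset.sum_congr rfl fun α hα => ?_
  rw [← trigPoly_const_mul]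
  congr 1
  funext m
  ring

theorem smoothBox_mollify (hz : Integrable z) (s : Finset (Fin d → ℤ)) (c : (Fin d → ℤ) → ℂ) :
    SmoothBox (mollify (trigPoly s c) z) := by
  refine contDiff_euclidean.2 fun i => ?_
  have e : (fun y : Fin d → ℝ => mollify (trigPoly s c) z (toBox y) i) = fun y =>
      trigPoly s (fun m => c m * fourierCoef (fun x => z x i) m) (toBox y) := by
    funext y
    rw [mollify_apply (continuous_trigPoly s c) hz, mollify_trigPoly (integrable_coord hz i)]
  rw [e]
  exact smoothBox_trigPoly _ _

end Weak

/-! ### The `Λ`-order -/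

/-- By `|xᵢ Pᵢⱼ xⱼ| ≤ M (xᵢ² + xⱼ²)/2`, summed over `i` and `j`, the quadratic form of `P` is at
least `-N M |x|²`. -/
theorem posSemidef_smul_one_add {N : ℕ} {P : Mat N} (hP : P.IsSymm) {M : ℝ}
    (hM : ∀ i j, |P i j| ≤ M) : ((N * M) • (1 : Mat N) + P).PosSemidef := by
  refine Matrix.PosSemidef.of_dotProduct_mulVec_nonneg ?_ fun x => ?_
  · rw [Matrix.IsHermitian, Matrix.conjTranspose_eq_transpose_of_trivial]
    simp [hP.eq]
  · have h1 : ∀ i j, -(M * ((x i ^ 2 + x j ^ 2) / 2)) ≤ x i * (P i j * x j) := by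
      intro i j
      have h2 : |x i * (P i j * x j)| ≤ M * ((x i ^ 2 + x j ^ 2) / 2) := by
        have h3 : |x i * (P i j * x j)| = |P i j| * (|x i| * |x j|) := by
          rw [abs_mul, abs_mul]
          ring
        rw [h3]
        have h4 : |x i| * |x j| ≤ (x i ^ 2 + x j ^ 2) / 2 := by
          nlinarith [sq_nonneg (|x i| - |x j|), sq_abs (x i), sq_abs (x j)]
        exact mul_le_mul (hM i j) h4 (by positivity) ((abs_nonneg _).trans (hM i j))
      exact (abs_le.1 h2).1
    have h5 : ∑ i, ∑ j, -(M * ((x i ^ 2 + x j ^ 2) / 2)) ≤ ∑ i, ∑ j, x i * (P i j * x j) :=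
      Finset.sum_le_sum fun i _ => Finset.sum_le_sum fun j _ => h1 i j
    have h6 : ∑ i : Fin N, ∑ j : Fin N, -(M * ((x i ^ 2 + x j ^ 2) / 2)) =
        -(N * M * ∑ i, x i ^ 2) := by
      simp only [Finset.sum_neg_distrib, ← Finset.mul_sum, ← Finset.sum_div,
        Finset.sum_add_distrib, Finset.sum_const, Finset.card_univ, Fintype.card_fin, nsmul_eq_mul]
      ring
    have h7 : star x ⬝ᵥ ((N * M) • (1 : Mat N) + P).mulVec x =
        N * M * (∑ i, x i ^ 2) + ∑ i, ∑ j, x i * (P i j * x j) := by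
      rw [Matrix.add_mulVec, Matrix.smul_mulVec, Matrix.one_mulVec, dotProduct_add]
      simp only [dotProduct, Matrix.mulVec, Finset.mul_sum, Pi.smul_apply, smul_eq_mul,
        Pi.star_apply, star_trivial]
      congr 1
      exact Finset.sum_congr rfl fun i _ => by ring
    rw [h7]
    linarith

theorem frob_add_right {N : ℕ} (A P Q : Mat N) : frob A (P + Q) = frob A P + frob A Q := by
  simp [frob, mul_add, Finset.sum_add_distrib]

theorem frob_smul_right {N : ℕ} (A P : Mat N) (r : ℝ) : frob A (r • P) = r * frob A P := by
  simp only [frob, Finset.mul_sum, Matrix.smul_apply, smul_eq_mul]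
  exact Finset.sum_congr rfl fun i _ => Finset.sum_congr rfl fun j _ => by ring

theorem frob_one_right {N : ℕ} (A : Mat N) : frob A 1 = A.trace := by
  simp [frob, Matrix.trace, Matrix.one_apply]

/-- `|F(v) : P| ≤ C (K(v) + 1)` for bounded `P ∈ Λ`. -/
theorem exists_abs_frob_le {n N : ℕ} {Λ : Submodule ℝ (Mat N)} {F : Vec n → Mat N} (h1 : 1 ∈ Λ)
    (hF : ∀ v, ∀ P ∈ Λ, P.PosSemidef → 0 ≤ frob (F v) P) (hK : ∀ v, 0 ≤ entropy F v) (M : ℝ) :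
    ∃ C, 0 ≤ C ∧ ∀ P ∈ Λ, P.IsSymm → (∀ i j, |P i j| ≤ M) → ∀ v,
      |frob (F v) P| ≤ C * (entropy F v + 1) := by
  refine ⟨|N * M| * (2 + |(F 0).trace|), by positivity, fun P hP hs hM v => ?_⟩
  -- Both `N M I + P` and `N M I - P` are nonnegative elements of `Λ`, so `|F(v) : P| ≤ N M tr
  -- F(v)`, and the trace is `2K(v) + tr F(0)`.
  have hpos := hF v _ (add_mem (Λ.smul_mem (N * M) h1) hP) (posSemidef_smul_one_add hs hM)
  have hneg := hF v _ (add_mem (Λ.smul_mem (N * M) h1) (neg_mem hP))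
    (posSemidef_smul_one_add hs.neg (M := M) fun i j => by simpa using hM i j)
  have e : frob (F v) (-P) = -frob (F v) P := by
    have := frob_smul_right (F v) P (-1)
    rwa [neg_one_smul, neg_one_mul] at this
  rw [frob_add_right, frob_smul_right, frob_one_right] at hpos hneg
  rw [e] at hneg
  have htr : (F v).trace = 2 * entropy F v + (F 0).trace := by
    rw [entropy, Matrix.trace_sub]
    ring
  have h2 : |frob (F v) P| ≤ N * M * (F v).trace := abs_le.2 ⟨by linarith, by linarith⟩
  have h3 : N * M * (F v).trace ≤ |N * M| * |(F v).trace| := by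
    rw [← abs_mul]
    exact le_abs_self _
  have h4 : |(F v).trace| ≤ (2 + |(F 0).trace|) * (entropy F v + 1) := by
    rw [htr]
    refine (abs_add_le _ _).trans ?_
    rw [abs_of_nonneg (by linarith [hK v])]
    nlinarith [hK v, abs_nonneg (F 0).trace]
  calc _ ≤ |N * M| * |(F v).trace| := h2.trans h3
    _ ≤ _ := by
      rw [mul_assoc]
      exact mul_le_mul_of_nonneg_left h4 (abs_nonneg _)

end EntropyCons

namespace EntropyCons

/-! ### Conservativity for irregular fields -/

theorem tendsto_integral_norm_mollify_sub {d : ℕ} {E : Type*} [NormedAddCommGroup E]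
    [NormedSpace ℝ E] [CompleteSpace E] {f : Box d → E} (hf : Integrable f)
    {ρ : ℕ → Box d → ℝ} (hρ : ∀ k, Continuous (ρ k)) (h0 : ∀ k x, 0 ≤ ρ k x)
    (h1 : ∀ k, ∫ x, ρ k x = 1) (hlim : ∀ g : Box d → ℝ, Continuous g →
      Tendsto (fun k => ∫ x, ρ k x * g x) atTop (𝓝 (g 0))) :
    Tendsto (fun k => ∫ x, ‖mollify (ρ k) f x - f x‖) atTop (𝓝 0) := by
  have h2 := hlim _ (continuous_integral_norm_translate_sub hf)
  simp only [sub_zero, sub_self, norm_zero, integral_zero] at h2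
  exact squeeze_zero (fun k => integral_nonneg fun _ => norm_nonneg _)
    (fun k => integral_norm_mollify_sub_le (hρ k) (h0 k) (h1 k) hf) h2

theorem DualPair.dual_mollify_le {d n : ℕ} {A B : Vec n → ℝ} {σ S : Vec n → Vec n}
    (hD : DualPair A B σ S) {ρ : Box d → ℝ} (hρ : Continuous ρ) (h0 : ∀ x, 0 ≤ ρ x)
    (h1 : ∫ x, ρ x = 1) {z : Box d → Vec n} (hz : MemOrlicz B volume z) (x : Box d) :
    B (mollify ρ z x) ≤ mollify ρ (fun y => B (z y)) x := by
  set p := mollify ρ z x with hp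
  have hρi : Integrable fun y => ρ (x - y) :=
    integrable_of_integral_eq_one (integral_kernel h1 x)
  have hzi := integrable_kernel_smul hρ (hD.integrable_of_memOrlicz hz) x
  have hBi := integrable_kernel_smul hρ hz.2 x
  have hin : Integrable fun y => (inner ℝ (S p) (ρ (x - y) • z y) : ℝ) := hzi.const_inner _
  -- Jensen's inequality: the supporting hyperplane of `B` at the mean `p`, weighted by the kernel,
  -- is integrated over `y`.
  have h2 : ∀ y, ρ (x - y) * (B p - inner ℝ (S p) p) + inner ℝ (S p) (ρ (x - y) • z y) ≤
      ρ (x - y) • B (z y) := by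
    intro y
    have := mul_le_mul_of_nonneg_left
      (hD.dual_convex.add_inner_gradient_le (hD.hasGradientAt p) (z y)) (h0 (x - y))
    rw [inner_sub_right] at this
    rw [inner_smul_right, smul_eq_mul]
    linarith
  have h3 := integral_mono ((hρi.mul_const _).add hin) hBi h2
  rw [integral_add' (hρi.mul_const _) hin, integral_mul_const, integral_kernel h1, integral_inner hzi]
    at h3
  change 1 * (B p - inner ℝ (S p) p) + inner ℝ (S p) p ≤ _ at h3
  rw [mollify]
  linarith

theorem abs_mollify_le {d : ℕ} {ρ : Box d → ℝ} (h0 : ∀ x, 0 ≤ ρ x)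
    (h1 : ∫ x, ρ x = 1) {f : Box d → ℝ} {M : ℝ} (hM : ∀ᵐ x, |f x| ≤ M) (x : Box d) :
    |mollify ρ f x| ≤ M := by
  have hρi : Integrable fun y => ρ (x - y) :=
    integrable_of_integral_eq_one (integral_kernel h1 x)
  have := norm_integral_le_of_norm_le (hρi.mul_const M) (f := fun y => ρ (x - y) • f y) (by
    filter_upwards [hM] with y hy
    rw [norm_smul, Real.norm_of_nonneg (h0 _)]
    exact mul_le_mul_of_nonneg_left hy (h0 _))
  rwa [integral_mul_const, integral_kernel h1, one_mul] at this

theorem mollify_pi_apply {d N : ℕ} {ρ : Box d → ℝ} (hρ : Continuous ρ)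
    {G : Box d → Fin N → Fin N → ℝ} (hG : Integrable G) (x : Box d) (l k : Fin N) :
    mollify ρ G x l k = mollify ρ (fun y => G y l k) x := by
  have := ((ContinuousLinearMap.proj (R := ℝ) (φ := fun _ : Fin N => ℝ) k).comp
    (ContinuousLinearMap.proj (R := ℝ) (φ := fun _ : Fin N => Fin N → ℝ) l)).integral_comp_comm
      (integrable_kernel_smul hρ hG x)
  simpa [mollify] using this.symm

/-- Extension of formal conservativity from smooth `v^#` to Orlicz fields with bounded weak `L^*`.
The mollified identities hold by assumption and pass to the limit; `G` takes values in `Λ` as an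
a.e. limit of values of `L^*` on smooth fields. -/
theorem TrigWeakLstar.mem_and_integral_frob_eq_zero {d n N ν : ℕ} {b : Coeff d n N}
    {F : Vec n → Mat N} {B : Vec n → ℝ} {S : Vec n → Vec n}
    (hD : DualPair (entropy F) B (sharp F) S) (hFc : ∀ i j, Continuous fun v => F v i j)
    (hF : ∀ v, ∀ P ∈ Lam ν b, P.PosSemidef → 0 ≤ frob (F v) P)
    (h_cons : FormallyConservative ν b F) {z : Box d → Vec n} {G : Box d → Mat N}
    (h : TrigWeakLstar ν b z G) (hz : MemOrlicz B volume z)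
    (hGm : ∀ l k, AEStronglyMeasurable (fun x => G x l k) volume) {M : ℝ}
    (hM : ∀ l k, ∀ᵐ x, |G x l k| ≤ M) (hs : ∀ x, (G x).IsSymm) :
    (∀ᵐ x, G x ∈ Lam ν b) ∧ ∫ x, frob (F (S (z x))) (G x) = 0 := by
  obtain ⟨s, c, h0, h1, hlim⟩ := exists_trigPoly_approx_identity d
  have hρ : ∀ k, Continuous (trigPoly (s k) (c k)) := fun k => continuous_trigPoly _ _
  have hzi := hD.integrable_of_memOrlicz hz
  have hGi : ∀ l k, Integrable fun x => G x l k := fun l k =>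
    (integrable_const M).mono' (hGm l k) (hM l k)
  -- Viewed as a function of two indices, `G` has a sup norm, so a single subsequence serves all
  -- entries.
  have hGi' : Integrable (ε := Fin N → Fin N → ℝ) (fun x => G x) :=
    Integrable.of_eval fun l => Integrable.of_eval fun k => hGi l k
  obtain ⟨n₁, hn₁, hz₁⟩ := exists_subseq_tendsto_ae_of_tendsto_integral_norm
    (fun k => integrable_mollify (hρ k) hzi) hzi
    (tendsto_integral_norm_mollify_sub hzi hρ h0 h1 hlim)
  obtain ⟨n₂, hn₂, hG₂⟩ := exists_subseq_tendsto_ae_of_tendsto_integral_norm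
    (E := Fin N → Fin N → ℝ) (fun k => integrable_mollify (hρ (n₁ k)) hGi') hGi'
    ((tendsto_integral_norm_mollify_sub hGi' hρ h0 h1 hlim).comp hn₁.tendsto_atTop)
  have hn : Tendsto (fun k => n₁ (n₂ k)) atTop atTop :=
    hn₁.tendsto_atTop.comp hn₂.tendsto_atTop
  set Z : ℕ → Box d → Vec n := fun k =>
    mollify (trigPoly (s (n₁ (n₂ k))) (c (n₁ (n₂ k)))) z with hZ
  have hLZ : ∀ k x l m, opLstar ν b (Z k) x l m =
      mollify (trigPoly (s (n₁ (n₂ k))) (c (n₁ (n₂ k)))) (fun y => G y l m) x := fun k x l m =>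
    h.opLstar_mollify hzi hGi hs _ _ x l m
  have hlimZ : ∀ᵐ x, Tendsto (fun k => Z k x) atTop (𝓝 (z x)) := by
    filter_upwards [hz₁] with x hx
    exact hx.comp hn₂.tendsto_atTop
  have hlimG : ∀ᵐ x, ∀ l m, Tendsto (fun k => opLstar ν b (Z k) x l m) atTop (𝓝 (G x l m)) := by
    filter_upwards [hG₂] with x hx l m
    have := (tendsto_pi_nhds.1 (tendsto_pi_nhds.1 hx l)) m
    refine this.congr fun k => ?_
    rw [hLZ, mollify_pi_apply (hρ _) hGi']
  have hmemk : ∀ k x, opLstar ν b (Z k) x ∈ Lam ν b := fun k x =>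
    Submodule.subset_span (Or.inr ⟨Z k, smoothBox_mollify hzi _ _, x, rfl⟩)
  have hmem : ∀ᵐ x, G x ∈ Lam ν b := by
    filter_upwards [hlimG] with x hx
    refine (Submodule.closed_of_finiteDimensional (Lam ν b)).mem_of_tendsto
      (tendsto_pi_nhds.2 fun l => tendsto_pi_nhds.2 fun m => hx l m)
      (Eventually.of_forall fun k => hmemk k x)
  refine ⟨hmem, ?_⟩
  obtain ⟨C, hC, hCle⟩ := exists_abs_frob_le (Submodule.subset_span (Or.inl rfl)) hF hD.nonneg M
  obtain ⟨D, hD0, hDle⟩ := hD.inv_bound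
  -- The flux product is bounded by an affine function of `B`. For mollified fields `B` is at most
  -- the mollified `B(z)`, and this converges in `L¹`, so the dominating functions converge as well.
  have hbound : ∀ P ∈ Lam ν b, P.IsSymm → (∀ i j, |P i j| ≤ M) → ∀ y r, B y ≤ r →
      |frob (F (S y)) P| ≤ C * (D * (r + 1) + 1) := fun P hP hPs hPM y r hr => by
    refine (hCle P hP hPs hPM (S y)).trans (mul_le_mul_of_nonneg_left ?_ hC)
    have := mul_le_mul_of_nonneg_left hr hD0
    linarith [hDle y]
  have hmB : ∀ k, Integrable (mollify (trigPoly (s (n₁ (n₂ k))) (c (n₁ (n₂ k))))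
      (fun y => B (z y))) := fun k => integrable_mollify (hρ _) hz.2
  have key : Tendsto (fun k => ∫ x, frob (F (S (Z k x))) (opLstar ν b (Z k) x)) atTop
      (𝓝 (∫ x, frob (F (S (z x))) (G x))) := by
    refine tendsto_integral_of_dominated_of_tendsto
      (G := fun k x => C * (D * (mollify (trigPoly (s (n₁ (n₂ k))) (c (n₁ (n₂ k))))
        (fun y => B (z y)) x + 1) + 1))
      (g := fun x => C * (D * (B (z x) + 1) + 1)) (fun k => ?_) (fun k => ?_) ?_ (fun k => ?_)
      ?_ ?_ ?_
    · have hzm : AEStronglyMeasurable (Z k) volume :=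
        (integrable_mollify (hρ _) hzi).aestronglyMeasurable
      refine Finset.aestronglyMeasurable_fun_sum _ fun l _ =>
        Finset.aestronglyMeasurable_fun_sum _ fun m _ => ?_
      refine (((hFc l m).comp hD.cont_inv).comp_aestronglyMeasurable hzm).mul ?_
      simp_rw [hLZ]
      exact (integrable_mollify (hρ _) (hGi l m)).aestronglyMeasurable
    · exact ((((hmB k).add (integrable_const 1)).const_mul D).add (integrable_const 1)).const_mul C
    · exact (((hz.2.add (integrable_const 1)).const_mul D).add (integrable_const 1)).const_mul C
    · refine ae_of_all _ fun x => hbound _ (hmemk k x) (isSymm_opLstar _ _ _ _) (fun l m => ?_) _ _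
        (hD.dual_mollify_le (hρ _) (h0 _) (h1 _) hz x)
      rw [hLZ]
      exact abs_mollify_le (h0 _) (h1 _) (hM l m) x
    · have hM' : ∀ᵐ x, ∀ l k, |G x l k| ≤ M := ae_all_iff.2 fun l => ae_all_iff.2 fun k => hM l k
      filter_upwards [hmem, hM'] with x hx hxM
      exact hbound _ hx (hs x) hxM _ _ le_rfl
    · filter_upwards [hlimZ, hlimG] with x hx hxG
      refine tendsto_finsetSum _ fun l _ => tendsto_finsetSum _ fun m _ => ?_
      exact ((((hFc l m).comp hD.cont_inv).tendsto _).comp hx).mul (hxG l m)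
    · have := ((tendsto_integral_norm_mollify_sub hz.2 hρ h0 h1 hlim).comp hn).const_mul (C * D)
      rw [mul_zero] at this
      refine this.congr fun k => ?_
      simp only [Function.comp]
      rw [← integral_const_mul]
      refine integral_congr_ae (ae_of_all _ fun x => ?_)
      simp only [Real.norm_eq_abs]
      rw [← abs_of_nonneg (mul_nonneg hC hD0), ← abs_mul]
      congr 1
      ring
  -- Every term of the sequence is zero by the smooth hypothesis for `v = S ∘ Z k`, whose sharp
  -- field is `Z k`.
  refine tendsto_nhds_unique key (tendsto_const_nhds.congr fun k => ?_)
  have e : (fun x => sharp F (S (Z k x))) = Z k := funext fun x => hD.right_inv _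
  have := h_cons (fun x => S (Z k x)) (by rw [e]; exact smoothBox_mollify hzi _ _)
  rw [e] at this
  exact this.symm

end EntropyCons

namespace EntropyCons

/-! ### One-dimensional analysis -/

/-- Test functions of time: smooth and compactly supported in `(0,T)`. -/
structure IsTimeTest {E : Type*} [NormedAddCommGroup E] [NormedSpace ℝ E] (T : ℝ) (φ : ℝ → E) :
    Prop where
  smooth : ContDiff ℝ ∞ φ
  compact : HasCompactSupport φ
  subset : tsupport φ ⊆ Ioo 0 T

section TimeTest

variable {E : Type*} [NormedAddCommGroup E] [NormedSpace ℝ E] {T : ℝ} {φ : ℝ → E}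

theorem IsTimeTest.exists_Icc (hT : 0 < T) (hφ : IsTimeTest T φ) :
    ∃ a b, 0 < a ∧ a ≤ b ∧ b < T ∧ ∀ t, t ∉ Icc a b → φ t = 0 := by
  -- The extra point `T / 2` keeps the set nonempty when `φ = 0`, so that its infimum and supremum
  -- lie in `(0,T)`.
  have hK : IsCompact (tsupport φ ∪ {T / 2}) := hφ.compact.isCompact.union isCompact_singleton
  have hne : (tsupport φ ∪ {T / 2}).Nonempty := ⟨T / 2, Or.inr rfl⟩
  have hsub : tsupport φ ∪ {T / 2} ⊆ Ioo 0 T := by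
    refine union_subset hφ.subset ?_
    rintro _ rfl
    exact ⟨by linarith, by linarith⟩
  refine ⟨sInf (tsupport φ ∪ {T / 2}), sSup (tsupport φ ∪ {T / 2}), (hsub (hK.sInf_mem hne)).1,
    csInf_le_csSup hne hK.bddBelow hK.bddAbove, (hsub (hK.sSup_mem hne)).2, fun t ht => ?_⟩
  by_contra h
  have : t ∈ tsupport φ ∪ {T / 2} := Or.inl (subset_tsupport _ h)
  exact ht ⟨csInf_le hK.bddBelow this, le_csSup hK.bddAbove this⟩

theorem IsTimeTest.deriv_eq_zero {φ : ℝ → E} {a b t : ℝ} (h : ∀ t, t ∉ Icc a b → φ t = 0)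
    (ht : t ∉ Icc a b) : deriv φ t = 0 := by
  have : φ =ᶠ[𝓝 t] fun _ => 0 := by
    filter_upwards [isClosed_Icc.isOpen_compl.mem_nhds ht] with s hs
    exact h s hs
  rw [this.deriv_eq, deriv_const]

theorem IsTimeTest.of_Icc {a b : ℝ} (hs : ContDiff ℝ ∞ φ) (ha : 0 < a) (hb : b < T)
    (h : ∀ t, t ∉ Icc a b → φ t = 0) : IsTimeTest T φ := by
  have hsub : tsupport φ ⊆ Icc a b := closure_minimal
    (fun t ht => by by_contra hc; exact ht (h t hc)) isClosed_Icc
  exact ⟨hs, isCompact_Icc.of_isClosed_subset (isClosed_tsupport _) hsub,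
    hsub.trans fun t ht => ⟨ha.trans_le ht.1, ht.2.trans_lt hb⟩⟩

end TimeTest

theorem exists_isTimeTest_integral_eq_one {T : ℝ} (hT : 0 < T) :
    ∃ χ : ℝ → ℝ, IsTimeTest T χ ∧ ∫ t, χ t = 1 := by
  let f : ContDiffBump (T / 2) := ⟨T / 8, T / 4, by positivity, by linarith⟩
  refine ⟨f.normed volume, ⟨f.contDiff_normed, f.hasCompactSupport_normed, ?_⟩, f.integral_normed⟩
  rw [f.tsupport_normed_eq, Real.closedBall_eq_Icc]
  intro t ht
  simp only [f, mem_Icc] at ht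
  exact ⟨by linarith [ht.1], by linarith [ht.2]⟩

theorem exists_primitive_isTimeTest {T : ℝ} (hT : 0 < T) {ψ : ℝ → ℝ} (hψ : IsTimeTest T ψ)
    (h0 : ∫ t, ψ t = 0) : ∃ η : ℝ → ℝ, IsTimeTest T η ∧ ∀ t, deriv η t = ψ t := by
  obtain ⟨a, b, ha, hab, hb, hz⟩ := hψ.exists_Icc hT
  have hc : Continuous ψ := hψ.smooth.continuous
  have hd : ∀ t, HasDerivAt (fun t => ∫ s in (0 : ℝ)..t, ψ s) (ψ t) t := fun t =>
    intervalIntegral.integral_hasDerivAt_right (hc.intervalIntegrable _ _)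
      hc.stronglyMeasurable.stronglyMeasurableAtFilter hc.continuousAt
  have hder : deriv (fun t => ∫ s in (0 : ℝ)..t, ψ s) = ψ := funext fun t => (hd t).deriv
  have hsm : ContDiff ℝ ∞ (fun t => ∫ s in (0 : ℝ)..t, ψ s) := by
    rw [contDiff_infty_iff_deriv, hder]
    exact ⟨fun t => (hd t).differentiableAt, hψ.smooth⟩
  refine ⟨_, .of_Icc hsm ha hb fun t ht => ?_, fun t => (hd t).deriv⟩
  rcases lt_or_ge t a with h | h
  · refine intervalIntegral.integral_zero_ae (ae_of_all _ fun s hs => hz s fun hs' => ?_)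
    rcases le_total 0 t with h1 | h1
    · rw [uIoc_of_le h1] at hs
      linarith [hs.2, hs'.1]
    · rw [uIoc_of_ge h1] at hs
      linarith [hs.2, hs'.1]
  · have hbt : b < t := by
      by_contra hcon
      exact ht ⟨h, not_lt.1 hcon⟩
    rw [intervalIntegral.integral_eq_integral_of_support_subset, h0]
    intro s hs
    have : s ∈ Icc a b := by
      by_contra hcon
      exact hs (hz s hcon)
    exact ⟨ha.trans_le this.1, this.2.trans hbt.le⟩

theorem IsTimeTest.setIntegral_eq {T : ℝ} {φ : ℝ → ℝ} (hφ : IsTimeTest T φ) (u : ℝ → ℝ) :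
    ∫ t in Ioo 0 T, φ t * u t = ∫ t, φ t * u t := by
  refine setIntegral_eq_integral_of_forall_compl_eq_zero fun t ht => ?_
  rw [image_eq_zero_of_notMem_tsupport (f := φ) (fun h => ht (hφ.subset h)), zero_mul]

theorem IsTimeTest.integrableOn_mul {T : ℝ} {φ : ℝ → ℝ} (hφ : IsTimeTest T φ) {u : ℝ → ℝ}
    (hu : IntegrableOn u (Ioo 0 T)) : IntegrableOn (fun t => φ t * u t) (Ioo 0 T) := by
  obtain ⟨C, hC⟩ := hφ.smooth.continuous.bounded_above_of_compact_support hφ.compact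
  exact hu.bdd_mul hφ.smooth.continuous.aestronglyMeasurable (ae_of_all _ hC)

/-- The lemma of du Bois-Reymond. -/
theorem ae_eq_const_of_integral_deriv_eq_zero {T : ℝ} (hT : 0 < T) {u : ℝ → ℝ}
    (hu : IntegrableOn u (Ioo 0 T))
    (h : ∀ φ : ℝ → ℝ, IsTimeTest T φ → ∫ t in Ioo 0 T, deriv φ t * u t = 0) :
    ∃ c, ∀ᵐ t ∂volume.restrict (Ioo 0 T), u t = c := by
  obtain ⟨χ, hχ, hχ1⟩ := exists_isTimeTest_integral_eq_one hT
  set c := ∫ t in Ioo 0 T, χ t * u t with hc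
  -- `φ - (∫ φ) χ` has mean zero, hence is the derivative of a test function and is annihilated by
  -- `u`.
  have key : ∀ φ : ℝ → ℝ, IsTimeTest T φ → ∫ t in Ioo 0 T, φ t * u t = (∫ t, φ t) * c := by
    intro φ hφ
    have hφi : Integrable φ := hφ.smooth.continuous.integrable_of_hasCompactSupport hφ.compact
    have hχi : Integrable χ := hχ.smooth.continuous.integrable_of_hasCompactSupport hχ.compact
    have hψ : IsTimeTest T (fun t => φ t - (∫ s, φ s) * χ t) := by
      refine ⟨hφ.smooth.sub (contDiff_const.mul hχ.smooth),
        hφ.compact.sub (hχ.compact.mul_left), ?_⟩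
      refine (tsupport_sub _ _).trans (union_subset hφ.subset ?_)
      exact (tsupport_mul_subset_right).trans hχ.subset
    obtain ⟨η, hη, hηd⟩ := exists_primitive_isTimeTest hT hψ (by
      rw [integral_sub hφi (hχi.const_mul _), integral_const_mul, hχ1, mul_one, sub_self])
    have := h η hη
    simp_rw [hηd, sub_mul, mul_assoc] at this
    rw [integral_sub (hφ.integrableOn_mul hu) ((hχ.integrableOn_mul hu).const_mul _),
      integral_const_mul] at this
    linarith
  refine ⟨c, ?_⟩
  have hloc : LocallyIntegrableOn (fun t => u t - c) (Ioo 0 T) :=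
    (hu.sub (integrableOn_const (by simp))).locallyIntegrableOn
  have := isOpen_Ioo.ae_eq_zero_of_integral_contDiff_smul_eq_zero hloc fun φ h1 h2 h3 => by
    have hφ : IsTimeTest T φ := ⟨h1, h2, h3⟩
    have hφi : Integrable φ := h1.continuous.integrable_of_hasCompactSupport h2
    simp only [smul_eq_mul]
    rw [← hφ.setIntegral_eq]
    simp_rw [mul_sub]
    rw [integral_sub (hφ.integrableOn_mul hu) (hφi.integrableOn.mul_const c), key φ hφ,
      integral_mul_const]
    have := hφ.setIntegral_eq (fun _ => 1)
    simp only [mul_one] at this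
    rw [this, sub_self]
  rw [ae_restrict_iff' measurableSet_Ioo]
  filter_upwards [this] with t ht hmem
  exact sub_eq_zero.1 (ht hmem)

/-! ### Absolutely continuous paths -/

/-- Absolute continuity concerns only sums of increments, so it passes to any map whose increments
are dominated. Primitives, the inverse weight and compositions with locally Lipschitz functions are
all treated this way. -/
theorem _root_.AbsolutelyContinuousOnInterval.of_dist_le {X Y : Type*} [PseudoMetricSpace X]
    [PseudoMetricSpace Y] {f : ℝ → X} {r : ℝ → Y} {a b C : ℝ}
    (hr : AbsolutelyContinuousOnInterval r a b)
    (h : ∀ s ∈ uIcc a b, ∀ t ∈ uIcc a b, dist (f s) (f t) ≤ C * dist (r s) (r t)) :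
    AbsolutelyContinuousOnInterval f a b := by
  rw [absolutelyContinuousOnInterval_iff] at hr ⊢
  intro ε hε
  have hC : 0 < |C| + 1 := by positivity
  obtain ⟨δ, hδ, hE⟩ := hr (ε / (|C| + 1)) (by positivity)
  refine ⟨δ, hδ, fun I hI hlt => ?_⟩
  calc ∑ i ∈ Finset.range I.1, dist (f (I.2 i).1) (f (I.2 i).2)
      ≤ ∑ i ∈ Finset.range I.1, (|C| + 1) * dist (r (I.2 i).1) (r (I.2 i).2) := by
        refine Finset.sum_le_sum fun i hi => ?_
        refine (h _ (hI.1 i hi).1 _ (hI.1 i hi).2).trans ?_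
        exact mul_le_mul_of_nonneg_right (by linarith [le_abs_self C]) dist_nonneg
    _ = (|C| + 1) * ∑ i ∈ Finset.range I.1, dist (r (I.2 i).1) (r (I.2 i).2) := by
        rw [Finset.mul_sum]
    _ < (|C| + 1) * (ε / (|C| + 1)) := mul_lt_mul_of_pos_left (hE I hI hlt) hC
    _ = ε := mul_div_cancel₀ _ hC.ne'

theorem absolutelyContinuousOnInterval_integral {E : Type*} [NormedAddCommGroup E]
    [NormedSpace ℝ E] {g : ℝ → E} {a b : ℝ} (hg : IntervalIntegrable g volume a b) :
    AbsolutelyContinuousOnInterval (fun t => ∫ s in a..t, g s) a b := by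
  refine AbsolutelyContinuousOnInterval.of_dist_le (C := 1)
    (hg.norm.absolutelyContinuousOnInterval_intervalIntegral (c := a) left_mem_uIcc)
    fun s hs t ht => ?_
  have hi : ∀ s ∈ uIcc a b, IntervalIntegrable g volume a s := fun s hs =>
    hg.mono_set (uIcc_subset_uIcc left_mem_uIcc hs)
  rw [one_mul, dist_eq_norm, dist_eq_norm, intervalIntegral.integral_interval_sub_left (hi s hs)
    (hi t ht), intervalIntegral.integral_interval_sub_left (hi s hs).norm (hi t ht).norm]
  exact intervalIntegral.norm_integral_le_abs_integral_norm

/-- The fundamental theorem of calculus for a function vanishing at both ends. The interval stops at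
`(b + T)/2`, short of `T`, because `𝒦⁻¹` is unbounded near `T`. -/
theorem setIntegral_eq_zero_of_absolutelyContinuous {T a b : ℝ} (ha : 0 < a) (hab : a ≤ b)
    (hb : b < T) {Q q : ℝ → ℝ} (hQ : AbsolutelyContinuousOnInterval Q 0 ((b + T) / 2))
    (hd : ∀ᵐ t ∂volume.restrict (Ioo 0 T), HasDerivAt Q (q t) t)
    (hQ0 : ∀ t, t ∉ Icc a b → Q t = 0) (hq0 : ∀ t, t ∉ Icc a b → q t = 0) :
    ∫ t in Ioo 0 T, q t = 0 := by
  have hc : 0 ≤ (b + T) / 2 := by linarith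
  have h1 := hQ.integral_deriv_eq_sub
  rw [hQ0 0 (fun h => by linarith [h.1]), hQ0 _ (fun h => by linarith [h.2]), sub_zero,
    intervalIntegral.integral_of_le hc] at h1
  have hsub : Ioc 0 ((b + T) / 2) ⊆ Ioo 0 T := fun t ht => ⟨ht.1, by linarith [ht.2]⟩
  rw [setIntegral_eq_of_subset_of_forall_sdiff_eq_zero measurableSet_Ioo hsub
    fun t ht => hq0 t fun h => ht.2 ⟨ht.1.1, by linarith [h.2]⟩]
  refine Eq.trans (integral_congr_ae ?_) h1
  filter_upwards [ae_restrict_of_ae_restrict_of_subset hsub hd] with t ht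
  exact ht.deriv.symm

/-! ### The weight -/

section Weight

variable {T : ℝ} {κ : ℝ → ℝ}

theorem IsWeight.intervalIntegrable (hT : 0 < T) (hκ : IsWeight T κ) :
    IntervalIntegrable κ volume 0 T := by
  obtain ⟨c, C, hc, h⟩ := hκ.2
  rw [intervalIntegrable_iff_integrableOn_Icc_of_le hT.le]
  refine Integrable.mono' (integrableOn_const (C := C) (by simp)) hκ.1.aestronglyMeasurable ?_
  rw [ae_restrict_iff' measurableSet_Icc]
  refine ae_of_all _ fun t ht => ?_
  rw [Real.norm_of_nonneg (hc.le.trans (h t ht).1)]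
  exact (h t ht).2

theorem IsWeight.cumWeight_eq (hT : 0 < T) (hκ : IsWeight T κ) {t : ℝ} (ht : t ∈ Icc 0 T) :
    cumWeight T κ t = (∫ s in (0 : ℝ)..T, κ s) - ∫ s in (0 : ℝ)..t, κ s := by
  have h := hκ.intervalIntegrable hT
  rw [cumWeight, intervalIntegral.integral_interval_sub_left h]
  exact h.mono_set (uIcc_subset_uIcc left_mem_uIcc (by rwa [uIcc_of_le hT.le]))

theorem IsWeight.absolutelyContinuous (hT : 0 < T) (hκ : IsWeight T κ) :
    AbsolutelyContinuousOnInterval (cumWeight T κ) 0 T := by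
  refine (absolutelyContinuousOnInterval_integral (hκ.intervalIntegrable hT)).of_dist_le (C := 1)
    fun s hs t ht => ?_
  rw [uIcc_of_le hT.le] at hs ht
  rw [hκ.cumWeight_eq hT hs, hκ.cumWeight_eq hT ht, dist_sub_left, one_mul]

theorem IsWeight.continuousOn (hT : 0 < T) (hκ : IsWeight T κ) :
    ContinuousOn (cumWeight T κ) (Icc 0 T) := by
  have := (hκ.absolutelyContinuous hT).continuousOn
  rwa [uIcc_of_le hT.le] at this

theorem IsWeight.ae_hasDerivAt (hT : 0 < T) (hκ : IsWeight T κ) :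
    ∀ᵐ t ∂volume.restrict (Ioo 0 T), HasDerivAt (cumWeight T κ) (-κ t) t := by
  rw [ae_restrict_iff' measurableSet_Ioo]
  filter_upwards [(hκ.intervalIntegrable hT).ae_hasDerivAt_integral] with t ht hmem
  have h1 := ht (by rw [uIcc_of_le hT.le]; exact Ioo_subset_Icc_self hmem) 0 left_mem_uIcc
  refine (h1.const_sub (∫ s in (0 : ℝ)..T, κ s)).congr_of_eventuallyEq ?_
  filter_upwards [isOpen_Ioo.mem_nhds hmem] with s hs
  exact hκ.cumWeight_eq hT (Ioo_subset_Icc_self hs)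

theorem IsWeight.exists_bounds (hT : 0 < T) (hκ : IsWeight T κ) :
    ∃ c C : ℝ, 0 < c ∧ (∀ t ∈ Icc 0 T, |κ t| ≤ C) ∧
      ∀ t ∈ Icc 0 T, c * (T - t) ≤ cumWeight T κ t ∧ cumWeight T κ t ≤ C * T := by
  obtain ⟨c, C, hc, h⟩ := hκ.2
  have hi := hκ.intervalIntegrable hT
  refine ⟨c, C, hc, fun t ht => ?_, fun t ht => ?_⟩
  · rw [abs_of_nonneg (hc.le.trans (h t ht).1)]
    exact (h t ht).2
  · have hi' : IntervalIntegrable κ volume t T :=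
      hi.mono_set (uIcc_subset_uIcc (by rwa [uIcc_of_le hT.le]) right_mem_uIcc)
    have hmem : ∀ s ∈ Icc t T, s ∈ Icc 0 T := fun s hs => ⟨ht.1.trans hs.1, hs.2⟩
    have h1 := intervalIntegral.integral_mono_on ht.2 (_root_.intervalIntegrable_const (c := c)) hi'
      fun s hs => (h s (hmem s hs)).1
    have h2 := intervalIntegral.integral_mono_on ht.2 hi' (_root_.intervalIntegrable_const (c := C))
      fun s hs => (h s (hmem s hs)).2
    rw [intervalIntegral.integral_const, smul_eq_mul] at h1 h2
    have hC : 0 ≤ C := hc.le.trans ((h t ht).1.trans (h t ht).2)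
    rw [cumWeight]
    refine ⟨by linarith, h2.trans ?_⟩
    rw [mul_comm]
    exact mul_le_mul_of_nonneg_left (by linarith [ht.1]) hC

theorem IsWeight.cumWeight_pos (hT : 0 < T) (hκ : IsWeight T κ) {t : ℝ} (ht : t ∈ Ico 0 T) :
    0 < cumWeight T κ t := by
  obtain ⟨c, C, hc, -, h⟩ := hκ.exists_bounds hT
  exact (mul_pos hc (sub_pos.2 ht.2)).trans_le (h t ⟨ht.1, ht.2.le⟩).1

/-- On `[0,r]` the weight satisfies `𝒦 ≥ c (T - r) > 0`, and inversion is Lipschitz on that range.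
-/
theorem IsWeight.absolutelyContinuous_inv (hT : 0 < T) (hκ : IsWeight T κ) {r : ℝ} (hr0 : 0 ≤ r)
    (hr : r < T) : AbsolutelyContinuousOnInterval (fun t => (cumWeight T κ t)⁻¹) 0 r := by
  obtain ⟨c, C, hc, -, h⟩ := hκ.exists_bounds hT
  have hsub : uIcc 0 r ⊆ uIcc 0 T := by
    rw [uIcc_of_le hr0, uIcc_of_le hT.le]
    exact Icc_subset_Icc_right hr.le
  refine ((hκ.absolutelyContinuous hT).mono hsub).of_dist_le (C := ((c * (T - r)) ^ 2)⁻¹)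
    fun s hs t ht => ?_
  rw [uIcc_of_le hr0] at hs ht
  have hm : 0 < c * (T - r) := mul_pos hc (sub_pos.2 hr)
  have hlow : ∀ s ∈ Icc 0 r, c * (T - r) ≤ cumWeight T κ s := fun s hs =>
    (mul_le_mul_of_nonneg_left (by linarith [hs.2]) hc.le).trans
      (h s ⟨hs.1, hs.2.trans hr.le⟩).1
  have h1 := hlow s hs
  have h2 := hlow t ht
  rw [Real.dist_eq, Real.dist_eq, inv_sub_inv (hm.trans_le h1).ne' (hm.trans_le h2).ne', abs_div,
    abs_sub_comm, div_eq_inv_mul, abs_of_pos (mul_pos (hm.trans_le h1) (hm.trans_le h2))]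
  refine mul_le_mul_of_nonneg_right ?_ (abs_nonneg _)
  refine inv_anti₀ (by positivity) ?_
  rw [sq]
  exact mul_le_mul h1 h2 hm.le (hm.trans_le h1).le

end Weight

/-! ### The path `t ↦ 𝒦(t)⁻¹ (u + ∫₀ᵗ g)` -/

/-- The path `t ↦ 𝒦(t)⁻¹ (u + ∫₀ᵗ g)`. -/
def path {n : ℕ} (T : ℝ) (κ : ℝ → ℝ) (u : Vec n) (g : ℝ → Vec n) (t : ℝ) : Vec n :=
  (cumWeight T κ t)⁻¹ • (u + ∫ s in (0 : ℝ)..t, g s)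

/-- The derivative of `path`. -/
def pathDeriv {n : ℕ} (T : ℝ) (κ : ℝ → ℝ) (u : Vec n) (g : ℝ → Vec n) (t : ℝ) : Vec n :=
  (cumWeight T κ t)⁻¹ • (g t + κ t • path T κ u g t)

section Path

variable {n : ℕ} {T : ℝ} {κ : ℝ → ℝ} {u : Vec n} {g : ℝ → Vec n}

theorem absolutelyContinuous_path (hT : 0 < T) (hκ : IsWeight T κ)
    (hg : IntervalIntegrable g volume 0 T) {r : ℝ} (hr0 : 0 ≤ r) (hr : r < T) :
    AbsolutelyContinuousOnInterval (path T κ u g) 0 r := by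
  have hsub : uIcc 0 r ⊆ uIcc 0 T := by
    rw [uIcc_of_le hr0, uIcc_of_le hT.le]
    exact Icc_subset_Icc_right hr.le
  refine (hκ.absolutelyContinuous_inv hT hr0 hr).smul
    (((absolutelyContinuousOnInterval_integral hg).mono hsub).of_dist_le (C := 1)
      (f := fun t => u + ∫ s in (0 : ℝ)..t, g s) fun s _ t _ => ?_)
  rw [dist_add_left, one_mul]

theorem ae_hasDerivAt_path (hT : 0 < T) (hκ : IsWeight T κ)
    (hg : IntervalIntegrable g volume 0 T) :
    ∀ᵐ t ∂volume.restrict (Ioo 0 T), HasDerivAt (path T κ u g) (pathDeriv T κ u g t) t := by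
  have h1 : ∀ᵐ t ∂volume.restrict (Ioo 0 T),
      HasDerivAt (fun t => u + ∫ s in (0 : ℝ)..t, g s) (g t) t := by
    rw [ae_restrict_iff' measurableSet_Ioo]
    filter_upwards [hg.ae_hasDerivAt_integral] with t ht hmem
    exact (ht (by rw [uIcc_of_le hT.le]; exact Ioo_subset_Icc_self hmem) 0 left_mem_uIcc).const_add u
  filter_upwards [h1, hκ.ae_hasDerivAt hT, ae_restrict_mem measurableSet_Ioo] with t h1 h2 hmem
  have hpos := hκ.cumWeight_pos hT ⟨hmem.1.le, hmem.2⟩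
  have h3 := (h2.inv hpos.ne').smul h1
  convert! h3 using 1
  rw [pathDeriv, path, smul_add, smul_smul, smul_smul]
  congr 2
  field_simp

/-- The path stays in a ball, on which the gradient `S` of `B` is bounded; so `B` is Lipschitz
there. -/
theorem DualPair.absolutelyContinuous_comp {A B : Vec n → ℝ} {σ S : Vec n → Vec n}
    (hD : DualPair A B σ S) {z : ℝ → Vec n} {a b : ℝ}
    (hz : AbsolutelyContinuousOnInterval z a b) :
    AbsolutelyContinuousOnInterval (fun t => B (z t)) a b := by
  obtain ⟨R, hR⟩ := hz.exists_bound
  obtain ⟨M, hM⟩ := (isCompact_closedBall (0 : Vec n) R).exists_bound_of_continuousOn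
    hD.cont_inv.continuousOn
  have key : ∀ x y, ‖y‖ ≤ R → B y - B x ≤ M * ‖x - y‖ := fun x y hy => by
    have h1 := hD.dual_convex.add_inner_gradient_le (hD.hasGradientAt y) x
    have h2 := neg_le_of_abs_le (abs_real_inner_le_norm (S y) (x - y))
    have h3 := mul_le_mul_of_nonneg_right (hM y (by simpa using hy)) (norm_nonneg (x - y))
    linarith
  refine hz.of_dist_le (C := M) fun s hs t ht => ?_
  rw [Real.dist_eq, dist_eq_norm, abs_le]
  have h1 := key (z s) (z t) (hR t ht)
  have h2 := key (z t) (z s) (hR s hs)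
  rw [norm_sub_rev] at h2
  constructor <;> linarith

/-- The chain rule for `B` along a path, in weak form. -/
theorem DualPair.setIntegral_chain {A B : Vec n → ℝ} {σ S : Vec n → Vec n}
    (hD : DualPair A B σ S) (hT : 0 < T) (hκ : IsWeight T κ)
    (hg : IntervalIntegrable g volume 0 T) {θ : ℝ → ℝ} (hθ : IsTimeTest T θ) :
    ∫ t in Ioo 0 T, (deriv θ t * B (path T κ u g t) +
      θ t * inner ℝ (S (path T κ u g t)) (pathDeriv T κ u g t)) = 0 := by
  obtain ⟨a, b, ha, hab, hb, hz⟩ := hθ.exists_Icc hT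
  have hac := absolutelyContinuous_path (u := u) hT hκ hg (r := (b + T) / 2) (by linarith)
    (by linarith)
  have hθac : AbsolutelyContinuousOnInterval θ 0 ((b + T) / 2) :=
    (hθ.smooth.of_le (by norm_cast)).contDiffOn.absolutelyContinuousOnInterval
  refine setIntegral_eq_zero_of_absolutelyContinuous ha hab hb
    (hθac.mul (hD.absolutelyContinuous_comp hac)) ?_ (fun t ht => ?_) fun t ht => ?_
  · filter_upwards [ae_hasDerivAt_path (u := u) hT hκ hg] with t ht
    have h1 := (hθ.smooth.differentiable (by simp) t).hasDerivAt
    have h2 := (hD.hasGradientAt (path T κ u g t)).hasFDerivAt.comp_hasDerivAt t ht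
    rw [InnerProductSpace.toDual_apply_apply] at h2
    -- The derivative of `θ B(z)` is the integrand: the gradient of `B` along the path is `S(z)`.
    exact h1.mul h2
  · rw [Pi.mul_apply, hz t ht, zero_mul]
  · rw [hz t ht, IsTimeTest.deriv_eq_zero hz ht, zero_mul, zero_mul, add_zero]

/-- Integration by parts along a path. -/
theorem setIntegral_path_parts (hT : 0 < T) (hκ : IsWeight T κ)
    (hg : IntervalIntegrable g volume 0 T) {φ : ℝ → Vec n} (hφ : IsTimeTest T φ) :
    ∫ t in Ioo 0 T, (inner ℝ (path T κ u g t) (deriv φ t) +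
      inner ℝ (pathDeriv T κ u g t) (φ t)) = 0 := by
  obtain ⟨a, b, ha, hab, hb, hz⟩ := hφ.exists_Icc hT
  have hac := absolutelyContinuous_path (u := u) hT hκ hg (r := (b + T) / 2) (by linarith)
    (by linarith)
  have hφac : AbsolutelyContinuousOnInterval φ 0 ((b + T) / 2) :=
    (hφ.smooth.of_le (by norm_cast)).contDiffOn.absolutelyContinuousOnInterval
  have hin : AbsolutelyContinuousOnInterval (fun t => (inner ℝ (path T κ u g t) (φ t) : ℝ)) 0
      ((b + T) / 2) := by
    -- The inner product is treated as a finite sum of products of absolutely continuous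
    -- coordinates.
    have hco : ∀ {f : ℝ → Vec n}, AbsolutelyContinuousOnInterval f 0 ((b + T) / 2) → ∀ i,
        AbsolutelyContinuousOnInterval (fun t => f t i) 0 ((b + T) / 2) := fun hf i =>
      hf.of_dist_le (C := 1) fun s _ t _ => by
        rw [one_mul, dist_eq_norm, dist_eq_norm]
        exact PiLp.norm_apply_le (p := 2) (_ - _ : Vec n) i
    have hsum : ∀ t : Finset (Fin n), AbsolutelyContinuousOnInterval
        (fun s => ∑ i ∈ t, path T κ u g s i * φ s i) 0 ((b + T) / 2) := by
      intro t
      induction t using Finset.induction_on with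
      | empty =>
        simp only [Finset.sum_empty]
        exact hφac.of_dist_le (C := 0) fun s _ t _ => by simp
      | insert i t hi ih =>
        simp_rw [Finset.sum_insert hi]
        exact ((hco hac i).mul (hco hφac i)).add ih
    convert! hsum Finset.univ using 2 with t
    simp [PiLp.inner_apply, mul_comm]
  refine setIntegral_eq_zero_of_absolutelyContinuous ha hab hb hin ?_ (fun t ht => ?_) fun t ht => ?_
  · filter_upwards [ae_hasDerivAt_path (u := u) hT hκ hg] with t ht
    exact ht.inner ℝ (hφ.smooth.differentiable (by simp) t).hasDerivAt
  · rw [hz t ht, inner_zero_right]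
  · rw [hz t ht, IsTimeTest.deriv_eq_zero hz ht, inner_zero_right, inner_zero_right, add_zero]

end Path

end EntropyCons

namespace EntropyCons

/-! ### Smooth fields of time and space -/

theorem isOpenQuotientMap_toBox (d : ℕ) : IsOpenQuotientMap (toBox (d := d)) :=
  IsOpenQuotientMap.piMap fun _ => QuotientAddGroup.isOpenQuotientMap_mk

theorem toBox_smul_single {d : ℕ} (s : ℝ) (i : Fin d) :
    toBox (s • Pi.single i (1 : ℝ)) = Pi.single i (s : UnitAddCircle) := by
  funext j
  rcases eq_or_ne j i with rfl | h
  · simp [toBox]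
  · simp [toBox, Pi.single_eq_of_ne h]

theorem toBox_smul_zero {d : ℕ} (s : ℝ) : toBox (s • (0 : Fin d → ℝ)) = 0 := by
  funext j
  simp [toBox]

theorem SmoothTimeBox.continuous {d : ℕ} {E : Type*} [NormedAddCommGroup E] [NormedSpace ℝ E]
    {f : ℝ × Box d → E} (hf : SmoothTimeBox f) : Continuous f :=
  (IsOpenQuotientMap.id.prodMap (isOpenQuotientMap_toBox d)).isQuotientMap.continuous_iff.2
    (ContDiff.continuous hf)

/-- The directional derivative of a scalar function of time and space. -/
def dirD {d : ℕ} (e : ℝ × (Fin d → ℝ)) (f : ℝ × Box d → ℝ) (p : ℝ × Box d) : ℝ :=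
  deriv (fun s : ℝ => f (p.1 + s * e.1, p.2 + toBox (s • e.2))) 0

theorem SmoothTimeBox.dirD_eq {d : ℕ} {f : ℝ × Box d → ℝ} (hf : SmoothTimeBox f)
    (e : ℝ × (Fin d → ℝ)) (t : ℝ) (y : Fin d → ℝ) : dirD e f (t, toBox y) =
      fderiv ℝ (fun p : ℝ × (Fin d → ℝ) => f (p.1, toBox p.2)) (t, y) e := by
  have h1 : HasFDerivAt (fun p : ℝ × (Fin d → ℝ) => f (p.1, toBox p.2))
      (fderiv ℝ (fun p : ℝ × (Fin d → ℝ) => f (p.1, toBox p.2)) (t, y)) ((t, y) + (0 : ℝ) • e) := by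
    rw [zero_smul, add_zero]
    exact (ContDiff.differentiable hf (by simp) _).hasFDerivAt
  have h2 : HasDerivAt (fun s : ℝ => (t, y) + s • e) e 0 := by
    simpa using ((hasDerivAt_id (0 : ℝ)).smul_const e).const_add (t, y)
  exact (h1.comp_hasDerivAt (0 : ℝ) h2).deriv

theorem SmoothTimeBox.dirD {d : ℕ} {f : ℝ × Box d → ℝ} (hf : SmoothTimeBox f)
    (e : ℝ × (Fin d → ℝ)) : SmoothTimeBox (dirD e f) := by
  have h : ContDiff ℝ ∞ (fun p : ℝ × (Fin d → ℝ) =>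
      fderiv ℝ (fun p : ℝ × (Fin d → ℝ) => f (p.1, toBox p.2)) p e) :=
    (ContDiff.fderiv_right (m := ∞) hf (by simp)).clm_apply contDiff_const
  have e1 : (fun p : ℝ × (Fin d → ℝ) => EntropyCons.dirD e f (p.1, toBox p.2)) = fun p =>
      fderiv ℝ (fun p : ℝ × (Fin d → ℝ) => f (p.1, toBox p.2)) p e :=
    funext fun p => hf.dirD_eq e p.1 p.2
  rw [SmoothTimeBox, e1]
  exact h

/-- Symmetry of the second derivative of the periodic lift; it lets `∂_t` pass through every `∂_α`.
-/
theorem SmoothTimeBox.dirD_comm {d : ℕ} {f : ℝ × Box d → ℝ} (hf : SmoothTimeBox f)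
    (e e' : ℝ × (Fin d → ℝ)) :
    EntropyCons.dirD e (EntropyCons.dirD e' f) = EntropyCons.dirD e' (EntropyCons.dirD e f) := by
  funext ⟨t, x⟩
  obtain ⟨y, rfl⟩ := (isOpenQuotientMap_toBox d).surjective x
  have key : ∀ e e', EntropyCons.dirD e (EntropyCons.dirD e' f) (t, toBox y) =
      fderiv ℝ (fderiv ℝ (fun p : ℝ × (Fin d → ℝ) => f (p.1, toBox p.2))) (t, y) e e' := by
    intro e e'
    rw [(hf.dirD e').dirD_eq]
    have h1 : (fun p : ℝ × (Fin d → ℝ) => EntropyCons.dirD e' f (p.1, toBox p.2)) =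
        fun p => fderiv ℝ (fun p : ℝ × (Fin d → ℝ) => f (p.1, toBox p.2)) p e' :=
      funext fun p => hf.dirD_eq e' p.1 p.2
    have hd : DifferentiableAt ℝ (fderiv ℝ (fun p : ℝ × (Fin d → ℝ) => f (p.1, toBox p.2)))
        (t, y) :=
      (ContDiff.fderiv_right (m := ∞) hf (by simp)).differentiable (by simp) _
    rw [h1, fderiv_clm_apply hd (differentiableAt_const e')]
    simp
  rw [key, key]
  have hs : IsSymmSndFDerivAt ℝ (fun p : ℝ × (Fin d → ℝ) => f (p.1, toBox p.2)) (t, y) :=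
    (ContDiff.contDiffAt hf).isSymmSndFDerivAt
      (by simpa using ENat.LEInfty.out)
  exact hs.eq e e'

/-- The time direction. -/
def timeDir (d : ℕ) : ℝ × (Fin d → ℝ) := (1, 0)

/-- The directions of space. -/
def spaceDir {d : ℕ} (i : Fin d) : ℝ × (Fin d → ℝ) := (0, Pi.single i 1)

theorem dirD_timeDir {d : ℕ} (f : ℝ × Box d → ℝ) (t : ℝ) (x : Box d) :
    dirD (timeDir d) f (t, x) = deriv (fun s => f (s, x)) t := by
  simp only [dirD, timeDir, mul_one, toBox_smul_zero, add_zero]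
  rw [deriv_comp_const_add (fun s => f (s, x)) t 0, add_zero]

theorem partialD_slice {d : ℕ} (f : ℝ × Box d → ℝ) (i : Fin d) (t : ℝ) :
    partialD i (fun y => f (t, y)) = fun y => dirD (spaceDir i) f (t, y) := by
  funext x
  simp only [partialD, dirD, spaceDir, mul_zero, add_zero, toBox_smul_single]

/-- The spatial derivative `∂_α` of a function of time and space. -/
def multiDT {d : ℕ} (α : Fin d → ℕ) (f : ℝ × Box d → ℝ) : ℝ × Box d → ℝ :=
  (List.finRange d).foldr (fun i g => (dirD (spaceDir i))^[α i] g) f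

theorem multiD_slice {d : ℕ} (α : Fin d → ℕ) (f : ℝ × Box d → ℝ) (t : ℝ) :
    multiD α (fun y => f (t, y)) = fun y => multiDT α f (t, y) := by
  have hit : ∀ (i : Fin d) (k : ℕ) (f : ℝ × Box d → ℝ), (partialD i)^[k] (fun y => f (t, y)) =
      fun y => (dirD (spaceDir i))^[k] f (t, y) := by
    intro i k f
    induction k with
    | zero => rfl
    | succ k ih => rw [Function.iterate_succ_apply', ih, partialD_slice, Function.iterate_succ_apply']
  rw [multiD, multiDT]
  induction List.finRange d with
  | nil => rfl
  | cons i l ih => rw [List.foldr_cons, ih, hit, List.foldr_cons]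

theorem SmoothTimeBox.iterate_dirD {d : ℕ} {f : ℝ × Box d → ℝ} (hf : SmoothTimeBox f)
    (e : ℝ × (Fin d → ℝ)) (k : ℕ) : SmoothTimeBox ((EntropyCons.dirD e)^[k] f) := by
  induction k with
  | zero => exact hf
  | succ k ih =>
    rw [Function.iterate_succ_apply']
    exact ih.dirD e

theorem SmoothTimeBox.multiDT {d : ℕ} {f : ℝ × Box d → ℝ} (hf : SmoothTimeBox f)
    (α : Fin d → ℕ) : SmoothTimeBox (multiDT α f) := by
  rw [EntropyCons.multiDT]
  induction List.finRange d with
  | nil => exact hf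
  | cons i l ih =>
    rw [List.foldr_cons]
    exact ih.iterate_dirD _ _

theorem SmoothTimeBox.dirD_multiDT {d : ℕ} {f : ℝ × Box d → ℝ} (hf : SmoothTimeBox f)
    (e : ℝ × (Fin d → ℝ)) (α : Fin d → ℕ) :
    EntropyCons.dirD e (EntropyCons.multiDT α f) = EntropyCons.multiDT α (EntropyCons.dirD e f) := by
  have hit : ∀ (e' : ℝ × (Fin d → ℝ)) (k : ℕ) (f : ℝ × Box d → ℝ), SmoothTimeBox f →
      EntropyCons.dirD e ((EntropyCons.dirD e')^[k] f) =
        (EntropyCons.dirD e')^[k] (EntropyCons.dirD e f) := by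
    intro e' k f hf
    induction k with
    | zero => rfl
    | succ k ih =>
      rw [Function.iterate_succ_apply', (hf.iterate_dirD e' k).dirD_comm, ih,
        Function.iterate_succ_apply']
  rw [EntropyCons.multiDT, EntropyCons.multiDT]
  have key : ∀ l : List (Fin d),
      SmoothTimeBox (l.foldr (fun i g => (EntropyCons.dirD (spaceDir i))^[α i] g) f) ∧
      EntropyCons.dirD e (l.foldr (fun i g => (EntropyCons.dirD (spaceDir i))^[α i] g) f) =
        l.foldr (fun i g => (EntropyCons.dirD (spaceDir i))^[α i] g) (EntropyCons.dirD e f) := by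
    intro l
    induction l with
    | nil => exact ⟨hf, rfl⟩
    | cons i l ih =>
      rw [List.foldr_cons, List.foldr_cons]
      exact ⟨ih.1.iterate_dirD _ _, by rw [hit _ _ _ ih.1, ih.2]⟩
  exact (key _).2

theorem multiD_const_mul {d : ℕ} (α : Fin d → ℕ) (r : ℝ) (f : Box d → ℝ) :
    multiD α (fun y => r * f y) = fun y => r * multiD α f y := by
  have hp : ∀ (i : Fin d) (f : Box d → ℝ),
      partialD i (fun y => r * f y) = fun y => r * partialD i f y := fun i f =>
    funext fun x => deriv_const_mul_field r
  have hit : ∀ (i : Fin d) (k : ℕ) (f : Box d → ℝ),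
      (partialD i)^[k] (fun y => r * f y) = fun y => r * (partialD i)^[k] f y := by
    intro i k f
    induction k with
    | zero => rfl
    | succ k ih => rw [Function.iterate_succ_apply', ih, hp, Function.iterate_succ_apply']
  rw [multiD, multiD]
  induction List.finRange d with
  | nil => rfl
  | cons i l ih => rw [List.foldr_cons, ih, hit, List.foldr_cons]

section Fields

variable {d n N : ℕ} {ν : ℕ} {b : Coeff d n N} {Ψ : ℝ × Box d → Mat N}

/-- The field `(t, x) ↦ L(Ψ(t))(x)`. -/
def opLField (ν : ℕ) (b : Coeff d n N) (Ψ : ℝ × Box d → Mat N) (p : ℝ × Box d) : Vec n :=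
  opL ν b (fun y => Ψ (p.1, y)) p.2

theorem opLField_apply (ν : ℕ) (b : Coeff d n N) (Ψ : ℝ × Box d → Mat N) (p : ℝ × Box d)
    (i : Fin n) : opLField ν b Ψ p i = ∑ j ∈ Finset.range (ν + 1), ∑ l, ∑ m,
      ∑ α ∈ Finset.piAntidiag (Finset.univ : Finset (Fin d)) j,
        b i l m α * multiDT α (fun p => Ψ p l m) p := by
  simp only [opLField, opL]
  refine Finset.sum_congr rfl fun j _ => Finset.sum_congr rfl fun l _ =>
    Finset.sum_congr rfl fun m _ => Finset.sum_congr rfl fun α _ => ?_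
  rw [multiD_slice α (fun p => Ψ p l m) p.1]

theorem smoothTimeBox_opLField (hΨ : ∀ i j, SmoothTimeBox (fun p => Ψ p i j)) :
    SmoothTimeBox (opLField ν b Ψ) := by
  refine contDiff_euclidean.2 fun i => ?_
  simp only [opLField_apply]
  refine ContDiff.sum fun j _ => ContDiff.sum fun l _ => ContDiff.sum fun m _ =>
    ContDiff.sum fun α _ => contDiff_const.mul ?_
  exact (hΨ l m).multiDT α

theorem SmoothTimeBox.hasDerivAt_time {f : ℝ × Box d → ℝ} (hf : SmoothTimeBox f) (t : ℝ)
    (x : Box d) : HasDerivAt (fun s => f (s, x)) (EntropyCons.dirD (timeDir d) f (t, x)) t := by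
  rw [dirD_timeDir]
  obtain ⟨y, rfl⟩ := (isOpenQuotientMap_toBox d).surjective x
  have h1 : ContDiff ℝ ∞ (fun s : ℝ => f (s, toBox y)) :=
    ContDiff.comp (g := fun p : ℝ × (Fin d → ℝ) => f (p.1, toBox p.2)) hf
      (contDiff_id.prodMk contDiff_const)
  exact (h1.differentiable (by simp) t).hasDerivAt

theorem SmoothTimeBox.contDiff_time {E : Type*} [NormedAddCommGroup E] [NormedSpace ℝ E]
    {f : ℝ × Box d → E} (hf : SmoothTimeBox f) (x : Box d) : ContDiff ℝ ∞ (fun s => f (s, x)) := by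
  obtain ⟨y, rfl⟩ := (isOpenQuotientMap_toBox d).surjective x
  exact ContDiff.comp (g := fun p : ℝ × (Fin d → ℝ) => f (p.1, toBox p.2)) hf
    (contDiff_id.prodMk contDiff_const)

/-- `θ` depends on time only and `L` differentiates in space only, so `L(θ ∂_tΨ) = θ ∂_t(LΨ)`. It is
used with the test field `θ ∂_tΨ` in the weak form of `L^*`. -/
theorem opLField_smul_timeDMat (hΨ : ∀ i j, SmoothTimeBox (fun p => Ψ p i j)) (θ : ℝ → ℝ)
    (p : ℝ × Box d) : opLField ν b (fun q => θ q.1 • timeDMat Ψ q) p =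
      θ p.1 • timeD (opLField ν b Ψ) p := by
  have h1 : HasDerivAt (fun s => opLField ν b Ψ (s, p.2))
      (WithLp.toLp 2 fun i => ∑ j ∈ Finset.range (ν + 1), ∑ l, ∑ m,
      ∑ α ∈ Finset.piAntidiag (Finset.univ : Finset (Fin d)) j,
        b i l m α * dirD (timeDir d) (multiDT α (fun p => Ψ p l m)) p) p.1 := by
    have hc := fun u : Fin n → ℝ =>
      ((PiLp.continuousLinearEquiv 2 ℝ (fun _ : Fin n => ℝ)).symm : (Fin n → ℝ) →L[ℝ] Vec n).hasFDerivAt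
        (x := u)
    refine (hc _).comp_hasDerivAt p.1
      (f := fun s i => opLField ν b Ψ (s, p.2) i) (hasDerivAt_pi.2 fun i => ?_)
    simp only [opLField_apply]
    refine HasDerivAt.fun_sum fun j _ => HasDerivAt.fun_sum fun l _ => HasDerivAt.fun_sum fun m _ =>
      HasDerivAt.fun_sum fun α _ => HasDerivAt.const_mul _ ?_
    exact ((hΨ l m).multiDT α).hasDerivAt_time p.1 p.2
  rw [timeD, h1.deriv]
  ext i
  simp only [opLField, opL, PiLp.smul_apply, smul_eq_mul, Finset.mul_sum]
  refine Finset.sum_congr rfl fun j _ => Finset.sum_congr rfl fun l _ =>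
    Finset.sum_congr rfl fun m _ => Finset.sum_congr rfl fun α _ => ?_
  have e : (fun y => (θ p.1 • timeDMat Ψ (p.1, y)) l m) =
      fun y => θ p.1 * dirD (timeDir d) (fun p => Ψ p l m) (p.1, y) := by
    funext y
    rw [dirD_timeDir]
    rfl
  rw [e, multiD_const_mul, multiD_slice, (hΨ l m).dirD_multiDT]
  ring

end Fields

/-! ### Test fields -/

theorem smoothTimeBox_smul {d : ℕ} {E : Type*} [NormedAddCommGroup E] [NormedSpace ℝ E]
    {T : ℝ} {θ : ℝ → ℝ} (hθ : IsTimeTest T θ) {f : ℝ × Box d → E} (hf : SmoothTimeBox f) :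
    SmoothTimeBox (fun p => θ p.1 • f p) :=
  (hθ.smooth.comp contDiff_fst).smul hf

theorem smoothTimeBox_of_smoothBox {d : ℕ} {E : Type*} [NormedAddCommGroup E] [NormedSpace ℝ E]
    {f : Box d → E} (hf : SmoothBox f) : SmoothTimeBox (fun p : ℝ × Box d => f p.2) :=
  ContDiff.comp (g := fun y : Fin d → ℝ => f (toBox y)) hf contDiff_snd

theorem tsupport_smul_subset_cylinder {d : ℕ} {E : Type*} [AddCommGroup E] [Module ℝ E]
    [TopologicalSpace E] {T : ℝ} (hT : 0 < T) {θ : ℝ → ℝ} (hθ : IsTimeTest T θ)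
    (f : ℝ × Box d → E) : HasCompactSupport (fun p : ℝ × Box d => θ p.1 • f p) ∧
      tsupport (fun p : ℝ × Box d => θ p.1 • f p) ⊆ cylinder d T := by
  obtain ⟨a, b, ha, hab, hb, hz⟩ := hθ.exists_Icc hT
  have hK : IsCompact (Icc a b ×ˢ (univ : Set (Box d))) := isCompact_Icc.prod isCompact_univ
  have hsub : tsupport (fun p : ℝ × Box d => θ p.1 • f p) ⊆ Icc a b ×ˢ (univ : Set (Box d)) := by
    refine closure_minimal (fun p hp => ?_) hK.isClosed
    refine ⟨?_, mem_univ _⟩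
    by_contra hc
    exact hp (by simp only [hz _ hc, zero_smul])
  refine ⟨hK.of_isClosed_subset (isClosed_tsupport _) hsub, hsub.trans ?_⟩
  exact prod_mono (fun t ht => ⟨ha.trans_le ht.1, ht.2.trans_lt hb⟩) subset_rfl

/-! ### The cylinder -/

theorem cylMeasure_eq (d : ℕ) (T : ℝ) :
    cylMeasure d T = (volume.restrict (Ioo 0 T)).prod volume := by
  have h := Measure.prod_restrict (μ := (volume : Measure ℝ)) (ν := (volume : Measure (Box d)))
    (Ioo 0 T) univ
  rw [Measure.restrict_univ] at h
  rw [h]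
  rfl

instance (d : ℕ) (T : ℝ) : IsFiniteMeasure (cylMeasure d T) := by
  rw [cylMeasure_eq]
  infer_instance

/-- This direction of Fubini for null sets needs a measurable set, hence the passage to measurable
representatives. -/
theorem ae_prod_le_of_ae_ae_le {α β : Type*} [MeasurableSpace α] [MeasurableSpace β]
    {μ : Measure α} {ν : Measure β} [SFinite μ] [SFinite ν] {f g : α × β → ℝ}
    (hf : AEMeasurable f (μ.prod ν)) (hg : AEMeasurable g (μ.prod ν))
    (h : ∀ᵐ a ∂μ, ∀ᵐ b ∂ν, f (a, b) ≤ g (a, b)) : ∀ᵐ p ∂μ.prod ν, f p ≤ g p := by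
  have h1 : ∀ᵐ p ∂μ.prod ν, hf.mk f p ≤ hg.mk g p := by
    rw [Measure.ae_prod_iff_ae_ae (measurableSet_le hf.measurable_mk hg.measurable_mk)]
    filter_upwards [h, Measure.ae_ae_of_ae_prod hf.ae_eq_mk, Measure.ae_ae_of_ae_prod hg.ae_eq_mk]
      with a h1 h2 h3
    filter_upwards [h1, h2, h3] with b h1 h2 h3
    rwa [← h2, ← h3]
  filter_upwards [h1, hf.ae_eq_mk, hg.ae_eq_mk] with p h1 h2 h3
  rwa [h2, h3]

/-- The fundamental lemma of the calculus of variations for `t ↦ ∫ f(t,x) dx`. As `f` is only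
locally integrable, Fubini is applied on a compact time interval containing the support of `χ`. -/
theorem ae_integral_slice_eq_zero {d : ℕ} {T : ℝ} {f : ℝ × Box d → ℝ}
    (hf : LocallyIntegrableOn f (cylinder d T))
    (h : ∀ χ : ℝ → ℝ, IsTimeTest T χ → ∫ p, χ p.1 * f p ∂cylMeasure d T = 0) (hT : 0 < T) :
    ∀ᵐ t ∂volume.restrict (Ioo 0 T), ∫ x, f (t, x) = 0 := by
  have hK : ∀ k ⊆ Ioo 0 T, IsCompact k →
      Integrable f ((volume.restrict k).prod (volume : Measure (Box d))) := by
    intro k hk hkc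
    have h1 := (locallyIntegrableOn_iff (isOpen_Ioo.prod isOpen_univ).isLocallyClosed).1 hf
      (k ×ˢ univ) (prod_mono hk subset_rfl) (hkc.prod isCompact_univ)
    rw [IntegrableOn, Measure.volume_eq_prod, ← Measure.prod_restrict, Measure.restrict_univ] at h1
    exact h1
  have hloc : LocallyIntegrableOn (fun t => ∫ x, f (t, x)) (Ioo 0 T) := by
    rw [locallyIntegrableOn_iff isOpen_Ioo.isLocallyClosed]
    exact fun k hk hkc => (hK k hk hkc).integral_prod_left
  rw [ae_restrict_iff' measurableSet_Ioo]
  refine isOpen_Ioo.ae_eq_zero_of_integral_contDiff_smul_eq_zero hloc fun χ h1 h2 h3 => ?_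
  have hχ : IsTimeTest T χ := ⟨h1, h2, h3⟩
  obtain ⟨a, b, ha, hab, hb, hz⟩ := hχ.exists_Icc hT
  have hsub : Icc a b ⊆ Ioo 0 T := fun t ht => ⟨ha.trans_le ht.1, ht.2.trans_lt hb⟩
  obtain ⟨C, hC⟩ := h1.continuous.bounded_above_of_compact_support h2
  have hi : Integrable (fun p : ℝ × Box d => χ p.1 * f p)
      ((volume.restrict (Icc a b)).prod volume) :=
    (hK _ hsub isCompact_Icc).bdd_mul (h1.continuous.comp continuous_fst).aestronglyMeasurable
      (ae_of_all _ fun p => hC p.1)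
  have e1 : ∫ p, χ p.1 * f p ∂cylMeasure d T =
      ∫ p, χ p.1 * f p ∂((volume.restrict (Icc a b)).prod volume) := by
    rw [← Measure.restrict_univ (μ := (volume : Measure (Box d))), Measure.prod_restrict,
      cylMeasure, cylinder, ← Measure.volume_eq_prod]
    refine setIntegral_eq_of_subset_of_forall_sdiff_eq_zero
      (measurableSet_Ioo.prod MeasurableSet.univ) (prod_mono hsub subset_rfl) fun p hp => ?_
    rw [hz p.1 (fun hc => hp.2 ⟨hc, mem_univ _⟩), zero_mul]
  have e2 := h χ hχ
  rw [e1, integral_prod _ hi] at e2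
  simp only [integral_const_mul] at e2
  rw [← e2]
  refine (setIntegral_eq_integral_of_forall_compl_eq_zero fun t ht => ?_).symm
  rw [hz t ht, zero_smul]

end EntropyCons

namespace EntropyCons

/-! ### Fields with an integrable weak time derivative -/

/-- All Fourier coefficients vanish, so every trigonometric mollification is zero, while the
mollifications converge to `f` in `L¹`. -/
theorem ae_eq_zero_of_integral_mul_trigPoly {d : ℕ} {f : Box d → ℝ} (hf : Integrable f)
    (h : ∀ (m : Fin d → ℤ), ∀ c ∈ ({1, Complex.I} : Set ℂ),
      ∫ x, f x * trigPoly {m} (fun _ => c) x = 0) : f =ᵐ[volume] 0 := by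
  have h0 : ∀ m, fourierCoef f m = 0 := by
    intro m
    have h1 := h (-m) 1 (by simp)
    have h2 := h (-m) Complex.I (by simp)
    rw [integral_mul_trigPoly hf] at h1 h2
    simp only [Finset.sum_singleton, neg_neg, one_mul, Complex.I_mul_re] at h1 h2
    exact Complex.ext h1 (by simpa using h2)
  obtain ⟨s, c, hc0, hc1, hlim⟩ := exists_trigPoly_approx_identity d
  have h1 := tendsto_integral_norm_mollify_sub hf (fun k => continuous_trigPoly (s k) (c k)) hc0 hc1
    hlim
  have h2 : ∀ k x, mollify (trigPoly (s k) (c k)) f x = 0 := fun k x => by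
    rw [mollify_trigPoly hf]
    simp [trigPoly, h0]
  simp only [h2, zero_sub, norm_neg] at h1
  have h3 := tendsto_nhds_unique tendsto_const_nhds h1
  rw [integral_eq_zero_iff_of_nonneg (fun _ => norm_nonneg _) hf.norm] at h3
  filter_upwards [h3] with x hx
  simpa using hx

/-- The primitive in time `∫₀ᵗ g(s, x) ds`. -/
def timePrim {d n : ℕ} (g : ℝ × Box d → Vec n) (p : ℝ × Box d) : Vec n :=
  ∫ s in (0 : ℝ)..p.1, g (s, p.2)

section TimePrim

variable {d n : ℕ} {T : ℝ} {g : ℝ × Box d → Vec n}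

theorem integrable_prod_restrict_of_subset {E : Type*} [NormedAddCommGroup E]
    {f : ℝ × Box d → E} (hf : Integrable f (cylMeasure d T)) {s : Set ℝ} (hs : s ⊆ Ioo 0 T) :
    Integrable f ((volume.restrict s).prod volume) := by
  have h1 : IntegrableOn f (s ×ˢ univ) volume :=
    IntegrableOn.mono_set (t := cylinder d T) hf (prod_mono hs subset_rfl)
  rw [IntegrableOn, Measure.volume_eq_prod, ← Measure.prod_restrict, Measure.restrict_univ] at h1
  exact h1

theorem ae_intervalIntegrable_slice {E : Type*} [NormedAddCommGroup E]
    {f : ℝ × Box d → E} (hT : 0 < T) (hf : Integrable f (cylMeasure d T)) :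
    ∀ᵐ x, IntervalIntegrable (fun s => f (s, x)) volume 0 T := by
  rw [cylMeasure_eq] at hf
  filter_upwards [hf.prod_left_ae] with x hx
  rwa [intervalIntegrable_iff_integrableOn_Ioo_of_le hT.le]

/-- Joint measurability: the primitive is a parameter integral of `g` times the indicator of `0 < s
≤ t`. -/
theorem exists_stronglyMeasurable_eq_timePrim (hgm : StronglyMeasurable g) :
    ∃ h : ℝ × Box d → Vec n, StronglyMeasurable h ∧
      ∀ t x, 0 ≤ t → timePrim g (t, x) = h (t, x) := by
  let S : Set ((ℝ × Box d) × ℝ) := {q | 0 < q.2} ∩ {q | q.2 ≤ q.1.1}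
  have hS : MeasurableSet S :=
    (measurableSet_lt measurable_const measurable_snd).inter
      (measurableSet_le measurable_snd (measurable_fst.comp measurable_fst))
  have hm : StronglyMeasurable (S.indicator fun q : (ℝ × Box d) × ℝ => g (q.2, q.1.2)) :=
    (hgm.comp_measurable (measurable_snd.prodMk (measurable_snd.comp measurable_fst))).indicator hS
  refine ⟨_, hm.integral_prod_right' (ν := volume), fun t x ht => ?_⟩
  rw [timePrim, intervalIntegral.integral_of_le ht, ← integral_indicator measurableSet_Ioc]
  refine integral_congr_ae (ae_of_all _ fun s => ?_)
  simp only [indicator, S, mem_Ioc, mem_inter_iff, mem_ofPred_eq]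

theorem aestronglyMeasurable_timePrim (hgm : StronglyMeasurable g) :
    AEStronglyMeasurable (timePrim g) (cylMeasure d T) := by
  obtain ⟨h, hm, heq⟩ := exists_stronglyMeasurable_eq_timePrim hgm
  refine ⟨h, hm, ?_⟩
  rw [cylMeasure, cylinder, EventuallyEq, ae_restrict_iff' (measurableSet_Ioo.prod MeasurableSet.univ)]
  exact ae_of_all _ fun p hp => heq p.1 p.2 hp.1.1.le

theorem stronglyMeasurable_timePrim_slice (hgm : StronglyMeasurable g) {t : ℝ} (ht : 0 ≤ t) :
    StronglyMeasurable fun x => timePrim g (t, x) := by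
  obtain ⟨h, hm, heq⟩ := exists_stronglyMeasurable_eq_timePrim hgm
  simp only [heq _ _ ht]
  exact hm.comp_measurable measurable_prodMk_left

theorem ae_of_ae_ae_cylMeasure {P : ℝ → Box d → Prop}
    (hP : ∀ᵐ x, ∀ t ∈ Ioo 0 T, P t x) : ∀ᵐ p ∂cylMeasure d T, P p.1 p.2 := by
  rw [cylMeasure_eq]
  have h1 : ∀ᵐ p ∂(volume.restrict (Ioo 0 T)).prod (volume : Measure (Box d)),
      ∀ t ∈ Ioo 0 T, P t p.2 :=
    Measure.quasiMeasurePreserving_snd.ae hP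
  have h2 : ∀ᵐ p ∂(volume.restrict (Ioo 0 T)).prod (volume : Measure (Box d)), p.1 ∈ Ioo 0 T :=
    Measure.quasiMeasurePreserving_fst.ae (ae_restrict_mem measurableSet_Ioo)
  filter_upwards [h1, h2] with p h1 h2
  exact h1 _ h2

theorem integrable_timePrim (hT : 0 < T) (hgm : StronglyMeasurable g)
    (hg : Integrable g (cylMeasure d T)) : Integrable (timePrim g) (cylMeasure d T) := by
  have h1 : Integrable (fun x => ∫ s in Ioo 0 T, ‖g (s, x)‖) (volume : Measure (Box d)) := by
    rw [cylMeasure_eq] at hg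
    exact hg.norm.integral_prod_right
  have h2 : Integrable (fun p : ℝ × Box d => ∫ s in Ioo 0 T, ‖g (s, p.2)‖) (cylMeasure d T) := by
    rw [cylMeasure_eq]
    exact h1.comp_snd _
  refine h2.mono' (aestronglyMeasurable_timePrim hgm) ?_
  refine ae_of_ae_ae_cylMeasure (P := fun t x => ‖timePrim g (t, x)‖ ≤ ∫ s in Ioo 0 T, ‖g (s, x)‖) ?_
  filter_upwards [ae_intervalIntegrable_slice hT hg] with x hx t ht
  rw [intervalIntegrable_iff_integrableOn_Ioo_of_le hT.le] at hx
  refine (intervalIntegral.norm_integral_le_integral_norm ht.1.le).trans ?_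
  rw [intervalIntegral.integral_of_le ht.1.le]
  exact setIntegral_mono_set hx.norm (ae_of_all _ fun _ => norm_nonneg _)
    (LE.le.eventuallyLE fun s hs => ⟨hs.1, hs.2.trans_lt ht.2⟩)

theorem setIntegral_primitive_parts {g : ℝ → ℝ} (hT : 0 < T)
    (hg : IntervalIntegrable g volume 0 T) {χ : ℝ → ℝ} (hχ : IsTimeTest T χ) :
    ∫ t in Ioo 0 T, (deriv χ t * (∫ s in (0 : ℝ)..t, g s) + χ t * g t) = 0 := by
  obtain ⟨a, b, ha, hab, hb, hz⟩ := hχ.exists_Icc hT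
  have hχac : AbsolutelyContinuousOnInterval χ 0 ((b + T) / 2) :=
    (hχ.smooth.of_le (by norm_cast)).contDiffOn.absolutelyContinuousOnInterval
  have hsub : uIcc 0 ((b + T) / 2) ⊆ uIcc 0 T := by
    rw [uIcc_of_le (by linarith), uIcc_of_le hT.le]
    exact Icc_subset_Icc_right (by linarith)
  refine setIntegral_eq_zero_of_absolutelyContinuous ha hab hb
    (hχac.mul ((absolutelyContinuousOnInterval_integral hg).mono hsub)) ?_ (fun t ht => ?_)
    fun t ht => ?_
  · rw [ae_restrict_iff' measurableSet_Ioo]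
    filter_upwards [hg.ae_hasDerivAt_integral] with t ht hmem
    exact (hχ.smooth.differentiable (by simp) t).hasDerivAt.mul
      (ht (by rw [uIcc_of_le hT.le]; exact Ioo_subset_Icc_self hmem) 0 left_mem_uIcc)
  · rw [Pi.mul_apply, hz t ht, zero_mul]
  · rw [hz t ht, IsTimeTest.deriv_eq_zero hz ht, zero_mul, zero_mul, add_zero]

theorem timePrim_apply (hT : 0 < T) (hg : Integrable g (cylMeasure d T)) (i : Fin n) :
    ∀ᵐ x, ∀ t ∈ Ioo 0 T, timePrim g (t, x) i = ∫ s in (0 : ℝ)..t, g (s, x) i := by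
  filter_upwards [ae_intervalIntegrable_slice hT hg] with x hx t ht
  have h1 : IntervalIntegrable (fun s => g (s, x)) volume 0 t :=
    hx.mono_set (uIcc_subset_uIcc left_mem_uIcc (by
      rw [uIcc_of_le hT.le]; exact Ioo_subset_Icc_self ht))
  exact ((EuclideanSpace.proj (𝕜 := ℝ) i).intervalIntegral_comp_comm h1).symm

/-- A field with an integrable weak time derivative is the primitive of the derivative. -/
theorem exists_eq_add_timePrim (hT : 0 < T) {f : ℝ × Box d → Vec n}
    (hf : Integrable f (cylMeasure d T)) (hgm : StronglyMeasurable g)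
    (hg : Integrable g (cylMeasure d T))
    (h : ∀ φ : ℝ × Box d → Vec n, SmoothTimeBox φ → HasCompactSupport φ →
      tsupport φ ⊆ cylinder d T → ∫ p, inner ℝ (f p) (timeD φ p) ∂(cylMeasure d T) =
        - ∫ p, inner ℝ (g p) (φ p) ∂(cylMeasure d T)) :
    ∃ u : Box d → Vec n, AEStronglyMeasurable u volume ∧
      ∀ᵐ p ∂cylMeasure d T, f p = u p.2 + timePrim g p := by
  set D : ℝ × Box d → Vec n := fun p => f p - timePrim g p with hDdef
  have hPi := integrable_timePrim hT hgm hg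
  have hDi : Integrable D (cylMeasure d T) := hf.sub hPi
  have hco : ∀ {f : ℝ × Box d → Vec n}, Integrable f (cylMeasure d T) → ∀ (i : Fin n)
      (e : Box d → ℝ), Continuous e → ∀ χ : ℝ → ℝ, Continuous χ → HasCompactSupport χ →
      Integrable (fun p : ℝ × Box d => χ p.1 * (e p.2 * f p i)) (cylMeasure d T) := by
    intro f hf i e he χ hχ hχc
    obtain ⟨C, hC⟩ := hχ.bounded_above_of_compact_support hχc
    obtain ⟨C', hC'⟩ := isCompact_univ.exists_bound_of_continuousOn he.continuousOn
    have hfi : Integrable (fun p => f p i) (cylMeasure d T) :=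
      (EuclideanSpace.proj (𝕜 := ℝ) i).integrable_comp hf
    exact (hfi.bdd_mul (he.comp continuous_snd).aestronglyMeasurable
      (ae_of_all _ fun p => hC' p.2 (mem_univ _))).bdd_mul
      (hχ.comp continuous_fst).aestronglyMeasurable (ae_of_all _ fun p => hC p.1)
  -- Tests `χ(t) e(x)` in each coordinate show that the Fourier modes of `D = f - ∫₀ᵗ g` have zero
  -- weak time derivative, hence are constant in time.
  have key : ∀ (m : Fin d → ℤ), ∀ c ∈ ({1, Complex.I} : Set ℂ), ∀ i, ∃ k : ℝ,
      ∀ᵐ t ∂volume.restrict (Ioo 0 T), ∫ x, trigPoly {m} (fun _ => c) x * D (t, x) i = k := by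
    intro m c _ i
    set e := trigPoly {m} (fun _ => c)
    have he : Continuous e := continuous_trigPoly _ _
    have hes : SmoothBox e := smoothBox_trigPoly _ _
    obtain ⟨C', hC'⟩ := isCompact_univ.exists_bound_of_continuousOn he.continuousOn
    refine ae_eq_const_of_integral_deriv_eq_zero hT ?_ fun χ hχ => ?_
    · have h1 : Integrable (fun p : ℝ × Box d => e p.2 * D p i) (cylMeasure d T) :=
        ((EuclideanSpace.proj (𝕜 := ℝ) i).integrable_comp hDi).bdd_mul
          (he.comp continuous_snd).aestronglyMeasurable
          (ae_of_all _ fun p => hC' p.2 (mem_univ _))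
      rw [cylMeasure_eq] at h1
      exact h1.integral_prod_left
    · have hχc : Continuous χ := hχ.smooth.continuous
      have hχ'c : Continuous (deriv χ) := hχ.smooth.continuous_deriv (by simp)
      have hχ's : HasCompactSupport (deriv χ) := hχ.compact.deriv
      have h1 : ∫ p, deriv χ p.1 * (e p.2 * f p i) ∂cylMeasure d T =
          - ∫ p, χ p.1 * (e p.2 * g p i) ∂cylMeasure d T := by
        have hsm : SmoothTimeBox (fun p : ℝ × Box d =>
            χ p.1 • (e p.2 • EuclideanSpace.single i (1 : ℝ))) :=
          smoothTimeBox_smul hχ (smoothTimeBox_of_smoothBox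
            (f := fun x => e x • EuclideanSpace.single i (1 : ℝ)) (ContDiff.smul hes contDiff_const))
        have hts := tsupport_smul_subset_cylinder hT hχ
          (fun p : ℝ × Box d => e p.2 • EuclideanSpace.single i (1 : ℝ))
        have h2 := h _ hsm hts.1 hts.2
        have e1 : ∀ p : ℝ × Box d, timeD (fun p : ℝ × Box d =>
            χ p.1 • (e p.2 • EuclideanSpace.single i (1 : ℝ))) p =
            deriv χ p.1 • (e p.2 • EuclideanSpace.single i (1 : ℝ)) := fun p =>
          ((hχ.smooth.differentiable (by simp) p.1).hasDerivAt.smul_const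
            (e p.2 • EuclideanSpace.single i (1 : ℝ) : Vec n)).deriv
        simpa only [e1, inner_smul_right, EuclideanSpace.inner_single_right, one_mul,
          conj_trivial] using h2
      have h2 : ∫ p, (deriv χ p.1 * (e p.2 * timePrim g p i) + χ p.1 * (e p.2 * g p i))
          ∂cylMeasure d T = 0 := by
        have hi := (hco hPi i e he _ hχ'c hχ's).fun_add (hco hg i e he _ hχc hχ.compact)
        rw [cylMeasure_eq] at hi ⊢
        rw [integral_prod_symm _ hi]
        refine integral_eq_zero_of_ae ?_
        filter_upwards [timePrim_apply hT hg i, ae_intervalIntegrable_slice hT hg] with x hx hxi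
        have hxi' : IntervalIntegrable (fun s => g (s, x) i) volume 0 T := by
          rw [intervalIntegrable_iff] at hxi ⊢
          exact (EuclideanSpace.proj (𝕜 := ℝ) i).integrable_comp hxi
        have h3 := congrArg (fun r => e x * r) (setIntegral_primitive_parts hT hxi' hχ)
        simp only [mul_zero, ← integral_const_mul] at h3
        refine Eq.trans (setIntegral_congr_fun measurableSet_Ioo fun t ht => ?_) h3
        simp only [hx t ht]
        ring
      rw [integral_add (hco hPi i e he _ hχ'c hχ's) (hco hg i e he _ hχc hχ.compact)] at h2
      have h3 : ∫ p, deriv χ p.1 * (e p.2 * D p i) ∂cylMeasure d T = 0 := by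
        have e1 : ∀ p : ℝ × Box d, deriv χ p.1 * (e p.2 * D p i) =
            deriv χ p.1 * (e p.2 * f p i) - deriv χ p.1 * (e p.2 * timePrim g p i) := by
          intro p
          simp only [hDdef, PiLp.sub_apply]
          ring
        simp_rw [e1]
        rw [integral_sub (hco hf i e he _ hχ'c hχ's) (hco hPi i e he _ hχ'c hχ's)]
        linarith
      have h4 := hco hDi i e he _ hχ'c hχ's
      rw [cylMeasure_eq] at h3 h4
      rw [integral_prod _ h4] at h3
      simpa only [integral_const_mul] using h3
  choose! k hk using key
  -- There are countably many modes, so one null set of times serves all of them; `u` is then `D` at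
  -- a good time `t₀`.
  have hk' : ∀ᵐ t ∂volume.restrict (Ioo 0 T), ∀ (m : Fin d → ℤ), ∀ c ∈ ({1, Complex.I} : Set ℂ),
      ∀ i, ∫ x, trigPoly {m} (fun _ => c) x * D (t, x) i = k m c i := by
    refine ae_all_iff.2 fun m => ?_
    refine (ae_ball_iff (by simp : ({1, Complex.I} : Set ℂ).Countable)).2 fun c hc => ?_
    exact ae_all_iff.2 fun i => hk m c hc i
  have hsl : ∀ᵐ t ∂volume.restrict (Ioo 0 T), Integrable (fun x => D (t, x)) volume := by
    rw [cylMeasure_eq] at hDi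
    exact hDi.prod_right_ae
  have hne : (ae (volume.restrict (Ioo 0 T))).NeBot := by
    rw [ae_restrict_neBot]
    simp [hT]
  obtain ⟨t₀, ht₀, ht₀i⟩ := (hk'.and hsl).exists
  refine ⟨fun x => D (t₀, x), ht₀i.aestronglyMeasurable, ?_⟩
  have hae : ∀ᵐ t ∂volume.restrict (Ioo 0 T), ∀ᵐ x, ‖D (t, x) - D (t₀, x)‖ ≤ 0 := by
    filter_upwards [hk', hsl] with t ht hti
    have h1 : ∀ i, ∀ᵐ x, D (t, x) i - D (t₀, x) i = 0 := by
      intro i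
      have hi1 : Integrable (fun x => D (t, x) i) := (EuclideanSpace.proj (𝕜 := ℝ) i).integrable_comp hti
      have hi2 : Integrable (fun x => D (t₀, x) i) :=
        (EuclideanSpace.proj (𝕜 := ℝ) i).integrable_comp ht₀i
      refine ae_eq_zero_of_integral_mul_trigPoly (hi1.sub hi2) fun m c hc => ?_
      obtain ⟨C', hC'⟩ := isCompact_univ.exists_bound_of_continuousOn
        (continuous_trigPoly {m} fun _ => c).continuousOn
      have hb : ∀ {f : Box d → ℝ}, Integrable f →
          Integrable fun x => trigPoly {m} (fun _ => c) x * f x := fun hf =>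
        hf.bdd_mul (continuous_trigPoly {m} fun _ => c).aestronglyMeasurable
          (ae_of_all _ fun x => hC' x (mem_univ _))
      have h2 := integral_sub (hb hi1) (hb hi2)
      rw [ht m c hc i, ht₀ m c hc i, sub_self] at h2
      rw [← h2]
      refine integral_congr_ae (ae_of_all _ fun x => ?_)
      simp only
      ring
    filter_upwards [ae_all_iff.2 h1] with x hx
    rw [norm_le_zero_iff]
    ext i
    exact hx i
  have hDm := hDi.aestronglyMeasurable
  rw [cylMeasure_eq] at hDm ⊢
  have hm : AEStronglyMeasurable (fun p : ℝ × Box d => D p - D (t₀, p.2))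
      ((volume.restrict (Ioo 0 T)).prod volume) := hDm.sub ht₀i.aestronglyMeasurable.comp_snd
  have := ae_prod_le_of_ae_ae_le hm.norm.aemeasurable (g := fun _ => 0) aemeasurable_const hae
  filter_upwards [this] with p hp
  rw [norm_le_zero_iff, sub_eq_zero] at hp
  rw [← hp, hDdef, sub_add_cancel]

end TimePrim

end EntropyCons

namespace EntropyCons

/-! ### Paths in the Orlicz space -/

/-- Jensen's inequality: `r ∫ g` is the average over `(a,b)` of `r (b - a) g`. The numbers `α`, `β`
allow either the `Δ₂`-bound or the sharper linear bound for small factors. -/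
theorem DualPair.dual_intervalIntegral_le {n : ℕ} {A B : Vec n → ℝ} {σ S : Vec n → Vec n}
    (hD : DualPair A B σ S) {g : ℝ → Vec n} {a b : ℝ} (hab : a < b)
    (hg : IntervalIntegrable g volume a b)
    (hB : IntervalIntegrable (fun s => B (g s)) volume a b) {r α β : ℝ}
    (h : ∀ y, B ((r * (b - a)) • y) ≤ α * B y + β) :
    B (r • ∫ s in a..b, g s) ≤ (b - a)⁻¹ * ∫ s in a..b, (α * B (g s) + β) := by
  have hba : 0 < b - a := sub_pos.2 hab
  have hG : IntervalIntegrable (fun s => α * B (g s) + β) volume a b :=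
    (hB.const_mul α).add intervalIntegrable_const
  have hc : IntervalIntegrable (fun s => (r * (b - a)) • g s) volume a b := hg.smul (r * (b - a))
  have hBc : IntervalIntegrable (fun s => B ((r * (b - a)) • g s)) volume a b := by
    rw [intervalIntegrable_iff] at hG hc ⊢
    refine hG.mono' (hD.cont_dual.comp_aestronglyMeasurable hc.aestronglyMeasurable)
      (ae_of_all _ fun s => ?_)
    rw [Real.norm_of_nonneg (hD.dual_nonneg _)]
    exact h _
  have h1 := hD.dual_convex.map_set_average_le (μ := volume) (t := Ioc a b)
    (f := fun s => (r * (b - a)) • g s) hD.cont_dual.continuousOn isClosed_univ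
    (by simp [hab]) (by simp) (ae_of_all _ fun _ => mem_univ _)
    ((intervalIntegrable_iff_integrableOn_Ioc_of_le hab.le).1 hc)
    ((intervalIntegrable_iff_integrableOn_Ioc_of_le hab.le).1 hBc)
  rw [setAverage_eq, setAverage_eq, ← intervalIntegral.integral_of_le hab.le,
    ← intervalIntegral.integral_of_le hab.le, intervalIntegral.integral_smul, smul_smul,
    Real.volume_real_Ioc_of_le hab.le, smul_eq_mul] at h1
  have e : (b - a)⁻¹ * (r * (b - a)) = r := by field_simp
  rw [e] at h1
  refine h1.trans (mul_le_mul_of_nonneg_left ?_ (inv_pos.2 hba).le)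
  exact intervalIntegral.integral_mono_on hab.le hBc hG fun s _ => h _

/-- The field `(t, x) ↦ 𝒦(t)⁻¹ (u(x) + ∫₀ᵗ g(s, x) ds)`. -/
def pathField {d n : ℕ} (T : ℝ) (κ : ℝ → ℝ) (u : Box d → Vec n) (g : ℝ × Box d → Vec n)
    (p : ℝ × Box d) : Vec n := path T κ (u p.2) (fun s => g (s, p.2)) p.1

section PathField

variable {d n : ℕ} {A B : Vec n → ℝ} {σ S : Vec n → Vec n} {T : ℝ} {κ : ℝ → ℝ}
  {u : Box d → Vec n} {g : ℝ × Box d → Vec n}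

theorem DualPair.memOrlicz_timePrim (hD : DualPair A B σ S) (hT : 0 < T)
    (hgm : StronglyMeasurable g) (hg : MemOrlicz B (cylMeasure d T) g) {t : ℝ}
    (ht : t ∈ Ico 0 T) : MemOrlicz B volume fun x => timePrim g (t, x) := by
  have hgi := hD.integrable_of_memOrlicz hg
  rcases ht.1.eq_or_lt with rfl | h0
  · simp only [timePrim, intervalIntegral.integral_same]
    exact ⟨aestronglyMeasurable_const, integrable_const _⟩
  obtain ⟨C, -, hC⟩ := hD.exists_dual_smul_le t
  have hsub : Ioc 0 t ⊆ Ioo 0 T := fun s hs => ⟨hs.1, hs.2.trans_lt ht.2⟩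
  have h1 : Integrable (fun p => C * B (g p) + C) (cylMeasure d T) :=
    (hg.2.const_mul C).add (integrable_const C)
  refine hD.memOrlicz_of_le (g := fun x => (t - 0)⁻¹ * ∫ s in (0 : ℝ)..t, (C * B (g (s, x)) + C))
    (stronglyMeasurable_timePrim_slice hgm ht.1).aestronglyMeasurable ?_ ?_
  · simp only [intervalIntegral.integral_of_le ht.1]
    exact (integrable_prod_restrict_of_subset h1 hsub).integral_prod_right.const_mul _
  · have hm : ∀ {E : Type} [NormedAddCommGroup E] {f : ℝ → E},
        IntervalIntegrable f volume 0 T → IntervalIntegrable f volume 0 t := fun hf =>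
      hf.mono_set (uIcc_subset_uIcc left_mem_uIcc (by
        rw [uIcc_of_le hT.le]; exact Ico_subset_Icc_self ht))
    filter_upwards [ae_intervalIntegrable_slice hT hgi, ae_intervalIntegrable_slice hT hg.2]
      with x hx hBx
    have := hD.dual_intervalIntegral_le h0 (hm hx) (hm hBx) (r := 1) (α := C) (β := C) fun y => by
      have := hC (1 * (t - 0)) (by rw [one_mul, sub_zero, abs_of_pos h0]) y
      linarith
    rwa [one_smul] at this

/-- As `|r| (t - s) ≤ 1`, convexity extracts the factor `|r| (t - s)`, whose length cancels that of
the average. What remains is the integral of an integrable modular over `(s,t)`, which is small for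
short intervals. -/
theorem DualPair.integral_dual_timePrim_sub_le_of_lt (hD : DualPair A B σ S) (hT : 0 < T)
    (hgm : StronglyMeasurable g) (hg : MemOrlicz B (cylMeasure d T) g) {s t : ℝ}
    (hs : 0 ≤ s) (hst : s < t) (ht : t < T) {r : ℝ} (hr : |r| * (t - s) ≤ 1) :
    ∫ x, B (r • (timePrim g (t, x) - timePrim g (s, x))) ≤
      |r| * ∫ τ in s..t, ∫ x, B (g (τ, x)) := by
  have hgi := hD.integrable_of_memOrlicz hg
  have hsub : Ioc s t ⊆ Ioo 0 T := fun τ hτ => ⟨hs.trans_lt hτ.1, hτ.2.trans_lt ht⟩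
  have h1 := integrable_prod_restrict_of_subset hg.2 hsub
  have hts : 0 < t - s := sub_pos.2 hst
  have habs : |r * (t - s)| = |r| * (t - s) := by rw [abs_mul, abs_of_pos hts]
  rw [intervalIntegral.integral_of_le hst.le, integral_integral_swap h1, ← integral_const_mul]
  have hmem : ∀ a ∈ Ico 0 T, a ∈ uIcc 0 T := fun a ha => by
    rw [uIcc_of_le hT.le]; exact Ico_subset_Icc_self ha
  have hs' := hmem s ⟨hs, hst.trans ht⟩
  have ht' := hmem t ⟨hs.trans hst.le, ht⟩
  refine integral_mono_ae
    (hD.memOrlicz_const_smul r (hD.memOrlicz_sub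
      (hD.memOrlicz_timePrim hT hgm hg ⟨hs.trans hst.le, ht⟩)
      (hD.memOrlicz_timePrim hT hgm hg ⟨hs, hst.trans ht⟩))).2 (h1.integral_prod_right.const_mul _) ?_
  filter_upwards [ae_intervalIntegrable_slice hT hgi, ae_intervalIntegrable_slice hT hg.2]
    with x hx hBx
  have e : timePrim g (t, x) - timePrim g (s, x) = ∫ τ in s..t, g (τ, x) :=
    intervalIntegral.integral_interval_sub_left
      (hx.mono_set (uIcc_subset_uIcc left_mem_uIcc ht'))
      (hx.mono_set (uIcc_subset_uIcc left_mem_uIcc hs'))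
  rw [e]
  have h2 := hD.dual_intervalIntegral_le hst (hx.mono_set (uIcc_subset_uIcc hs' ht'))
    (hBx.mono_set (uIcc_subset_uIcc hs' ht')) (r := r) (α := |r| * (t - s)) (β := 0) fun y => by
      rw [add_zero, ← habs]
      exact hD.dual_smul_le (habs.trans_le hr) y
  refine h2.trans_eq ?_
  simp only [add_zero, intervalIntegral.integral_const_mul]
  rw [intervalIntegral.integral_of_le hst.le]
  field_simp

theorem DualPair.intervalIntegrable_modular (hT : 0 < T) (hg : MemOrlicz B (cylMeasure d T) g) :
    IntervalIntegrable (fun τ => ∫ x, B (g (τ, x))) volume 0 T := by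
  rw [intervalIntegrable_iff_integrableOn_Ioo_of_le hT.le]
  exact (integrable_prod_restrict_of_subset hg.2 subset_rfl).integral_prod_left

theorem DualPair.integral_dual_timePrim_sub_le (hD : DualPair A B σ S) (hT : 0 < T)
    (hgm : StronglyMeasurable g) (hg : MemOrlicz B (cylMeasure d T) g) {s t : ℝ}
    (hs : s ∈ Ico 0 T) (ht : t ∈ Ico 0 T) {r : ℝ} (hr : |r| * |t - s| ≤ 1) :
    ∫ x, B (r • (timePrim g (t, x) - timePrim g (s, x))) ≤
      |r| * |(∫ τ in (0 : ℝ)..t, ∫ x, B (g (τ, x))) - ∫ τ in (0 : ℝ)..s, ∫ x, B (g (τ, x))| := by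
  have hi := DualPair.intervalIntegrable_modular hT hg
  have hm : ∀ t ∈ Ico 0 T, IntervalIntegrable (fun τ => ∫ x, B (g (τ, x))) volume 0 t :=
    fun t ht => hi.mono_set (uIcc_subset_uIcc left_mem_uIcc (by
      rw [uIcc_of_le hT.le]; exact Ico_subset_Icc_self ht))
  rcases lt_trichotomy s t with h | rfl | h
  · rw [abs_of_pos (sub_pos.2 h)] at hr
    refine (hD.integral_dual_timePrim_sub_le_of_lt hT hgm hg hs.1 h ht.2 hr).trans ?_
    rw [intervalIntegral.integral_interval_sub_left (hm t ht) (hm s hs)]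
    exact mul_le_mul_of_nonneg_left (le_abs_self _) (abs_nonneg _)
  · simp [hD.dual_zero]
  · rw [abs_sub_comm, abs_of_pos (sub_pos.2 h)] at hr
    have h1 := hD.integral_dual_timePrim_sub_le_of_lt hT hgm hg ht.1 h hs.2 hr
    rw [abs_sub_comm, intervalIntegral.integral_interval_sub_left (hm s hs) (hm t ht)]
    refine (Eq.trans_le ?_ h1).trans (mul_le_mul_of_nonneg_left (le_abs_self _) (abs_nonneg _))
    refine integral_congr_ae (ae_of_all _ fun x => ?_)
    simp only
    rw [← hD.dual_even, ← smul_neg, neg_sub]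

theorem DualPair.memOrlicz_pathField (hD : DualPair A B σ S) (hT : 0 < T)
    (hgm : StronglyMeasurable g) (hg : MemOrlicz B (cylMeasure d T) g)
    (hu : MemOrlicz B volume u) {t : ℝ} (ht : t ∈ Ico 0 T) :
    MemOrlicz B volume fun x => pathField T κ u g (t, x) :=
  hD.memOrlicz_const_smul (cumWeight T κ t)⁻¹ (hD.memOrlicz_add hu (hD.memOrlicz_timePrim hT hgm hg ht))

theorem DualPair.tendsto_luxemburg_pathField (hD : DualPair A B σ S) (hT : 0 < T)
    (hκ : IsWeight T κ) (hgm : StronglyMeasurable g) (hg : MemOrlicz B (cylMeasure d T) g)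
    (hu : MemOrlicz B volume u) {t : ℝ} (ht : t ∈ Ico 0 T) :
    Tendsto (fun s => luxemburg B volume
      fun x => pathField T κ u g (s, x) - pathField T κ u g (t, x)) (𝓝[Ico 0 T] t) (𝓝 0) := by
  refine hD.tendsto_luxemburg_of_tendsto_modular ?_ fun M hM => ?_
  · filter_upwards [self_mem_nhdsWithin] with s hs
    exact hD.memOrlicz_sub (hD.memOrlicz_pathField hT hgm hg hu hs)
      (hD.memOrlicz_pathField hT hgm hg hu ht)
  have hat : MemOrlicz B volume fun x => u x + timePrim g (t, x) :=
    hD.memOrlicz_add hu (hD.memOrlicz_timePrim hT hgm hg ht)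
  set k : ℝ → ℝ := fun s => (cumWeight T κ s)⁻¹ with hk
  have hkc : Tendsto k (𝓝[Ico 0 T] t) (𝓝 (k t)) :=
    (((hκ.continuousOn hT).mono Ico_subset_Icc_self) t ht).inv₀ (hκ.cumWeight_pos hT ht).ne'
  set Ψ : ℝ → ℝ := fun t => ∫ τ in (0 : ℝ)..t, ∫ x, B (g (τ, x)) with hΨ
  have hΨc : Tendsto Ψ (𝓝[Ico 0 T] t) (𝓝 (Ψ t)) := by
    have h1 := (absolutelyContinuousOnInterval_integral
      (DualPair.intervalIntegrable_modular hT hg)).continuousOn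
    rw [uIcc_of_le hT.le] at h1
    exact (h1.mono Ico_subset_Icc_self) t ht
  have hkt : 0 < k t := inv_pos.2 (hκ.cumWeight_pos hT ht)
  -- With `k = 𝒦⁻¹` and `P` the primitive, the difference is `k(s)(P(s) - P(t)) + (k(s) - k(t))(u +
  -- P(t))`. `R` bounds `2 M k(s)` for `s` near `t`, and the `2` comes from splitting the sum by
  -- `dual_add_le`.
  set R : ℝ := 2 * M * (k t + 1) with hR
  have hRpos : 0 < R := by positivity
  have hid : Tendsto (fun s : ℝ => s) (𝓝[Ico 0 T] t) (𝓝 t) := nhdsWithin_le_nhds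
  have l1 : Tendsto (fun s => R * |Ψ s - Ψ t|) (𝓝[Ico 0 T] t) (𝓝 0) := by
    simpa using ((hΨc.sub_const (Ψ t)).abs).const_mul R
  have l2 : Tendsto (fun s => |2 * M * (k s - k t)|) (𝓝[Ico 0 T] t) (𝓝 0) := by
    simpa using ((hkc.sub_const (k t)).const_mul (2 * M)).abs
  have l3 : Tendsto (fun s => R * |s - t|) (𝓝[Ico 0 T] t) (𝓝 0) := by
    simpa using ((hid.sub_const t).abs).const_mul R
  have hlim : Tendsto (fun s => (1 / 2) * (R * |Ψ s - Ψ t|) + (1 / 2) *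
      (|2 * M * (k s - k t)| * ∫ x, B (u x + timePrim g (t, x)))) (𝓝[Ico 0 T] t) (𝓝 0) := by
    have := (l1.const_mul (1 / 2)).add
      ((l2.mul_const (∫ x, B (u x + timePrim g (t, x)))).const_mul (1 / 2))
    rwa [zero_mul, mul_zero, add_zero] at this
  refine squeeze_zero' (Eventually.of_forall fun s => integral_nonneg fun x => hD.dual_nonneg _)
    ?_ hlim
  filter_upwards [self_mem_nhdsWithin, hkc.eventually_lt_const (show k t < k t + 1 by linarith),
    l2.eventually_lt_const zero_lt_one, l3.eventually_lt_const zero_lt_one] with s hs h1 h2 h3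
  have hks : 0 < k s := inv_pos.2 (hκ.cumWeight_pos hT hs)
  have hrR : |2 * M * k s| ≤ R := by
    rw [abs_of_pos (by positivity)]
    exact mul_le_mul_of_nonneg_left h1.le (by positivity)
  have hm1 := hD.memOrlicz_const_smul (2 * M * k s) (hD.memOrlicz_sub
    (hD.memOrlicz_timePrim hT hgm hg hs) (hD.memOrlicz_timePrim hT hgm hg ht))
  have hm2 := hD.memOrlicz_const_smul (2 * M * (k s - k t)) hat
  calc ∫ x, B (M • (pathField T κ u g (s, x) - pathField T κ u g (t, x)))
      ≤ ∫ x, ((1 / 2) * B ((2 * M * k s) • (timePrim g (s, x) - timePrim g (t, x))) +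
          (1 / 2) * B ((2 * M * (k s - k t)) • (u x + timePrim g (t, x)))) := by
        refine integral_mono_of_nonneg (ae_of_all _ fun x => hD.dual_nonneg _)
          ((hm1.2.const_mul _).add (hm2.2.const_mul _)) (ae_of_all _ fun x => ?_)
        have e : M • (pathField T κ u g (s, x) - pathField T κ u g (t, x)) =
            (M * k s) • (timePrim g (s, x) - timePrim g (t, x)) +
            (M * (k s - k t)) • (u x + timePrim g (t, x)) := by
          change M • (k s • (u x + timePrim g (s, x)) - k t • (u x + timePrim g (t, x))) = _
          module
        simp only
        rw [e]
        refine (hD.dual_add_le _ _).trans_eq ?_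
        rw [smul_smul, smul_smul, mul_assoc, mul_assoc]
    _ = (1 / 2) * (∫ x, B ((2 * M * k s) • (timePrim g (s, x) - timePrim g (t, x)))) +
          (1 / 2) * ∫ x, B ((2 * M * (k s - k t)) • (u x + timePrim g (t, x))) := by
        rw [integral_add (hm1.2.const_mul _) (hm2.2.const_mul _), integral_const_mul,
          integral_const_mul]
    _ ≤ _ := by
        refine add_le_add (mul_le_mul_of_nonneg_left ?_ (by norm_num))
          (mul_le_mul_of_nonneg_left ?_ (by norm_num))
        · refine (hD.integral_dual_timePrim_sub_le hT hgm hg ht hs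
            ((mul_le_mul_of_nonneg_right hrR (abs_nonneg _)).trans h3.le)).trans ?_
          exact mul_le_mul_of_nonneg_right hrR (abs_nonneg _)
        · rw [← integral_const_mul]
          exact integral_mono hm2.2 (hat.2.const_mul _) fun x => hD.dual_smul_le h2.le _

end PathField

end EntropyCons

namespace EntropyCons

/-! ### Fields on the cylinder -/

section Cylinder

variable {d n N : ℕ} {T : ℝ} {κ : ℝ → ℝ} {A B : Vec n → ℝ} {σ S : Vec n → Vec n}

theorem ae_fst_mem_Ioo (d : ℕ) (T : ℝ) : ∀ᵐ p ∂cylMeasure d T, p.1 ∈ Ioo 0 T := by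
  rw [cylMeasure_eq]
  exact Measure.quasiMeasurePreserving_fst.ae (ae_restrict_mem measurableSet_Ioo)

theorem aestronglyMeasurable_comp_fst {E : Type*} [TopologicalSpace E] {f : ℝ → E}
    (hf : AEStronglyMeasurable f (volume.restrict (Ioo 0 T))) :
    AEStronglyMeasurable (fun p : ℝ × Box d => f p.1) (cylMeasure d T) := by
  rw [cylMeasure_eq]
  exact hf.comp_fst

theorem exists_bound_of_continuous {E : Type*} [NormedAddCommGroup E] {q : ℝ × Box d → E}
    (hq : Continuous q) (T : ℝ) : ∃ C, ∀ᵐ p ∂cylMeasure d T, ‖q p‖ ≤ C := by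
  obtain ⟨C, hC⟩ := ((isCompact_Icc (a := (0 : ℝ)) (b := T)).prod
    (isCompact_univ (X := Box d))).exists_bound_of_continuousOn hq.continuousOn
  refine ⟨C, ?_⟩
  filter_upwards [ae_fst_mem_Ioo d T] with p hp
  exact hC p ⟨Ioo_subset_Icc_self hp, mem_univ _⟩

theorem integrable_inner_of_continuous {E q : ℝ × Box d → Vec n}
    (hE : Integrable E (cylMeasure d T)) (hq : Continuous q) :
    Integrable (fun p => (inner ℝ (E p) (q p) : ℝ)) (cylMeasure d T) := by
  obtain ⟨C, hC⟩ := exists_bound_of_continuous hq T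
  refine (hE.norm.mul_const C).mono' (hE.aestronglyMeasurable.inner hq.aestronglyMeasurable) ?_
  filter_upwards [hC] with p hp
  exact (norm_inner_le_norm _ _).trans (mul_le_mul_of_nonneg_left hp (norm_nonneg _))

theorem integrable_frob_of_continuous {G Ψ : ℝ × Box d → Mat N}
    (hG : ∀ i j, Integrable (fun p => G p i j) (cylMeasure d T))
    (hΨ : ∀ i j, Continuous fun p => Ψ p i j) :
    Integrable (fun p => frob (G p) (Ψ p)) (cylMeasure d T) := by
  refine integrable_finsetSum _ fun i _ => integrable_finsetSum _ fun j _ => ?_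
  obtain ⟨C, hC⟩ := exists_bound_of_continuous (hΨ i j) T
  exact (hG i j).mul_bdd (hΨ i j).aestronglyMeasurable hC

theorem MemOrlicz.ae_slice {f : ℝ × Box d → Vec n} (hf : MemOrlicz B (cylMeasure d T) f) :
    ∀ᵐ t ∂volume.restrict (Ioo 0 T), MemOrlicz B volume fun x => f (t, x) := by
  rw [cylMeasure_eq] at hf
  filter_upwards [hf.1.prodMk_left, hf.2.prod_right_ae] with t h1 h2
  exact ⟨h1, h2⟩

theorem IsWeight.aestronglyMeasurable_cumWeight (hT : 0 < T) (hκ : IsWeight T κ) :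
    AEStronglyMeasurable (cumWeight T κ) (volume.restrict (Ioo 0 T)) :=
  ((hκ.continuousOn hT).mono Ioo_subset_Icc_self).aestronglyMeasurable measurableSet_Ioo

/-- A field whose product with the weight has a weak time derivative in the Orlicz space is a
field of paths. -/
theorem DualPair.exists_eq_pathField (hD : DualPair A B σ S) (hT : 0 < T) (hκ : IsWeight T κ)
    {z g : ℝ × Box d → Vec n} (hz : MemOrlicz B (cylMeasure d T) z)
    (hg : MemOrlicz B (cylMeasure d T) g)
    (h : HasWeakTimeDeriv T (fun p => cumWeight T κ p.1 • z p) g) :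
    ∃ (u : Box d → Vec n) (g₀ : ℝ × Box d → Vec n), StronglyMeasurable g₀ ∧
      MemOrlicz B (cylMeasure d T) g₀ ∧ MemOrlicz B volume u ∧
      z =ᵐ[cylMeasure d T] pathField T κ u g₀ := by
  obtain ⟨c, C, hc, -, hb⟩ := hκ.exists_bounds hT
  have hf : MemOrlicz B (cylMeasure d T) (fun p => cumWeight T κ p.1 • z p) := by
    refine hD.memOrlicz_smul (M := C * T)
      (aestronglyMeasurable_comp_fst (hκ.aestronglyMeasurable_cumWeight hT)) ?_ hz
    filter_upwards [ae_fst_mem_Ioo d T] with p hp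
    rw [abs_of_pos (hκ.cumWeight_pos hT (Ioo_subset_Ico_self hp))]
    exact (hb _ (Ioo_subset_Icc_self hp)).2
  have hae := hg.1.ae_eq_mk
  have hm := hg.1.stronglyMeasurable_mk
  set g₀ := hg.1.mk g
  have hg₀ : MemOrlicz B (cylMeasure d T) g₀ :=
    ⟨hm.aestronglyMeasurable, hg.2.congr (by filter_upwards [hae] with p hp; rw [hp])⟩
  obtain ⟨u, hum, hu⟩ := exists_eq_add_timePrim hT (hD.integrable_of_memOrlicz hf) hm
    (hD.integrable_of_memOrlicz hg₀) fun φ h1 h2 h3 => by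
      rw [h.2.2 φ h1 h2 h3]
      congr 1
      refine integral_congr_ae ?_
      filter_upwards [hae] with p hp
      rw [hp]
  refine ⟨u, g₀, hm, hg₀, ?_, ?_⟩
  · have hne : (ae (volume.restrict (Ioo 0 T))).NeBot := by
      rw [ae_restrict_neBot]
      simp [hT]
    have h1 := hu
    rw [cylMeasure_eq] at h1
    -- `u` inherits its finite modular from a single good time: it is the slice of `𝒦 z` minus the
    -- primitive there.
    obtain ⟨t, ⟨h2, h3⟩, h4⟩ := ((hf.ae_slice.and (Measure.ae_ae_of_ae_prod h1)).and
      (ae_restrict_mem measurableSet_Ioo)).exists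
    have h5 := hD.memOrlicz_sub h2 (hD.memOrlicz_timePrim hT hm hg₀ (Ioo_subset_Ico_self h4))
    refine ⟨hum, h5.2.congr ?_⟩
    filter_upwards [h3] with x hx
    rw [hx, add_sub_cancel_right]
  · filter_upwards [hu, ae_fst_mem_Ioo d T] with p hp hmem
    have hpos := hκ.cumWeight_pos hT (Ioo_subset_Ico_self hmem)
    have : z p = (cumWeight T κ p.1)⁻¹ • (u p.2 + timePrim g₀ p) := by
      rw [← hp, smul_smul, inv_mul_cancel₀ hpos.ne', one_smul]
    exact this

/-- The support of `θ` keeps away from `T`, where `𝒦` vanishes. So the weighted regularity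
assumptions become unweighted ones after multiplication by `θ`. -/
theorem IsTimeTest.exists_abs_mul_inv_cumWeight_le (hT : 0 < T) (hκ : IsWeight T κ) {θ : ℝ → ℝ}
    (hθ : IsTimeTest T θ) : ∃ C, 0 ≤ C ∧ ∀ t ∈ Ioo 0 T, |θ t * (cumWeight T κ t)⁻¹| ≤ C := by
  obtain ⟨a, b, ha, hab, hb, hz⟩ := hθ.exists_Icc hT
  obtain ⟨c, _, hc, -, hlow⟩ := hκ.exists_bounds hT
  obtain ⟨C, hC⟩ := hθ.smooth.continuous.bounded_above_of_compact_support hθ.compact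
  have hm : 0 < c * (T - b) := mul_pos hc (sub_pos.2 hb)
  have hC0 : 0 ≤ C := (norm_nonneg _).trans (hC 0)
  refine ⟨C * (c * (T - b))⁻¹, by positivity, fun t ht => ?_⟩
  by_cases hmem : t ∈ Icc a b
  · have h1 : c * (T - b) ≤ cumWeight T κ t :=
      (mul_le_mul_of_nonneg_left (by linarith [hmem.2]) hc.le).trans
        (hlow t (Ioo_subset_Icc_self ht)).1
    rw [abs_mul, abs_inv, abs_of_pos (hm.trans_le h1)]
    exact mul_le_mul (hC t) (inv_anti₀ hm h1) (inv_nonneg.2 (hm.trans_le h1).le) hC0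
  · rw [hz t hmem, zero_mul, abs_zero]
    positivity

/-! ### Fields with a weak `L^*` -/

variable {ν : ℕ} {b : Coeff d n N} {z : ℝ × Box d → Vec n} {G : ℝ × Box d → Mat N}

theorem MemLinftySym.exists_bound (hG : MemLinftySym T (fun p => cumWeight T κ p.1 • G p))
    (hT : 0 < T) (hκ : IsWeight T κ) : ∃ M, 0 ≤ M ∧ ∀ᵐ p ∂cylMeasure d T, ∀ l k,
      |G p l k| ≤ M * (cumWeight T κ p.1)⁻¹ := by
  have h1 : ∀ l k, ∃ M, 0 ≤ M ∧ ∀ᵐ p ∂cylMeasure d T, |cumWeight T κ p.1 * G p l k| ≤ M := by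
    intro l k
    have h2 := hG.1 l k
    refine ⟨(eLpNorm (fun p => (cumWeight T κ p.1 • G p) l k) ∞ (cylMeasure d T)).toReal,
      ENNReal.toReal_nonneg, ?_⟩
    have h3 := ae_le_eLpNormEssSup (f := fun p => (cumWeight T κ p.1 • G p) l k)
      (μ := cylMeasure d T)
    filter_upwards [h3] with p hp
    rw [← eLpNorm_exponent_top] at hp
    have := ENNReal.toReal_mono h2.2.ne hp
    simpa [abs_mul] using this
  choose M hM0 hM using h1
  refine ⟨∑ l, ∑ k, M l k, Finset.sum_nonneg fun l _ => Finset.sum_nonneg fun k _ => hM0 l k, ?_⟩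
  have hM' : ∀ᵐ p ∂cylMeasure d T, ∀ l k, |cumWeight T κ p.1 * G p l k| ≤ M l k :=
    ae_all_iff.2 fun l => ae_all_iff.2 fun k => hM l k
  filter_upwards [hM', ae_fst_mem_Ioo d T] with p hp hmem l k
  have hpos := hκ.cumWeight_pos hT (Ioo_subset_Ico_self hmem)
  have h2 := hp l k
  rw [abs_mul, abs_of_pos hpos] at h2
  rw [← div_eq_mul_inv, le_div_iff₀ hpos, mul_comm]
  refine h2.trans ?_
  refine (Finset.single_le_sum (f := fun k => M l k) (fun k _ => hM0 l k) (Finset.mem_univ k)).trans ?_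
  exact Finset.single_le_sum (f := fun l => ∑ k, M l k)
    (fun l _ => Finset.sum_nonneg fun k _ => hM0 l k) (Finset.mem_univ l)

theorem HasWeakLstar.aestronglyMeasurable (hw : HasWeakLstar ν b T z G) (l k : Fin N) :
    AEStronglyMeasurable (fun p => G p l k) (cylMeasure d T) :=
  (hw.2.1 l k).aestronglyMeasurable

theorem HasWeakLstar.memLinftySym_smul (hw : HasWeakLstar ν b T z G)
    (hG : MemLinftySym T (fun p => cumWeight T κ p.1 • G p)) (hT : 0 < T) (hκ : IsWeight T κ)
    {θ : ℝ → ℝ} (hθ : IsTimeTest T θ) : MemLinftySym T (fun p => θ p.1 • G p) := by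
  obtain ⟨M, hM0, hM⟩ := hG.exists_bound hT hκ
  obtain ⟨C, hC0, hC⟩ := hθ.exists_abs_mul_inv_cumWeight_le hT hκ
  refine ⟨fun i j => ?_, fun p => (hw.2.2.1 p).smul _⟩
  refine memLp_top_of_bound ((hθ.smooth.continuous.comp continuous_fst).aestronglyMeasurable.mul
    (hw.aestronglyMeasurable i j)) (C * M) ?_
  filter_upwards [hM, ae_fst_mem_Ioo d T] with p hp hmem
  have hpos := hκ.cumWeight_pos hT (Ioo_subset_Ico_self hmem)
  have h1 := hC _ hmem
  rw [abs_mul, abs_inv, abs_of_pos hpos] at h1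
  change |θ p.1 * G p i j| ≤ C * M
  calc |θ p.1 * G p i j| ≤ |θ p.1| * (M * (cumWeight T κ p.1)⁻¹) := by
        rw [abs_mul]
        exact mul_le_mul_of_nonneg_left (hp i j) (abs_nonneg _)
    _ = |θ p.1| * (cumWeight T κ p.1)⁻¹ * M := by ring
    _ ≤ C * M := mul_le_mul_of_nonneg_right h1 hM0

theorem opL_const_smul (r : ℝ) (Ξ : Box d → Mat N) (x : Box d) :
    opL ν b (fun y => r • Ξ y) x = r • opL ν b Ξ x := by
  ext i
  simp only [opL, PiLp.smul_apply, smul_eq_mul, Finset.mul_sum, Matrix.smul_apply]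
  refine Finset.sum_congr rfl fun j _ => Finset.sum_congr rfl fun l _ =>
    Finset.sum_congr rfl fun m _ => Finset.sum_congr rfl fun α _ => ?_
  rw [multiD_const_mul]
  ring

theorem frob_smul_left (r : ℝ) (P Q : Mat N) : frob (r • P) Q = r * frob P Q := by
  simp only [frob, Matrix.smul_apply, smul_eq_mul, Finset.mul_sum, mul_assoc]

/-- The space-time equation is tested with `χ(t) Ξ(x)` and localised in time. Countably many
trigonometric tests `Ξ` suffice, so almost every time works for all of them. -/
theorem HasWeakLstar.ae_trigWeakLstar (hw : HasWeakLstar ν b T z G) (hT : 0 < T)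
    (hκ : IsWeight T κ) (hz : Integrable z (cylMeasure d T))
    (hG : MemLinftySym T (fun p => cumWeight T κ p.1 • G p)) :
    ∀ᵐ t ∂volume.restrict (Ioo 0 T), TrigWeakLstar ν b (fun x => z (t, x)) (fun x => G (t, x)) := by
  have hsmooth : ∀ (m : Fin d → ℤ) (c : ℂ) (l k i j : Fin N), SmoothTimeBox (fun p : ℝ × Box d =>
      (trigPoly {m} (fun _ => c) p.2 • symUnit l k : Mat N) i j) := fun m c l k i j =>
    smoothTimeBox_of_smoothBox (f := fun x => trigPoly {m} (fun _ => c) x * symUnit l k i j)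
      (ContDiff.mul (smoothBox_trigPoly _ _) contDiff_const)
  have hone : ∀ (m : Fin d → ℤ) (c : ℂ) (l k : Fin N), ∀ᵐ t ∂volume.restrict (Ioo 0 T),
      ∫ x, frob (G (t, x)) (trigPoly {m} (fun _ => c) x • symUnit l k) =
        ∫ x, inner ℝ (z (t, x)) (opL ν b (fun y => trigPoly {m} (fun _ => c) y • symUnit l k) x) := by
    intro m c l k
    set Ξ : ℝ × Box d → Mat N := fun p => trigPoly {m} (fun _ => c) p.2 • symUnit l k
    have hΞc : ∀ i j, Continuous fun p => Ξ p i j := fun i j => (hsmooth m c l k i j).continuous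
    have hL : Continuous (opLField ν b Ξ) := (smoothTimeBox_opLField (hsmooth m c l k)).continuous
    have hLeq : ∀ p : ℝ × Box d, opLField ν b Ξ p =
      opL ν b (fun y => trigPoly {m} (fun _ => c) y • symUnit l k) p.2 := fun p => rfl
    have hf1 : LocallyIntegrableOn (fun p => frob (G p) (Ξ p)) (cylinder d T) := by
      have hcl := (isOpen_Ioo.prod (isOpen_univ (X := Box d)) :
        IsOpen (cylinder d T)).isLocallyClosed
      refine (locallyIntegrableOn_iff hcl).2 fun K hK hKc => integrable_finsetSum _ fun i _ =>
        integrable_finsetSum _ fun j _ => ?_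
      exact ((locallyIntegrableOn_iff hcl).1 (hw.2.1 i j) K hK hKc).mul_continuousOn
        (hΞc i j).continuousOn hKc
    have hf2 : LocallyIntegrableOn (fun p => (inner ℝ (z p) (opLField ν b Ξ p) : ℝ))
        (cylinder d T) :=
      IntegrableOn.locallyIntegrableOn (integrable_inner_of_continuous hz hL)
    have hsl := ae_integral_slice_eq_zero (hf1.sub hf2) (fun χ hχ => ?_) hT
    · have hzs : ∀ᵐ t ∂volume.restrict (Ioo 0 T), Integrable (fun x => inner ℝ (z (t, x))
          (opLField ν b Ξ (t, x))) volume := by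
        have := integrable_inner_of_continuous hz hL
        rw [cylMeasure_eq] at this
        exact this.prod_right_ae
      have hGs : ∀ᵐ t ∂volume.restrict (Ioo 0 T), Integrable (fun x => frob (G (t, x)) (Ξ (t, x)))
          volume := by
        obtain ⟨M, hM0, hM⟩ := hG.exists_bound hT hκ
        have h1 : ∀ᵐ t ∂volume.restrict (Ioo 0 T), ∀ i j,
            AEStronglyMeasurable (fun x => G (t, x) i j) volume := by
          refine ae_all_iff.2 fun i => ae_all_iff.2 fun j => ?_
          have := hw.aestronglyMeasurable i j
          rw [cylMeasure_eq] at this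
          exact this.prodMk_left
        rw [cylMeasure_eq] at hM
        filter_upwards [h1, Measure.ae_ae_of_ae_prod hM] with t h1 h2
        refine integrable_finsetSum _ fun i _ => integrable_finsetSum _ fun j _ => ?_
        have h3 : Continuous fun x => Ξ (t, x) i j := (hΞc i j).comp (Continuous.prodMk_right t)
        obtain ⟨C, hC⟩ := isCompact_univ.exists_bound_of_continuousOn h3.continuousOn
        refine Integrable.mul_bdd (c := C) ((integrable_const (M * (cumWeight T κ t)⁻¹)).mono' (h1 i j)
          ?_) h3.aestronglyMeasurable (ae_of_all _ fun x => hC x (mem_univ _))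
        filter_upwards [h2] with x hx
        exact hx i j
      filter_upwards [hsl, hzs, hGs] with t h1 h2 h3
      simp only [Pi.sub_apply] at h1
      rw [integral_sub h3 h2] at h1
      exact sub_eq_zero.1 h1
    · have hts := tsupport_smul_subset_cylinder hT hχ Ξ
      have hsm : ∀ i j, SmoothTimeBox (fun p => (χ p.1 • Ξ p) i j) := fun i j =>
        smoothTimeBox_smul hχ (hsmooth m c l k i j)
      have hw1 := hw.2.2.2 (fun p => χ p.1 • Ξ p) hsm
        (fun p => (isSymm_symUnit l k).smul _ |>.smul _) hts.1 hts.2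
      simp only [opL_const_smul, inner_smul_right, frob_smul_right] at hw1
      have i1 : Integrable (fun p => χ p.1 * frob (G p) (Ξ p)) (cylMeasure d T) := by
        have := integrable_frob_of_continuous (G := fun p => χ p.1 • G p) (Ψ := Ξ) (T := T)
          (fun i j => ((hw.memLinftySym_smul hG hT hκ hχ).1 i j).integrable le_top) hΞc
        simpa only [frob_smul_left] using this
      have i2 : Integrable (fun p => χ p.1 * inner ℝ (z p) (opLField ν b Ξ p)) (cylMeasure d T) := by
        have := integrable_inner_of_continuous (q := fun p => χ p.1 • opLField ν b Ξ p) hz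
          ((hχ.smooth.continuous.comp continuous_fst).smul hL)
        simpa only [inner_smul_right] using this
      simp only [Pi.sub_apply, mul_sub]
      rw [integral_sub i1 i2, sub_eq_zero]
      exact hw1
  have hall : ∀ᵐ t ∂volume.restrict (Ioo 0 T), ∀ (m : Fin d → ℤ), ∀ c ∈ ({1, Complex.I} : Set ℂ),
      ∀ l k : Fin N, ∫ x, frob (G (t, x)) (trigPoly {m} (fun _ => c) x • symUnit l k) =
        ∫ x, inner ℝ (z (t, x)) (opL ν b (fun y => trigPoly {m} (fun _ => c) y • symUnit l k) x) :=
    ae_all_iff.2 fun m => (ae_ball_iff (by simp : ({1, Complex.I} : Set ℂ).Countable)).2 fun c _ =>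
      ae_all_iff.2 fun l => ae_all_iff.2 fun k => hone m c l k
  filter_upwards [hall] with t ht m c hc l k
  exact ht m c hc l k

end Cylinder

end EntropyCons

namespace EntropyCons

/-! ### The test fields built from a solution -/

section TestField

variable {d n N : ℕ} {T : ℝ} {κ : ℝ → ℝ} {A B : Vec n → ℝ} {σ S : Vec n → Vec n}
  {u : Box d → Vec n} {g : ℝ × Box d → Vec n} {θ : ℝ → ℝ}

theorem integral_cylMeasure_eq_zero_of_space {f : ℝ × Box d → ℝ}
    (hf : Integrable f (cylMeasure d T)) (h : ∀ᵐ x, ∫ t in Ioo 0 T, f (t, x) = 0) :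
    ∫ p, f p ∂cylMeasure d T = 0 := by
  rw [cylMeasure_eq] at hf ⊢
  rw [integral_prod_symm _ hf]
  exact integral_eq_zero_of_ae h

theorem integral_cylMeasure_eq_zero_of_time {f : ℝ × Box d → ℝ}
    (hf : Integrable f (cylMeasure d T))
    (h : ∀ᵐ t ∂volume.restrict (Ioo 0 T), ∫ x, f (t, x) = 0) :
    ∫ p, f p ∂cylMeasure d T = 0 := by
  rw [cylMeasure_eq] at hf ⊢
  rw [integral_prod _ hf]
  exact integral_eq_zero_of_ae h

/-- The field of the time derivatives of the paths of `pathField`. -/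
def pathFieldDeriv (T : ℝ) (κ : ℝ → ℝ) (u : Box d → Vec n) (g : ℝ × Box d → Vec n)
    (p : ℝ × Box d) : Vec n := pathDeriv T κ (u p.2) (fun s => g (s, p.2)) p.1

/-- The distributional time derivative of `θ z`, for the field `z` of paths. -/
def testField (T : ℝ) (κ : ℝ → ℝ) (u : Box d → Vec n) (g : ℝ × Box d → Vec n) (θ : ℝ → ℝ)
    (p : ℝ × Box d) : Vec n :=
  deriv θ p.1 • pathField T κ u g p + θ p.1 • pathFieldDeriv T κ u g p

theorem IsTimeTest.exists_deriv_bound (hθ : IsTimeTest T θ) : ∃ C, ∀ t, ‖deriv θ t‖ ≤ C :=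
  (hθ.smooth.continuous_deriv (by simp)).bounded_above_of_compact_support hθ.compact.deriv

/-- The field expands into `θ' z`, `θ 𝒦⁻¹ g` and `θ 𝒦⁻¹ κ z`, which are products of Orlicz fields
with bounded scalars. -/
theorem DualPair.memOrlicz_testField (hD : DualPair A B σ S) (hT : 0 < T) (hκ : IsWeight T κ)
    (hg : MemOrlicz B (cylMeasure d T) g)
    (hZ : MemOrlicz B (cylMeasure d T) (pathField T κ u g)) (hθ : IsTimeTest T θ) :
    MemOrlicz B (cylMeasure d T) (testField T κ u g θ) := by
  obtain ⟨C, hC0, hC⟩ := hθ.exists_abs_mul_inv_cumWeight_le hT hκ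
  obtain ⟨_, D, -, hD', -⟩ := hκ.exists_bounds hT
  obtain ⟨C', hC'⟩ := hθ.exists_deriv_bound
  have hkm : AEStronglyMeasurable (fun t => θ t * (cumWeight T κ t)⁻¹) (volume.restrict (Ioo 0 T)) :=
    (hθ.smooth.continuous.continuousOn.mul
      (((hκ.continuousOn hT).mono Ioo_subset_Icc_self).inv₀ fun t ht =>
        (hκ.cumWeight_pos hT (Ioo_subset_Ico_self ht)).ne')).aestronglyMeasurable measurableSet_Ioo
  have hκm : AEStronglyMeasurable κ (volume.restrict (Ioo 0 T)) :=
    hκ.1.aestronglyMeasurable.mono_measure (Measure.restrict_mono Ioo_subset_Icc_self le_rfl)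
  have h1 := hD.memOrlicz_smul (M := C') (aestronglyMeasurable_comp_fst (d := d)
    (hθ.smooth.continuous_deriv (by simp)).aestronglyMeasurable) (ae_of_all _ fun p => hC' p.1) hZ
  have h2 := hD.memOrlicz_smul (M := C) (aestronglyMeasurable_comp_fst (d := d) hkm)
    (by filter_upwards [ae_fst_mem_Ioo d T] with p hp using hC _ hp) hg
  have h3 := hD.memOrlicz_smul (M := C * D) (aestronglyMeasurable_comp_fst (d := d) (hkm.mul hκm))
    (by
      filter_upwards [ae_fst_mem_Ioo d T] with p hp
      rw [Pi.mul_apply, abs_mul]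
      exact mul_le_mul (hC _ hp) (hD' _ (Ioo_subset_Icc_self hp)) (abs_nonneg _) hC0) hZ
  convert! hD.memOrlicz_add h1 (hD.memOrlicz_add h2 h3) using 2 with p
  simp only [testField, pathFieldDeriv, pathDeriv, Pi.mul_apply, smul_add, smul_smul,
    mul_assoc]
  rfl

/-- Weak form of `∂_t(θ L^* z) = L^* ∂_t(θ z)`. The equation for `L^* z` is tested with `θ ∂_tΨ`,
and for a.e. `x` the path `z` is integrated by parts against `θ LΨ`. The cut-off `θ` removes all
boundary terms. -/
theorem constraint_testField {ν : ℕ} {b : Coeff d n N} {z : ℝ × Box d → Vec n}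
    {G : ℝ × Box d → Mat N} (hT : 0 < T) (hκ : IsWeight T κ) (hw : HasWeakLstar ν b T z G)
    (hG : MemLinftySym T (fun p => cumWeight T κ p.1 • G p))
    (hz : z =ᵐ[cylMeasure d T] pathField T κ u g) (hg : Integrable g (cylMeasure d T))
    (hZ : Integrable (pathField T κ u g) (cylMeasure d T)) (hθ : IsTimeTest T θ)
    (hE : Integrable (testField T κ u g θ) (cylMeasure d T)) :
    Constraint ν b T (testField T κ u g θ) (fun p => θ p.1 • G p) := by
  intro Ψ hΨ hΨs _
  have hdt : ∀ i j, SmoothTimeBox (fun p => timeDMat Ψ p i j) := fun i j => by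
    have e : (fun p => timeDMat Ψ p i j) = dirD (timeDir d) (fun p => Ψ p i j) :=
      funext fun p => (dirD_timeDir (fun p => Ψ p i j) p.1 p.2).symm
    rw [e]
    exact (hΨ i j).dirD _
  have hdts : ∀ p, (timeDMat Ψ p).IsSymm := fun p => by
    ext i j
    simp only [timeDMat, Matrix.transpose_apply, Matrix.of_apply]
    congr 1
    funext s
    exact (hΨs (s, p.2)).apply i j
  have hΦ : ∀ i j, SmoothTimeBox (fun p => (θ p.1 • timeDMat Ψ p) i j) := fun i j =>
    smoothTimeBox_smul hθ (hdt i j)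
  have hL : SmoothTimeBox (opLField ν b Ψ) := smoothTimeBox_opLField hΨ
  have hts := tsupport_smul_subset_cylinder hT hθ (timeDMat Ψ)
  have hw1 := hw.2.2.2 (fun p => θ p.1 • timeDMat Ψ p) hΦ (fun p => (hdts p).smul _) hts.1 hts.2
  have hΦc : Continuous fun p => θ p.1 • timeD (opLField ν b Ψ) p := by
    have e : (fun p => θ p.1 • timeD (opLField ν b Ψ) p) =
        opLField ν b fun p => θ p.1 • timeDMat Ψ p :=
      funext fun p => (opLField_smul_timeDMat hΨ θ p).symm
    rw [e]
    exact (smoothTimeBox_opLField hΦ).continuous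
  have hw2 : ∫ p, frob (θ p.1 • G p) (timeDMat Ψ p) ∂cylMeasure d T =
      ∫ p, inner ℝ (pathField T κ u g p) (θ p.1 • timeD (opLField ν b Ψ) p) ∂cylMeasure d T := by
    simp only [frob_smul_right] at hw1
    simp only [frob_smul_left]
    rw [hw1]
    refine integral_congr_ae ?_
    filter_upwards [hz] with p hp
    rw [← hp, ← opLField_smul_timeDMat hΨ]
    rfl
  have i1 : Integrable (fun p => frob (θ p.1 • G p) (timeDMat Ψ p)) (cylMeasure d T) :=
    integrable_frob_of_continuous
      (fun i j => ((hw.memLinftySym_smul hG hT hκ hθ).1 i j).integrable le_top)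
      fun i j => (hdt i j).continuous
  have i2 := integrable_inner_of_continuous hE hL.continuous
  have i3 := integrable_inner_of_continuous hZ hΦc
  change ∫ p, (frob (θ p.1 • G p) (timeDMat Ψ p) +
    inner ℝ (testField T κ u g θ p) (opLField ν b Ψ p)) ∂cylMeasure d T = 0
  rw [integral_add i1 i2, hw2, ← integral_add i3 i2]
  refine integral_cylMeasure_eq_zero_of_space (i3.add i2) ?_
  filter_upwards [ae_intervalIntegrable_slice hT hg] with x hx
  have hφs : ContDiff ℝ ∞ fun t => opLField ν b Ψ (t, x) := hL.contDiff_time x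
  have hφ : IsTimeTest T (fun t => θ t • opLField ν b Ψ (t, x)) :=
    ⟨hθ.smooth.smul hφs, hθ.compact.smul_right, (tsupport_smul_subset_left _ _).trans hθ.subset⟩
  refine (setIntegral_congr_fun measurableSet_Ioo fun t _ => ?_).trans
    (setIntegral_path_parts (u := u x) hT hκ hx hφ)
  have hd : deriv (fun t => θ t • opLField ν b Ψ (t, x)) t =
      θ t • timeD (opLField ν b Ψ) (t, x) + deriv θ t • opLField ν b Ψ (t, x) :=
    ((hθ.smooth.differentiable (by simp) t).hasDerivAt.smul
      (hφs.differentiable (by simp) t).hasDerivAt).deriv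
  simp only [hd, testField, pathField, pathFieldDeriv, inner_add_left, inner_add_right,
    inner_smul_left, inner_smul_right, conj_trivial]
  ring

/-- `v₀` does not depend on time, and `∂_t(θ z)` integrates to zero in time. -/
theorem DualPair.integral_inner_initial_testField (hD : DualPair A B σ S) (hT : 0 < T)
    (hκ : IsWeight T κ) (hg : Integrable g (cylMeasure d T)) (hθ : IsTimeTest T θ)
    (hE : MemOrlicz B (cylMeasure d T) (testField T κ u g θ)) {v₀ : Box d → Vec n}
    (hv₀ : MemOrlicz A (cylMeasure d T) (fun p => v₀ p.2)) :
    ∫ p, inner ℝ (v₀ p.2) (testField T κ u g θ p) ∂cylMeasure d T = 0 := by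
  refine integral_cylMeasure_eq_zero_of_space (hD.integrable_inner hv₀ hE) ?_
  filter_upwards [ae_intervalIntegrable_slice hT hg] with x hx
  have hφ : IsTimeTest T (fun t => θ t • v₀ x) :=
    ⟨hθ.smooth.smul contDiff_const, hθ.compact.smul_right,
      (tsupport_smul_subset_left θ fun _ => v₀ x).trans hθ.subset⟩
  refine (setIntegral_congr_fun measurableSet_Ioo fun t _ => ?_).trans
    (setIntegral_path_parts (u := u x) hT hκ hx hφ)
  have hd : deriv (fun t => θ t • v₀ x) t = deriv θ t • v₀ x :=
    ((hθ.smooth.differentiable (by simp) t).hasDerivAt.smul_const (v₀ x)).deriv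
  simp only [hd, testField, pathField, pathFieldDeriv, inner_add_right, inner_smul_right]
  rw [real_inner_comm, real_inner_comm (pathDeriv _ _ _ _ _)]

/-- By Young's equality `S(z)·∂_t(θ z) = θ' (A(S z) + B(z)) + θ S(z)·∂_t z`. The chain rule for `B`
makes `θ' B(z) + θ S(z)·∂_t z` integrate to zero, so only the primal term survives. -/
theorem DualPair.integral_inner_testField (hD : DualPair A B σ S) (hT : 0 < T)
    (hκ : IsWeight T κ) (hg : Integrable g (cylMeasure d T)) (hθ : IsTimeTest T θ)
    (hZ : MemOrlicz B (cylMeasure d T) (pathField T κ u g))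
    (hE : MemOrlicz B (cylMeasure d T) (testField T κ u g θ)) :
    ∫ p, inner ℝ (S (pathField T κ u g p)) (testField T κ u g θ p) ∂cylMeasure d T =
      ∫ p, deriv θ p.1 * A (S (pathField T κ u g p)) ∂cylMeasure d T := by
  obtain ⟨C', hC'⟩ := hθ.exists_deriv_bound
  have i1 := hD.integrable_inner (v := fun p => S (pathField T κ u g p))
    ⟨hD.cont_inv.comp_aestronglyMeasurable hZ.1, hD.integrable_comp_inv hZ⟩ hE
  have i2 : Integrable (fun p => deriv θ p.1 * A (S (pathField T κ u g p))) (cylMeasure d T) :=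
    (hD.integrable_comp_inv hZ).bdd_mul
      ((hθ.smooth.continuous_deriv (by simp)).comp continuous_fst).aestronglyMeasurable
      (ae_of_all _ fun p => hC' p.1)
  rw [← sub_eq_zero, ← integral_sub i1 i2]
  refine integral_cylMeasure_eq_zero_of_space (i1.sub i2) ?_
  filter_upwards [ae_intervalIntegrable_slice hT hg] with x hx
  refine (setIntegral_congr_fun measurableSet_Ioo fun t _ => ?_).trans
    (hD.setIntegral_chain (u := u x) hT hκ hx hθ)
  simp only [testField, pathField, pathFieldDeriv, inner_add_right, inner_smul_right, hD.young_eq]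
  ring

end TestField

/-! ### The flux -/

section Flux

variable {d n N ν : ℕ} {b : Coeff d n N} {F : Vec n → Mat N} {B : Vec n → ℝ} {S : Vec n → Vec n}
  {T : ℝ} {κ θ : ℝ → ℝ} {v : ℝ × Box d → Vec n} {G : ℝ × Box d → Mat N}

theorem DualPair.integral_frob_flux (hD : DualPair (entropy F) B (sharp F) S)
    (hFc : ∀ i j, Continuous fun v => F v i j)
    (hF : ∀ v, ∀ P ∈ Lam ν b, P.PosSemidef → 0 ≤ frob (F v) P)
    (h_cons : FormallyConservative ν b F) (hT : 0 < T) (hκ : IsWeight T κ)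
    (hv : MemOrlicz (entropy F) (cylMeasure d T) v)
    (hw : HasWeakLstar ν b T (fun p => sharp F (v p)) G)
    (hG : MemLinftySym T (fun p => cumWeight T κ p.1 • G p)) (hθ : IsTimeTest T θ) :
    Integrable (fun p => frob (F (v p)) (θ p.1 • G p)) (cylMeasure d T) ∧
      ∫ p, frob (F (v p)) (θ p.1 • G p) ∂cylMeasure d T = 0 := by
  have hz := hD.memOrlicz_grad hv
  obtain ⟨M, hM0, hM⟩ := hG.exists_bound hT hκ
  obtain ⟨C, hC0, hC⟩ := hθ.exists_abs_mul_inv_cumWeight_le hT hκ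
  have hM' := hM
  have hGm : ∀ᵐ t ∂volume.restrict (Ioo 0 T), ∀ i j,
      AEStronglyMeasurable (fun x => G (t, x) i j) volume := by
    refine ae_all_iff.2 fun i => ae_all_iff.2 fun j => ?_
    have := hw.aestronglyMeasurable i j
    rw [cylMeasure_eq] at this
    exact this.prodMk_left
  rw [cylMeasure_eq] at hM'
  have hslice : ∀ᵐ t ∂volume.restrict (Ioo 0 T), (∀ᵐ x, G (t, x) ∈ Lam ν b) ∧
      ∫ x, frob (F (v (t, x))) (G (t, x)) = 0 := by
    filter_upwards [hw.ae_trigWeakLstar hT hκ (hD.integrable_of_memOrlicz hz) hG, hz.ae_slice,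
      hGm, Measure.ae_ae_of_ae_prod hM'] with t h1 h2 h3 h4
    have := h1.mem_and_integral_frob_eq_zero hD hFc hF h_cons h2 h3
      (M := M * (cumWeight T κ t)⁻¹) (fun l k => h4.mono fun x hx => hx l k)
      fun x => hw.2.2.1 (t, x)
    simpa only [hD.left_inv] using this
  have hm : AEStronglyMeasurable (fun p => frob (F (v p)) (θ p.1 • G p)) (cylMeasure d T) := by
    refine Finset.aestronglyMeasurable_fun_sum _ fun i _ =>
      Finset.aestronglyMeasurable_fun_sum _ fun j _ => ?_
    exact ((hFc i j).comp_aestronglyMeasurable hv.1).mul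
      ((hθ.smooth.continuous.comp continuous_fst).aestronglyMeasurable.mul
        (hw.aestronglyMeasurable i j))
  obtain ⟨D, -, hDle⟩ := exists_abs_frob_le (Submodule.subset_span (Or.inl rfl)) hF hD.nonneg (C * M)
  have hbound : Integrable (fun p => D * (entropy F (v p) + 1)) (cylMeasure d T) :=
    (hv.2.add (integrable_const 1)).const_mul D
  have hi : Integrable (fun p => frob (F (v p)) (θ p.1 • G p)) (cylMeasure d T) := by
    refine hbound.mono' hm ?_
    have h1 := hm.norm.aemeasurable
    have h2 := hbound.aestronglyMeasurable.aemeasurable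
    rw [cylMeasure_eq] at h1 h2 ⊢
    -- Membership of `G` in `Λ` is known slice by slice only; it is the resulting inequality between
    -- measurable functions that is carried over to the cylinder.
    refine ae_prod_le_of_ae_ae_le h1 h2 ?_
    filter_upwards [hslice, Measure.ae_ae_of_ae_prod hM', ae_restrict_mem measurableSet_Ioo]
      with t ht hMt hmem
    filter_upwards [ht.1, hMt] with x hx hMx
    refine hDle _ (Submodule.smul_mem _ _ hx) ((hw.2.2.1 (t, x)).smul _) (fun i j => ?_) _
    have hpos := hκ.cumWeight_pos hT (Ioo_subset_Ico_self hmem)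
    have h5 := hC t hmem
    rw [abs_mul, abs_inv, abs_of_pos hpos] at h5
    change |θ t * G (t, x) i j| ≤ C * M
    calc |θ t * G (t, x) i j| ≤ |θ t| * (M * (cumWeight T κ t)⁻¹) := by
          rw [abs_mul]
          exact mul_le_mul_of_nonneg_left (hMx i j) (abs_nonneg _)
      _ = |θ t| * (cumWeight T κ t)⁻¹ * M := by ring
      _ ≤ C * M := mul_le_mul_of_nonneg_right h5 hM0
  refine ⟨hi, integral_cylMeasure_eq_zero_of_time hi ?_⟩
  filter_upwards [hslice] with t ht
  simp only [frob_smul_right, integral_const_mul, ht.2, mul_zero]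

end Flux

/-! ### Conservation of the total entropy -/

section Conservation

variable {d n N ν : ℕ} {b : Coeff d n N} {F : Vec n → Mat N} {B : Vec n → ℝ} {S : Vec n → Vec n}
  {T : ℝ} {κ : ℝ → ℝ} {v₀ : Box d → Vec n} {v w : ℝ × Box d → Vec n}

theorem IsStrongSolution.exists_pathField
    (hD : DualPair (entropy F) (legendre (entropy F)) (sharp F) S) (hT : 0 < T)
    (hκ : IsWeight T κ) (hv : IsStrongSolution ν b F T κ v₀ v) :
    ∃ (u : Box d → Vec n) (g : ℝ × Box d → Vec n), StronglyMeasurable g ∧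
      MemOrlicz (legendre (entropy F)) (cylMeasure d T) g ∧
      MemOrlicz (legendre (entropy F)) volume u ∧
      (fun p => sharp F (v p)) =ᵐ[cylMeasure d T] pathField T κ u g := by
  obtain ⟨g, hg, hgm⟩ := hv.regular_time
  exact hD.exists_eq_pathField hT hκ (hD.memOrlicz_grad hv.weakSolution.mem) hgm hg

theorem IsStrongSolution.exists_isContinuousVersion
    (hD : DualPair (entropy F) (legendre (entropy F)) (sharp F) S) (hT : 0 < T)
    (hκ : IsWeight T κ) (hv : IsStrongSolution ν b F T κ v₀ v) :
    ∃ w, IsContinuousVersion F T v w := by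
  obtain ⟨u, g, hgm, hg, hu, hz⟩ := hv.exists_pathField hD hT hκ
  refine ⟨fun p => S (pathField T κ u g p), ?_, fun t ht => ?_, fun t ht => ?_⟩
  · filter_upwards [hz] with p hp
    rw [← hp, hD.left_inv]
  · simp only [hD.right_inv]
    exact hD.memOrlicz_pathField hT hgm hg hu ht
  · simp only [hD.right_inv]
    exact hD.tendsto_luxemburg_pathField hT hκ hgm hg hu ht

theorem IsStrongSolution.exists_ae_totalEntropy_eq
    (hD : DualPair (entropy F) (legendre (entropy F)) (sharp F) S)
    (hFc : ∀ i j, Continuous fun v => F v i j)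
    (hF : ∀ v, ∀ P ∈ Lam ν b, P.PosSemidef → 0 ≤ frob (F v) P)
    (h_cons : FormallyConservative ν b F) (hT : 0 < T) (hκ : IsWeight T κ)
    (hv₀ : MemOrlicz (entropy F) volume v₀) (hv : IsStrongSolution ν b F T κ v₀ v) :
    ∃ c, ∀ᵐ t ∂volume.restrict (Ioo 0 T), totalEntropy F v t = c := by
  obtain ⟨u, g, hgm, hg, hu, hz⟩ := hv.exists_pathField hD hT hκ
  obtain ⟨_, G, -, hw, hG, -⟩ := hv.equation
  have hvm := hv.weakSolution.mem
  have hgi := hD.integrable_of_memOrlicz hg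
  have hZ : MemOrlicz (legendre (entropy F)) (cylMeasure d T) (pathField T κ u g) := by
    have h1 := hD.memOrlicz_grad hvm
    exact ⟨h1.1.congr hz, h1.2.congr (by filter_upwards [hz] with p hp; rw [hp])⟩
  have hv₀' : MemOrlicz (entropy F) (cylMeasure d T) fun p => v₀ p.2 := by
    rw [cylMeasure_eq]
    exact ⟨hv₀.1.comp_snd, hv₀.2.comp_snd _⟩
  have hi := hvm.2
  rw [cylMeasure_eq] at hi
  -- It remains to show `∫ θ' ∫_Ω K(v) = 0`, and the weak equation with `E = ∂_t(θ v^#)`, `B = θ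
  -- L^*(v^#)` is exactly this once the initial and flux terms are dropped.
  refine ae_eq_const_of_integral_deriv_eq_zero hT hi.integral_prod_left fun θ hθ => ?_
  have hE := hD.memOrlicz_testField hT hκ hg hZ hθ
  have hweak := hv.weakSolution.weak _ _ hE (hw.memLinftySym_smul hG hT hκ hθ)
    (constraint_testField hT hκ hw hG hz hgi (hD.integrable_of_memOrlicz hZ) hθ
      (hD.integrable_of_memOrlicz hE))
  obtain ⟨iF, hflux⟩ := hD.integral_frob_flux hFc hF h_cons hT hκ hvm hw hG hθ
  simp only [inner_sub_left] at hweak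
  have i1 := hD.integrable_inner hvm hE
  have i2 := hD.integrable_inner hv₀' hE
  have i12 : Integrable (fun p => (inner ℝ (v p) (testField T κ u g θ p) : ℝ) -
      inner ℝ (v₀ p.2) (testField T κ u g θ p)) (cylMeasure d T) := i1.sub i2
  rw [integral_add i12 iF, integral_sub i1 i2, hflux,
    hD.integral_inner_initial_testField hT hκ hgi hθ hE hv₀', sub_zero, add_zero] at hweak
  have hvS : ∀ᵐ p ∂cylMeasure d T, v p = S (pathField T κ u g p) := by
    filter_upwards [hz] with p hp
    rw [← hp, hD.left_inv]
  have h1 : ∫ p, deriv θ p.1 * entropy F (v p) ∂cylMeasure d T = 0 := by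
    rw [← hweak]
    refine Eq.trans (integral_congr_ae ?_) ((hD.integral_inner_testField hT hκ hgi hθ hZ hE).symm.trans
      (integral_congr_ae ?_))
    · filter_upwards [hvS] with p hp
      rw [← hp]
    · filter_upwards [hvS] with p hp
      rw [← hp]
  obtain ⟨C', hC'⟩ := hθ.exists_deriv_bound
  have i3 : Integrable (fun p => deriv θ p.1 * entropy F (v p)) (cylMeasure d T) :=
    hvm.2.bdd_mul
      ((hθ.smooth.continuous_deriv (by simp)).comp continuous_fst).aestronglyMeasurable
      (ae_of_all _ fun p => hC' p.1)
  rw [cylMeasure_eq] at h1 i3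
  rw [integral_prod _ i3] at h1
  simp only [integral_const_mul] at h1
  exact h1

theorem IsContinuousVersion.integrable_entropy
    (hD : DualPair (entropy F) (legendre (entropy F)) (sharp F) S)
    (hw : IsContinuousVersion F T v w) {t : ℝ} (ht : t ∈ Ico 0 T) :
    Integrable (fun x => entropy F (w (t, x))) volume := by
  simpa only [hD.left_inv] using hD.integrable_comp_inv (hw.mem t ht)

/-- `K = (K ∘ S)(v^#)`, and `K ∘ S` grows at most like `K^*`; so the integral is continuous along
modular, hence along norm, convergence of `v^#`. -/
theorem IsContinuousVersion.continuousOn_totalEntropy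
    (hD : DualPair (entropy F) (legendre (entropy F)) (sharp F) S)
    (hw : IsContinuousVersion F T v w) : ContinuousOn (totalEntropy F w) (Ico 0 T) := by
  rw [continuousOn_iff_continuous_domRestrict, continuous_iff_seqContinuous]
  intro s t hs
  obtain ⟨C, -, hC⟩ := hD.inv_bound
  have hmem : ∀ k, MemOrlicz (legendre (entropy F)) volume
      fun x : Box d => sharp F (w (s k, x)) := fun k => hw.mem _ (s k).2
  have hs' : Tendsto (fun k => (s k : ℝ)) atTop (𝓝[Ico 0 T] (t : ℝ)) :=
    tendsto_nhdsWithin_iff.2 ⟨(continuous_subtype_val.tendsto _).comp hs,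
      Eventually.of_forall fun k => (s k).2⟩
  have h1 := hD.tendsto_integral_comp (f := fun y => entropy F (S y)) (C := C)
    (hD.cont.comp hD.cont_inv) (fun y => by
      rw [abs_of_nonneg (hD.nonneg _)]
      exact hC y) (hw.mem _ t.2) hmem fun M =>
    hD.tendsto_modular_of_tendsto_luxemburg
      (Eventually.of_forall fun k => hD.memOrlicz_sub (hmem k) (hw.mem _ t.2))
      ((hw.continuous _ t.2).comp hs') M
  simp only [hD.left_inv] at h1
  exact h1

theorem IsStrongSolution.totalEntropy_eq
    (hD : DualPair (entropy F) (legendre (entropy F)) (sharp F) S)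
    (hFc : ∀ i j, Continuous fun v => F v i j)
    (hF : ∀ v, ∀ P ∈ Lam ν b, P.PosSemidef → 0 ≤ frob (F v) P)
    (h_cons : FormallyConservative ν b F) (hT : 0 < T) (hκ : IsWeight T κ)
    (hv₀ : MemOrlicz (entropy F) volume v₀) (hv : IsStrongSolution ν b F T κ v₀ v)
    (hw : IsContinuousVersion F T v w) {t : ℝ} (ht : t ∈ Ico 0 T) :
    totalEntropy F w t = totalEntropy F w 0 := by
  obtain ⟨c, hc⟩ := hv.exists_ae_totalEntropy_eq hD hFc hF h_cons hT hκ hv₀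
  have hvw := hw.ae_eq
  rw [cylMeasure_eq] at hvw
  have h1 : totalEntropy F w =ᵐ[volume.restrict (Ico 0 T)] fun _ => c := by
    rw [← Measure.restrict_congr_set Ioo_ae_eq_Ico]
    filter_upwards [hc, Measure.ae_ae_of_ae_prod hvw] with t h1 h2
    rw [← h1]
    refine integral_congr_ae ?_
    filter_upwards [h2] with x hx
    rw [hx]
  -- Continuous functions that agree almost everywhere on `[0,T)` agree everywhere on it, the end
  -- point `0` included.
  have h2 : EqOn (totalEntropy F w) (fun _ => c) (Ico 0 T) :=
    Measure.eqOn_of_ae_eq h1 (hw.continuousOn_totalEntropy hD) continuousOn_const (by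
      rw [interior_Ico, closure_Ioo hT.ne]
      exact Ico_subset_Icc_self)
  rw [h2 ht, h2 ⟨le_rfl, hT⟩]

end Conservation

end EntropyCons

end

/-! ### The theorem -/

theorem mainTheorem5 (d n N ν : ℕ) (b : EntropyCons.Coeff d n N)
    (F : EntropyCons.Vec n → EntropyCons.Mat N)
    (hF_symm : ∀ v, (F v).IsSymm)
    (hF_smooth : ∀ i j, ContDiff ℝ 2 (fun v => F v i j))
    (hF_entropy : EntropyCons.EntropyAssumption F)
    (hF_convex : EntropyCons.LambdaConvex (EntropyCons.Lam ν b) F)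
    (hF_order : EntropyCons.LambdaOrderAssumption (EntropyCons.Lam ν b) F)
    (h_cons : EntropyCons.FormallyConservative ν b F)
    (T : ℝ) (hT : 0 < T) (κ : ℝ → ℝ) (hκ : EntropyCons.IsWeight T κ)
    (v₀ : EntropyCons.Box d → EntropyCons.Vec n)
    (hv₀ : EntropyCons.MemOrlicz (EntropyCons.entropy F) volume v₀)
    (v : ℝ × EntropyCons.Box d → EntropyCons.Vec n)
    (hv : EntropyCons.IsStrongSolution ν b F T κ v₀ v) :
    (∃ w, EntropyCons.IsContinuousVersion F T v w) ∧
    ∀ w, EntropyCons.IsContinuousVersion F T v w →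
      (∀ t ∈ Ico 0 T, Integrable (fun x => EntropyCons.entropy F (w (t, x))) volume) ∧
      ContinuousOn (EntropyCons.totalEntropy F w) (Ico 0 T) ∧
      (∀ t ∈ Ico 0 T, EntropyCons.totalEntropy F w t = EntropyCons.totalEntropy F w 0) ∧
      EntropyCons.totalEntropy F w 0 = ∫ x, EntropyCons.entropy F (v₀ x) := by
  have hK : ContDiff ℝ 2 (EntropyCons.entropy F) := by
    have e : EntropyCons.entropy F = fun v => (1 / 2 : ℝ) * ∑ i, (F v i i - F 0 i i) := rfl
    rw [e]
    exact contDiff_const.mul (ContDiff.sum fun i _ => (hF_smooth i i).sub contDiff_const)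
  obtain ⟨S, hD⟩ := EntropyCons.exists_dualPair hF_entropy.nFunction hF_entropy.strictConvex
    (hK.of_le (by norm_num)) hF_entropy.deltaTwo hF_entropy.deltaTwo_legendre
  replace hD : EntropyCons.DualPair (EntropyCons.entropy F)
    (EntropyCons.legendre (EntropyCons.entropy F)) (EntropyCons.sharp F) S := hD
  refine ⟨hv.exists_isContinuousVersion hD hT hκ, fun w hw =>
    ⟨fun t ht => hw.integrable_entropy hD ht, hw.continuousOn_totalEntropy hD, fun t ht =>
      hv.totalEntropy_eq hD (fun i j => (hF_smooth i j).continuous) hF_order.nonneg h_cons hT hκ hv₀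
        hw ht, ?_⟩⟩
  refine integral_congr_ae ?_
  filter_upwards [hv.initial w hw] with x hx
  -- The initial condition concerns `v^#`; applying `S` recovers the initial value itself.
  rw [← hD.left_inv (w (0, x)), hx, hD.left_inv]
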